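/- Use coordinates $(x_1,x_2,z)$ on $\mathbb{R}^3$. **Gehring ropelength.** A *generalized link* $L$ is a finite family of disjoint rectifiable curves, closed or arcs, where each endpoint $x$ of an arc is constrained to an affine subspace $M_x$, and where $L$ must stay in $\{g_j\ge 0\}$ for finitely many obstacles $\{g_j<0\}$ ($g_j$ of class $C^1$ with regular value $0$). Its Gehring thickness $\mathrm{GThi}(L)$ is the minimal distance between points on different components, pairs attaining it are the Gehring struts, and $O(L)=\min_j\min_{x\in L}g_j(x)$. A continuous vector field $\xi$ along $L$ is *compatible* if it is tangent to $M_x$ at each endpoint $x$. For $L$ of finite total curvature, $\delta_\xi\mathrm{Len}=-\int_L\langle\xi,d\mathcal K\rangle$ is the first variation of length, $\mathcal K$ being the curvature force, a vector-valued Radon measure along $L$. $L$ is *strongly critical* (for minimizing length when constrained by $\mathrm{GThi}$) if there is $\varepsilon>0$ such that $\min(\delta^+_\xi\mathrm{GThi}(L),\delta^+_\xi O(L))\le-\varepsilon$ for all compatible $\xi$ with $\delta_\xi\mathrm{Len}=-1$, where $\delta^+_\xi$ is the one-sided derivative at $t=0^+$ along $L+t\xi$. **Clasp arcs.** Let $0<\tau\le1$,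 $\theta=\arcsin\tau$. For $0\le u\le\tau$ put $$x(u)=\sqrt{\frac{u^2(1-(\tau-u)^2)}{1-u^2(\tau-u)^2}},\qquad x(-u)=-x(u),$$ and let $Z(\varphi)$, for $|\varphi|\le\theta$, be the height determined by $Z(0)=0$ and $dZ=\tan\varphi\;d\big(x(\sin\varphi)\big)$. The curve $\varphi\mapsto(x(\sin\varphi),Z(\varphi))$ is the $\tau$-clasp arc; its tip is at $\varphi=0$. Put $G=Z(\theta)+\sqrt{1-\tau^2}$. **The configuration $L(\tau,d,c)$**, for $d\ge1$ and $c\ge\tau(d/2+G)$. The arc $\gamma$ lies in the $x_2z$-plane: it consists of the clasp arc $(0,x(\sin\varphi),d/2+Z(\varphi))$, $|\varphi|\le\theta$, with tip $(0,0,d/2)$, continued tangentially at both ends by straight segments of length $c-\tau(d/2+G)$ up to the two planes $\pm\sqrt{1-\tau^2}\,x_2+\tau z=c$ (the ceiling), to which its endpoints are constrained. The arc $\beta$, attached to the floor, is the mirror image of $\gamma$ in the plane $z=0$, with the mirror-image constraints. The closed curve $\alpha$ lies in the $x_1z$-plane and is symmetric in the plane $z=0$; its part in $z\ge0$ consists of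 the clasp arc $(x(\sin\varphi),0,d/2+G-Z(\varphi))$, $|\varphi|\le\theta$, of the arcs $(\sin s,0,d/2+\cos s)$, $\theta\le|s|\le\pi/2$, of the unit circle around the tip of $\gamma$ (reduced to points if $\tau=1$), and of the vertical segments from $(\pm1,0,d/2)$ to $(\pm1,0,0)$. The regions beyond the four planes are obstacles. **Theorem.** 1. If $0<\tau<1$ and $c\ge\tau(1/2+G)$, then $L(\tau,1,c)$ is a generalized link with $\mathrm{GThi}=1$ and is strongly critical for Gehring ropelength. The tips of $\beta$ and $\gamma$ form a Gehring strut, which is isolated in the set of struts. 2. If $\tau=1$, then for every $d\ge1$ and every $c\ge d/2+G$, $L(1,d,c)$ is a generalized link with $\mathrm{GThi}=1$ and is strongly critical for Gehring ropelength. For fixed floor and ceiling $z=\pm c$ these form a one-parameter family with parameter $d$, in which the total length is constant, whereas the length of $\alpha$ varies: $\mathrm{Len}(\alpha_{d'})-\mathrm{Len}(\alpha_d)=2(d'-d)$. -/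

import Mathlib

open MeasureTheory Set
open scoped RealInnerProductSpace

noncomputable section

/-- Euclidean three-space, with coordinates `(x₁, x₂, z)`. -/
abbrev E3 : Type := EuclideanSpace ℝ (Fin 3)

/-! ### Generalized links -/

/-- A component of a generalized link: a curve parametrized on `[left, right]` (the values of `path`
elsewhere are irrelevant), either closed, or an arc whose two endpoints are constrained to the
affine subspaces `leftPlane` and `rightPlane` (which play no role for a closed component). -/
structure Strand where
  left : ℝ
  right : ℝ
  path : ℝ → E3
  isClosed : Prop
  leftPlane : AffineSubspace ℝ E3
  rightPlane : AffineSubspace ℝ E3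

/-- The parameter interval of a component. -/
def Strand.dom (C : Strand) : Set ℝ := Icc C.left C.right

/-- The length `∫ ‖c'‖` of a (Lipschitz) parametrized curve `c`. -/
def Strand.length (C : Strand) : ℝ := ∫ s in C.dom, ‖deriv C.path s‖

/-- The data of a generalized link: components indexed by `ι`, and obstacles `{p | g j p < 0}`
indexed by `κ`. -/
structure GeneralizedLink (ι κ : Type) where
  strand : ι → Strand
  obstacle : κ → E3 → ℝ

namespace GeneralizedLink

variable {ι κ : Type}

/-- The conditions under which the data describe a generalized link: Lipschitz parametrized curves
that are regular almost everywhere, closed or with endpoints obeying their constraints, with disjoint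
components, and obstacles given by `C¹` functions with regular value `0` and avoided by the link. -/
structure IsValid (L : GeneralizedLink ι κ) : Prop where
  left_lt_right : ∀ i, (L.strand i).left < (L.strand i).right
  lipschitz : ∀ i, ∃ K, LipschitzOnWith K (L.strand i).path (L.strand i).dom
  regular : ∀ i, ∀ᵐ s : ℝ, s ∈ (L.strand i).dom → deriv (L.strand i).path s ≠ 0
  closes_up : ∀ i, (L.strand i).isClosed →
    (L.strand i).path (L.strand i).left = (L.strand i).path (L.strand i).right
  left_mem : ∀ i, ¬ (L.strand i).isClosed →
    (L.strand i).path (L.strand i).left ∈ (L.strand i).leftPlane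
  right_mem : ∀ i, ¬ (L.strand i).isClosed →
    (L.strand i).path (L.strand i).right ∈ (L.strand i).rightPlane
  disjoint : ∀ i j, i ≠ j →
    Disjoint ((L.strand i).path '' (L.strand i).dom) ((L.strand j).path '' (L.strand j).dom)
  contDiff_obstacle : ∀ j, ContDiff ℝ 1 (L.obstacle j)
  regular_obstacle : ∀ j p, L.obstacle j p = 0 → fderiv ℝ (L.obstacle j) p ≠ 0
  avoids : ∀ j i, ∀ s ∈ (L.strand i).dom, 0 ≤ L.obstacle j ((L.strand i).path s)

/-- Total length. -/
def length [Fintype ι] (L : GeneralizedLink ι κ) : ℝ := ∑ i, (L.strand i).length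

/-- The Gehring thickness: the minimal distance between points on different components. -/
def gThi (L : GeneralizedLink ι κ) : ℝ :=
  sInf {r | ∃ i j, i ≠ j ∧ ∃ s ∈ (L.strand i).dom, ∃ t ∈ (L.strand j).dom,
    r = dist ((L.strand i).path s) ((L.strand j).path t)}

/-- The Gehring struts, as ordered pairs of points (each unordered strut occurs in both orders). -/
def gStrut (L : GeneralizedLink ι κ) : Set (E3 × E3) :=
  {p | ∃ i j, i ≠ j ∧ ∃ s ∈ (L.strand i).dom, ∃ t ∈ (L.strand j).dom,
    p = ((L.strand i).path s, (L.strand j).path t) ∧ dist p.1 p.2 = L.gThi}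

/-- The obstacle function `O(L)`: the minimum of all the obstacle functions along the link. -/
def obstacleMin (L : GeneralizedLink ι κ) : ℝ :=
  sInf {r | ∃ j i, ∃ s ∈ (L.strand i).dom, r = L.obstacle j ((L.strand i).path s)}

/-- The space of compatible vector fields: `ξ` is continuous along the link, and tangent to the
constraint subspaces at the endpoints of arcs. -/
def Compatible (L : GeneralizedLink ι κ) (ξ : ι → ℝ → E3) : Prop :=
  ∀ i, ContinuousOn (ξ i) (L.strand i).dom ∧
    ((L.strand i).isClosed → ξ i (L.strand i).left = ξ i (L.strand i).right) ∧
    (¬ (L.strand i).isClosed →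
      ξ i (L.strand i).left ∈ (L.strand i).leftPlane.direction ∧
      ξ i (L.strand i).right ∈ (L.strand i).rightPlane.direction)

/-- The variation `L + t ξ` of a link. -/
def vary (L : GeneralizedLink ι κ) (ξ : ι → ℝ → E3) (t : ℝ) : GeneralizedLink ι κ where
  strand i := { L.strand i with path := fun s => (L.strand i).path s + t • ξ i s }
  obstacle := L.obstacle

/-- The pairing `∫_L ⟨ξ, 𝒦⟩` of a vector field with a vector-valued measure along the link; the
latter is written in polar form, with density `ν i` with respect to a positive measure `μ i`. -/
def forcePairing [Fintype ι] (L : GeneralizedLink ι κ) (μ : ι → Measure ℝ) (ν ξ : ι → ℝ → E3) : ℝ :=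
  ∑ i, ∫ s in (L.strand i).dom, ⟪ξ i s, ν i s⟫ ∂(μ i)

/-- `L` has finite total curvature and the vector-valued Radon measure `𝒦 = ν μ` is its curvature
force: the derivative of length in the direction of a compatible `ξ` is `-∫_L ⟨ξ, 𝒦⟩`. This is
tested on the Lipschitz fields `ξ`, for which the length of `L + t ξ` makes sense; they are uniformly
dense in the continuous ones, so that the pairing with compatible fields is determined by `L`. -/
def IsCurvatureForce [Fintype ι] (L : GeneralizedLink ι κ) (μ : ι → Measure ℝ)
    (ν : ι → ℝ → E3) : Prop :=
  (∀ i, IsFiniteMeasure (μ i) ∧ Integrable (ν i) (μ i)) ∧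
  ∀ ξ : ι → ℝ → E3, L.Compatible ξ →
    (∀ i, ∃ K, LipschitzOnWith K (ξ i) (L.strand i).dom) →
    HasDerivAt (fun t => (L.vary ξ t).length) (-L.forcePairing μ ν ξ) 0

/-- Strong criticality for minimizing length when constrained by Gehring thickness: there is `ε > 0`
such that for every compatible `ξ` with `δ_ξ Len = -1`, the one-sided first variations of `gThi` and
of `O` in direction `ξ` (which are part of the claim) satisfy
`min (δ⁺_ξ gThi) (δ⁺_ξ O) ≤ -ε`. -/
def IsStronglyCritical [Fintype ι] (L : GeneralizedLink ι κ) : Prop :=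
  ∃ (μ : ι → Measure ℝ) (ν : ι → ℝ → E3), L.IsCurvatureForce μ ν ∧
    ∃ ε : ℝ, 0 < ε ∧ ∀ ξ : ι → ℝ → E3, L.Compatible ξ → -L.forcePairing μ ν ξ = -1 →
      ∃ p q : ℝ,
        HasDerivWithinAt (fun t => (L.vary ξ t).gThi) p (Ici 0) 0 ∧
        HasDerivWithinAt (fun t => (L.vary ξ t).obstacleMin) q (Ici 0) 0 ∧
        min p q ≤ -ε

end GeneralizedLink

/-! ### The clasp arcs -/

/-- The horizontal coordinate of a `τ`-clasp arc, as a function of the vertical component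
`u ∈ [-τ, τ]` of its unit tangent vector: contact points of the two arcs satisfy `|u₁| + |u₂| = τ`,
and `x₁² = u₁² (1 - u₂²) / (1 - u₁² u₂²)`. -/
def claspX (τ u : ℝ) : ℝ :=
  u * √((1 - (τ - |u|) ^ 2) / (1 - u ^ 2 * (τ - |u|) ^ 2))

/-- The height above its tip of the point of a `τ`-clasp arc where the tangent makes angle `φ` with
the horizontal. As `u = sin φ`, the defining relation `dz / dx = u / √(1 - u²) = tan φ` reads
`dz = tan φ · x'(u) cos φ dφ = sin φ · x'(sin φ) dφ`. -/
def claspZ (τ φ : ℝ) : ℝ :=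
  ∫ ψ in (0 : ℝ)..φ, Real.sin ψ * deriv (claspX τ) (Real.sin ψ)

/-- The vertical distance between the tips of the two arcs of a `τ`-clasp (the tip of one arc is at
distance one from the two points of the other arc where `u = ±τ`). -/
def claspGap (τ : ℝ) : ℝ := claspZ τ (Real.arcsin τ) + √(1 - τ ^ 2)

/-! ### The chained clasp -/

/-- Reflection in the horizontal plane `z = 0`. -/
def reflZ (p : E3) : E3 := !₂[p 0, p 1, -p 2]

/-- The arc `γ`, in the `x₂z`-plane, with lowest point `(0, 0, d/2)`: a `τ`-clasp arc (parametrized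
by the angle of its tangent) continued by straight segments (parametrized by arclength). -/
def gammaPath (τ d s : ℝ) : E3 :=
  if |s| ≤ Real.arcsin τ then !₂[0, claspX τ (Real.sin s), d / 2 + claspZ τ s]
  else !₂[0,
    SignType.sign s * (τ + (|s| - Real.arcsin τ) * √(1 - τ ^ 2)),
    d / 2 + claspZ τ (Real.arcsin τ) + (|s| - Real.arcsin τ) * τ]

/-- The upper half of `α`, in the `x₁z`-plane, from `(-1, 0, 0)` to `(1, 0, 0)`: in the middle a
`τ`-clasp arc, on both sides of it arcs of the unit circle around the tip `(0, 0, d/2)` of `γ`, and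
outside these vertical segments. -/
def alphaUpper (τ d s : ℝ) : E3 :=
  if |s| ≤ Real.arcsin τ then
    !₂[claspX τ (Real.sin s), 0, d / 2 + claspGap τ - claspZ τ s]
  else if |s| ≤ Real.pi / 2 then
    !₂[Real.sin s, 0, d / 2 + Real.cos s]
  else
    !₂[SignType.sign s, 0, d / 2 - (|s| - Real.pi / 2)]

/-- The closed curve `α`, parametrized on `[-h, 3h]` where `h = π/2 + d/2`: its upper half followed
by the mirror image of the upper half. -/
def alphaPath (τ d s : ℝ) : E3 :=
  if s ≤ Real.pi / 2 + d / 2 then alphaUpper τ d s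
  else reflZ (alphaUpper τ d (2 * (Real.pi / 2 + d / 2) - s))

/-- Outer unit normals of the four walls, at angle `arcsin τ` with the horizontal; the signs of `σ`
and `ρ` distinguish the four walls (`ρ = 1` for the ceiling, `ρ = -1` for the floor). -/
def wallNormal (τ σ ρ : ℝ) : E3 := !₂[0, σ * √(1 - τ ^ 2), ρ * τ]

/-- The plane at distance `c` from the origin with unit normal `n`. -/
def wallPlane (n : E3) (c : ℝ) : AffineSubspace ℝ E3 :=
  AffineSubspace.mk' (c • n) (Submodule.span ℝ {n})ᗮ

/-- The function that is negative beyond the wall with unit normal `n` at distance `c`. -/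
def wallFun (n : E3) (c : ℝ) (p : E3) : ℝ := c - ⟪n, p⟫

/-- The length of the straight ends of `β` and `γ`, when the walls are at distance `c` from the
origin. -/
def endLength (τ d c : ℝ) : ℝ := c - τ * (d / 2 + claspGap τ)

/-- The configuration of the chained clasp with walls at distance `c` from the origin and with the
tips of `β` and `γ` at distance `d`. The components are `α` (index `0`), `β` (index `1`, attached to
the floor) and `γ` (index `2`, attached to the ceiling). The region beyond the walls is an
obstacle. -/
def chainedClasp (τ d c : ℝ) : GeneralizedLink (Fin 3) (Fin 4) where
  strand :=
    ![{ left := -(Real.pi / 2 + d / 2)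
        right := 3 * (Real.pi / 2 + d / 2)
        path := alphaPath τ d
        isClosed := True
        leftPlane := ⊤
        rightPlane := ⊤ },
      { left := -(Real.arcsin τ + endLength τ d c)
        right := Real.arcsin τ + endLength τ d c
        path := fun s => reflZ (gammaPath τ d s)
        isClosed := False
        leftPlane := wallPlane (wallNormal τ (-1) (-1)) c
        rightPlane := wallPlane (wallNormal τ 1 (-1)) c },
      { left := -(Real.arcsin τ + endLength τ d c)
        right := Real.arcsin τ + endLength τ d c
        path := gammaPath τ d
        isClosed := False
        leftPlane := wallPlane (wallNormal τ (-1) 1) c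
        rightPlane := wallPlane (wallNormal τ 1 1) c }]
  obstacle :=
    ![wallFun (wallNormal τ (-1) (-1)) c, wallFun (wallNormal τ 1 (-1)) c,
      wallFun (wallNormal τ (-1) 1) c, wallFun (wallNormal τ 1 1) c]

end

open MeasureTheory Set
open scoped RealInnerProductSpace

noncomputable section

/-! Strong criticality is a quantitative balance of forces. A compatible field `ξ` with length
variation `-1` has pairing `1` with the curvature force. Suppose that this force is transmitted by a
positive measure on the struts. If every strut lengthens at a rate at least `p`, integration against
that measure bounds the pairing by `-p` times the mass of the measure, so `p` lies below a negative
constant. The walls play no part in the estimate: the ends of `β` and `γ` meet them at right angles,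
so the boundary terms in the variation of length vanish. The variation of the obstacle function only
has to exist.

The clasp arcs are parametrized by the angle of the tangent, in which the unit tangent is Lipschitz
and its derivative is the density of the curvature force. With `u` the sine of the angle, the angle
element is `du / √(1 - u²)`, so the vertical component of the curvature force is `± du`. The points
with `|u| = a` on `γ` and `|u| = τ - a` on `α` are in contact: two points on each arc, joined by
four struts with components `± claspX τ (τ - a)`, `± claspX τ a` and `H = contactHeight τ a`. The
formula for `claspX` makes the struts orthogonal to both arcs, that is, `claspX τ a * √(1 - a²) = a
* H` (`claspX_mul_sqrt`). Three facts rest on this. The heights of points in contact fit together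
for all `a` (`claspGap_eq`). The squared distance from a fixed point of one arc decreases along the
other up to the contact point and increases after it (`one_le_clasp_dist_sq_of_nonneg`). The weight
`1 / (2 H)` on each of the four struts balances the curvature of both arcs (`contact_balance`).

The circular arcs of `α` are joined to the tip of `γ` by struts of weight one per unit angle. Their
horizontal components cancel at the tip, and the vertical ones leave a force `2 (1 - τ)` that pushes
the tip of `γ` towards that of `β` (`clasp_balance`); by symmetry the opposite force acts on `β`. If
`τ < 1`, then `d = 1` makes the segment between the tips a strut, which carries this force. If `τ =
1`, there is no such force and `d` is free. The lengths show the same thing: as `d` grows with the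
walls fixed, `α` gains `2 d` while `β` and `γ` together lose `2 τ d`.

The remaining analysis consists of Danskin's theorem, which yields the one-sided derivative of the
thickness, and of the first variation of length (`hasDerivAt_length_vary`). -/

/-! ### Differentiating a minimum over a compact family -/

/-- **Danskin's theorem** for families depending quadratically on the parameter: the minimum over a
compact family has a one-sided derivative, which is the least derivative of an active member. -/
theorem hasDerivWithinAt_iInf_quadratic {X : Type*} [TopologicalSpace X] [CompactSpace X]
    [Nonempty X] {A B C : X → ℝ} (hA : Continuous A) (hB : Continuous B) (hC : Continuous C) :
    ∃ p, HasDerivWithinAt (fun t : ℝ => ⨅ k, A k + t * B k + t ^ 2 * C k) p (Ici 0) 0 ∧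
      ∀ k, A k = ⨅ k, A k → p ≤ B k := by
  obtain ⟨k₀, -, hk₀⟩ := isCompact_univ.exists_isMinOn univ_nonempty hA.continuousOn
  have hmin : ∀ k, A k₀ ≤ A k := fun k => hk₀ (mem_univ k)
  have hbdd : ∀ {F : X → ℝ}, Continuous F → BddBelow (range F) := fun hF => by
    simpa using (isCompact_univ.image hF).bddBelow
  have hinf : ⨅ k, A k = A k₀ := le_antisymm (ciInf_le (hbdd hA) k₀) (le_ciInf hmin)
  have hS : IsCompact {k | A k = A k₀} := (isClosed_eq hA continuous_const).isCompact
  obtain ⟨k₁, hk₁, hk₁'⟩ := hS.exists_isMinOn ⟨k₀, rfl⟩ hB.continuousOn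
  have hk₁A : A k₁ = A k₀ := hk₁
  have hBmin : ∀ k, A k = A k₀ → B k₁ ≤ B k := fun k hk => hk₁' hk
  refine ⟨B k₁, ?_, fun k hk => hBmin k (hk.trans hinf)⟩
  obtain ⟨M₁, hM₁⟩ := isCompact_univ.exists_bound_of_continuousOn hB.continuousOn
  obtain ⟨M₂, hM₂⟩ := isCompact_univ.exists_bound_of_continuousOn hC.continuousOn
  obtain ⟨M, hM, hBM, hCM⟩ : ∃ M : ℝ, 0 < M ∧ (∀ k, |B k| ≤ M) ∧ ∀ k, |C k| ≤ M :=
    ⟨max 1 (max M₁ M₂), by positivity,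
      fun k => (hM₁ k (mem_univ k)).trans ((le_max_left _ _).trans (le_max_right _ _)),
      fun k => (hM₂ k (mem_univ k)).trans ((le_max_right _ _).trans (le_max_right _ _))⟩
  rw [hasDerivWithinAt_iff_isLittleO, Asymptotics.isLittleO_iff]
  intro ε hε
  -- Members whose derivative is smaller than `B k₁` by `ε / 2` cannot be active. They form a
  -- compact set, so their values exceed the minimum by a uniform gap `δ`.
  obtain ⟨δ, hδ, hδA⟩ : ∃ δ > 0, ∀ k, B k ≤ B k₁ - ε / 2 → A k₀ + δ ≤ A k := by
    have hT : IsCompact {k | B k ≤ B k₁ - ε / 2} := (isClosed_le hB continuous_const).isCompact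
    rcases eq_empty_or_nonempty {k | B k ≤ B k₁ - ε / 2} with he | hne
    · exact ⟨1, one_pos, fun k hk =>
        absurd (show k ∈ {k | B k ≤ B k₁ - ε / 2} from hk) (by simp [he])⟩
    · obtain ⟨k₂, hk₂, hk₂'⟩ := hT.exists_isMinOn hne hA.continuousOn
      refine ⟨A k₂ - A k₀, sub_pos.2 (lt_of_le_of_ne (hmin k₂) fun h => ?_), fun k hk => ?_⟩
      · have := hBmin k₂ h.symm
        have : B k₂ ≤ B k₁ - ε / 2 := hk₂
        linarith
      · have : A k₂ ≤ A k := hk₂' hk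
        linarith
  -- The bound `t * M < ε / 2` absorbs the quadratic term of members near the minimum. The bound `3
  -- * t * M < δ`, with `t < 1`, keeps the members beyond the gap from competing: their two linear
  -- terms and one quadratic term are each at most `t * M`.
  have hsmall : ∀ᶠ t : ℝ in nhdsWithin 0 (Ici 0),
      0 ≤ t ∧ t < 1 ∧ t < ε / 2 / M ∧ t < δ / (3 * M) := by
    refine Filter.Eventually.and self_mem_nhdsWithin (nhdsWithin_le_nhds ?_)
    exact (eventually_lt_nhds one_pos).and
      ((eventually_lt_nhds (by positivity)).and (eventually_lt_nhds (by positivity)))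
  filter_upwards [hsmall] with t ⟨ht0, ht1, ht2, ht3⟩
  rw [lt_div_iff₀ hM] at ht2
  rw [lt_div_iff₀ (by positivity)] at ht3
  have hFc : Continuous fun k => A k + t * B k + t ^ 2 * C k := by fun_prop
  have hup : ⨅ k, A k + t * B k + t ^ 2 * C k ≤ A k₀ + t * B k₁ + ε * t := by
    refine (ciInf_le (hbdd hFc) k₁).trans ?_
    have := (abs_le.1 (hCM k₁)).2
    rw [hk₁A]
    nlinarith [mul_nonneg ht0 ht0]
  have hlow : A k₀ + t * B k₁ - ε * t ≤ ⨅ k, A k + t * B k + t ^ 2 * C k := by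
    refine le_ciInf fun k => ?_
    have hCk := (abs_le.1 (hCM k)).1
    have h2 : - (t * (t * M)) ≤ t ^ 2 * C k := by nlinarith [mul_nonneg ht0 ht0]
    rcases le_or_gt (B k) (B k₁ - ε / 2) with h | h
    · have h1 := hδA k h
      have h3 := mul_le_mul_of_nonneg_left (abs_le.1 (hBM k)).1 ht0
      have h4 := mul_le_mul_of_nonneg_left (abs_le.1 (hBM k₁)).2 ht0
      nlinarith [mul_nonneg ht0 hM.le, mul_nonneg ht0 hε.le]
    · have h1 := hmin k
      nlinarith [mul_le_mul_of_nonneg_left h.le ht0]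
  have h0 : ⨅ k, A k + (0 : ℝ) * B k + (0 : ℝ) ^ 2 * C k = A k₀ := by simpa using hinf
  rw [h0, Real.norm_eq_abs, Real.norm_eq_abs, sub_zero, abs_of_nonneg ht0, smul_eq_mul, abs_le]
  constructor <;> linarith

theorem hasDerivWithinAt_sInf_quadratic {X : Type*} [TopologicalSpace X] {K : Set X}
    (hK : IsCompact K) (hne : K.Nonempty) {A B C : X → ℝ} (hA : ContinuousOn A K)
    (hB : ContinuousOn B K) (hC : ContinuousOn C K) :
    ∃ p, HasDerivWithinAt (fun t : ℝ => sInf ((fun k => A k + t * B k + t ^ 2 * C k) '' K)) p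
      (Ici 0) 0 ∧ ∀ k ∈ K, A k = sInf (A '' K) → p ≤ B k := by
  have := isCompact_iff_compactSpace.1 hK
  have := hne.to_subtype
  obtain ⟨p, hp, hp'⟩ := hasDerivWithinAt_iInf_quadratic (X := K) hA.domRestrict hB.domRestrict
    hC.domRestrict
  refine ⟨p, ?_, fun k hk h => hp' ⟨k, hk⟩ ?_⟩
  · convert hp using 2 with t
    rw [sInf_image']
    rfl
  · rw [domRestrict_apply, h, sInf_image']
    rfl

/-- The square root commutes with the minimum of a compact set of squares. -/
theorem sInf_image_sqrt {X : Type*} [TopologicalSpace X] {K : Set X} (hK : IsCompact K)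
    (hne : K.Nonempty) {F : X → ℝ} (hF : ContinuousOn F K) :
    sInf ((fun k => √(F k)) '' K) = √(sInf (F '' K)) := by
  obtain ⟨k, hk, hk'⟩ := hK.exists_isMinOn hne hF
  have h1 : IsLeast (F '' K) (F k) :=
    ⟨mem_image_of_mem _ hk, by rintro _ ⟨l, hl, rfl⟩; exact hk' hl⟩
  have h2 : IsLeast ((fun k => √(F k)) '' K) √(F k) :=
    ⟨mem_image_of_mem (fun k => √(F k)) hk,
      by rintro _ ⟨l, hl, rfl⟩; exact Real.sqrt_le_sqrt (hk' hl)⟩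
  rw [h1.csInf_eq, h2.csInf_eq]

/-! ### First variations of the Gehring thickness and of the obstacle function -/

namespace GeneralizedLink

variable {ι κ : Type}

/-- Pairs of parameters of points on different components. -/
def pairs (L : GeneralizedLink ι κ) : Set (ι × ι × ℝ × ℝ) :=
  {k | k.1 ≠ k.2.1 ∧ k.2.2.1 ∈ (L.strand k.1).dom ∧ k.2.2.2 ∈ (L.strand k.2.1).dom}

/-- Squared distances along `L + t ξ` are quadratic polynomials in `t`. Danskin's theorem applies to
them, and the square root is then moved outside the infimum. -/
theorem gThi_eq_sInf (L : GeneralizedLink ι κ) (ξ : ι → ℝ → E3) (t : ℝ) :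
    (L.vary ξ t).gThi = sInf ((fun k : ι × ι × ℝ × ℝ =>
      √(‖(L.strand k.1).path k.2.2.1 - (L.strand k.2.1).path k.2.2.2‖ ^ 2 +
        t * (2 * ⟪(L.strand k.1).path k.2.2.1 - (L.strand k.2.1).path k.2.2.2,
          ξ k.1 k.2.2.1 - ξ k.2.1 k.2.2.2⟫) +
        t ^ 2 * ‖ξ k.1 k.2.2.1 - ξ k.2.1 k.2.2.2‖ ^ 2)) '' L.pairs) := by
  have key : ∀ (x y u v : E3), √(‖x - y‖ ^ 2 + t * (2 * ⟪x - y, u - v⟫) + t ^ 2 * ‖u - v‖ ^ 2) =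
      dist (x + t • u) (y + t • v) := by
    intro x y u v
    rw [dist_eq_norm, show x + t • u - (y + t • v) = (x - y) + t • (u - v) by module,
      ← Real.sqrt_sq (norm_nonneg ((x - y) + t • (u - v))), norm_add_sq_real,
      real_inner_smul_right, norm_smul, mul_pow, Real.norm_eq_abs, sq_abs]
    ring_nf
  simp only [key]
  unfold gThi
  congr 1
  ext r
  constructor
  · rintro ⟨i, j, hij, s, hs, s', hs', rfl⟩
    exact ⟨(i, j, s, s'), ⟨hij, hs, hs'⟩, rfl⟩
  · rintro ⟨⟨i, j, s, s'⟩, ⟨hij, hs, hs'⟩, rfl⟩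
    exact ⟨i, j, hij, s, hs, s', hs', rfl⟩

theorem isCompact_pairs [TopologicalSpace ι] [Finite ι]
    (L : GeneralizedLink ι κ) : IsCompact L.pairs := by
  have : L.pairs = ⋃ i, ⋃ j, ⋃ (_ : i ≠ j), (fun p : ℝ × ℝ => (i, j, p)) ''
      ((L.strand i).dom ×ˢ (L.strand j).dom) := by
    ext ⟨i, j, s, t⟩
    simp only [pairs, mem_ofPred_eq, mem_iUnion, mem_image, mem_prod, Prod.exists, Prod.mk.injEq]
    constructor
    · rintro ⟨h, hs, ht⟩
      exact ⟨i, j, h, s, t, ⟨hs, ht⟩, rfl, rfl, rfl, rfl⟩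
    · rintro ⟨i', j', h, s', t', ⟨hs, ht⟩, rfl, rfl, rfl, rfl⟩
      exact ⟨h, hs, ht⟩
  rw [this]
  refine isCompact_iUnion fun i => isCompact_iUnion fun j => isCompact_iUnion fun _ => ?_
  exact (isCompact_Icc.prod isCompact_Icc).image (by fun_prop)

theorem continuousOn_pairs [TopologicalSpace ι] [DiscreteTopology ι]
    {L : GeneralizedLink ι κ} {η : ι → ℝ → E3}
    (hη : ∀ i, ContinuousOn (η i) (L.strand i).dom) :
    ContinuousOn (fun k : ι × ι × ℝ × ℝ => η k.1 k.2.2.1 - η k.2.1 k.2.2.2) L.pairs := by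
  rw [continuousOn_prod_of_discrete_left]
  intro i
  rw [continuousOn_prod_of_discrete_left]
  intro j
  refine ContinuousOn.sub ((hη i).comp continuousOn_fst ?_) ((hη j).comp continuousOn_snd ?_)
  · exact fun p hp => hp.2.1
  · exact fun p hp => hp.2.2

/-- The one-sided first variation of Gehring thickness exists, and is at most the first variation
of the length of each strut. -/
theorem exists_hasDerivWithinAt_gThi [TopologicalSpace ι] [DiscreteTopology ι] [Finite ι]
    {L : GeneralizedLink ι κ}
    (hc : ∀ i, ContinuousOn (L.strand i).path (L.strand i).dom) (h1 : L.gThi = 1)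
    (hne : L.pairs.Nonempty) {ξ : ι → ℝ → E3} (hξ : ∀ i, ContinuousOn (ξ i) (L.strand i).dom) :
    ∃ p, HasDerivWithinAt (fun t => (L.vary ξ t).gThi) p (Ici 0) 0 ∧
      ∀ i j s t, i ≠ j → s ∈ (L.strand i).dom → t ∈ (L.strand j).dom →
        ‖(L.strand i).path s - (L.strand j).path t‖ = 1 →
        p ≤ ⟪(L.strand i).path s - (L.strand j).path t, ξ i s - ξ j t⟫ := by
  have hcP := continuousOn_pairs hc
  have hcX := continuousOn_pairs hξ
  set A : ι × ι × ℝ × ℝ → ℝ := fun k =>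
    ‖(L.strand k.1).path k.2.2.1 - (L.strand k.2.1).path k.2.2.2‖ ^ 2 with hAdef
  set B : ι × ι × ℝ × ℝ → ℝ := fun k =>
    2 * ⟪(L.strand k.1).path k.2.2.1 - (L.strand k.2.1).path k.2.2.2,
          ξ k.1 k.2.2.1 - ξ k.2.1 k.2.2.2⟫ with hBdef
  set C : ι × ι × ℝ × ℝ → ℝ := fun k => ‖ξ k.1 k.2.2.1 - ξ k.2.1 k.2.2.2‖ ^ 2 with hCdef
  have hA : ContinuousOn A L.pairs := hcP.norm.pow 2
  have hB : ContinuousOn B L.pairs := continuousOn_const.mul (hcP.inner hcX)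
  have hC : ContinuousOn C L.pairs := hcX.norm.pow 2
  obtain ⟨p, hp, hp'⟩ := hasDerivWithinAt_sInf_quadratic L.isCompact_pairs hne hA hB hC
  have hg : (fun t => (L.vary ξ t).gThi) = fun t : ℝ =>
      √(sInf ((fun k => A k + t * B k + t ^ 2 * C k) '' L.pairs)) := by
    funext t
    rw [gThi_eq_sInf]
    refine sInf_image_sqrt L.isCompact_pairs hne (F := fun k => A k + t * B k + t ^ 2 * C k) ?_
    exact (hA.add (continuousOn_const.mul hB)).add (continuousOn_const.mul hC)
  have hv0 : (L.vary ξ 0).gThi = 1 := by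
    rw [← h1]
    simp [vary]
  have hA1 : sInf (A '' L.pairs) = 1 := by
    have := congrFun hg 0
    simp only [hv0, zero_mul, add_zero, ne_eq, OfNat.ofNat_ne_zero, not_false_eq_true, zero_pow]
      at this
    exact (Real.sqrt_eq_one).1 this.symm
  have hs0 : sInf ((fun k => A k + (0 : ℝ) * B k + (0 : ℝ) ^ 2 * C k) '' L.pairs) = 1 := by
    simpa using hA1
  refine ⟨p / (2 * √1), ?_, ?_⟩
  · rw [hg]
    have := hp.sqrt (by rw [hs0]; norm_num)
    simp only [hs0] at this
    exact this
  · intro i j s t hij hs ht hst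
    have := hp' (i, j, s, t) ⟨hij, hs, ht⟩ (by rw [hA1]; simp [hAdef, hst])
    rw [Real.sqrt_one]
    simp only [hBdef] at this
    linarith

end GeneralizedLink

namespace GeneralizedLink

/-- The one-sided first variation of the obstacle function exists if the obstacles are
half-spaces. -/
theorem exists_hasDerivWithinAt_obstacleMin {ι κ : Type} [TopologicalSpace ι] [DiscreteTopology ι]
    [Finite ι] [Nonempty ι] [TopologicalSpace κ] [DiscreteTopology κ] [Finite κ] [Nonempty κ]
    {L : GeneralizedLink ι κ} (hdom : ∀ i, (L.strand i).left ≤ (L.strand i).right)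
    (hc : ∀ i, ContinuousOn (L.strand i).path (L.strand i).dom)
    {n : κ → E3} {c : κ → ℝ} (hn : ∀ j, L.obstacle j = wallFun (n j) (c j)) {ξ : ι → ℝ → E3}
    (hξ : ∀ i, ContinuousOn (ξ i) (L.strand i).dom) :
    ∃ q, HasDerivWithinAt (fun t => (L.vary ξ t).obstacleMin) q (Ici 0) 0 := by
  set K : Set (κ × ι × ℝ) := {k | k.2.2 ∈ (L.strand k.2.1).dom} with hKdef
  have hK : IsCompact K := by
    have : K = ⋃ j, ⋃ i, (fun s : ℝ => (j, i, s)) '' (L.strand i).dom := by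
      ext ⟨j, i, s⟩
      simp only [hKdef, mem_ofPred_eq, mem_iUnion, mem_image, Prod.mk.injEq]
      constructor
      · intro h
        exact ⟨j, i, s, h, rfl, rfl, rfl⟩
      · rintro ⟨j', i', s', h, rfl, rfl, rfl⟩
        exact h
    rw [this]
    exact isCompact_iUnion fun j => isCompact_iUnion fun i => isCompact_Icc.image (by fun_prop)
  have hcont : ∀ {η : ι → ℝ → E3}, (∀ i, ContinuousOn (η i) (L.strand i).dom) →
      ContinuousOn (fun k : κ × ι × ℝ => ⟪n k.1, η k.2.1 k.2.2⟫) K := by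
    intro η hη
    rw [continuousOn_prod_of_discrete_left]
    intro j
    rw [continuousOn_prod_of_discrete_left]
    intro i
    exact (continuous_const (y := n j)).continuousOn.inner ((hη i).mono fun s hs => hs)
  have hcc : Continuous fun k : κ × ι × ℝ => c k.1 :=
    continuous_of_discreteTopology.comp continuous_fst
  -- Wall functions are affine, so the quadratic coefficient is zero. Only existence of the
  -- derivative is kept, because the bound on the minimum will come from the thickness.
  obtain ⟨q, hq, -⟩ := hasDerivWithinAt_sInf_quadratic hK
    ⟨(Classical.arbitrary κ, Classical.arbitrary ι, (L.strand (Classical.arbitrary ι)).left),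
      left_mem_Icc.2 (hdom _)⟩
    (hcc.continuousOn.sub (hcont hc)) (hcont hξ).neg (continuousOn_const (c := (0 : ℝ)))
  refine ⟨q, ?_⟩
  convert hq using 2 with t
  unfold obstacleMin
  congr 1
  have key : ∀ (j : κ) (x u : E3), c j - ⟪n j, x⟫ + t * (-⟪n j, u⟫) + t ^ 2 * 0 =
      wallFun (n j) (c j) (x + t • u) := by
    intro j x u
    rw [wallFun, inner_add_right, real_inner_smul_right]
    ring
  ext r
  simp only [mem_image, Pi.neg_apply, Pi.sub_apply, key]
  constructor
  · rintro ⟨j, i, s, hs, rfl⟩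
    exact ⟨(j, i, s), hs, by simp [vary, hn]⟩
  · rintro ⟨⟨j, i, s⟩, hs, rfl⟩
    exact ⟨j, i, s, hs, by simp [vary, hn]⟩

end GeneralizedLink

/-! ### The first variation of length -/

theorem hasDerivAt_norm_add_smul {E : Type*} [NormedAddCommGroup E] [InnerProductSpace ℝ E]
    {x : E} (hx : x ≠ 0) (y : E) :
    HasDerivAt (fun t : ℝ => ‖x + t • y‖) (⟪x, y⟫ / ‖x‖) 0 := by
  have h : HasDerivAt (fun t : ℝ => x + t • y) y 0 := by
    simpa using ((hasDerivAt_id (0 : ℝ)).smul_const y).const_add x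
  have h2 := h.norm_sq.sqrt (by simpa using hx)
  simp only [zero_smul, add_zero, Real.sqrt_sq (norm_nonneg _)] at h2
  convert h2 using 1
  have : ‖x‖ ≠ 0 := norm_ne_zero_iff.2 hx
  field_simp

theorem ae_mem_Ioo_of_mem_Icc (a b : ℝ) : ∀ᵐ s : ℝ, s ∈ Icc a b → s ∈ Ioo a b := by
  filter_upwards [compl_mem_ae_iff.2 (measure_singleton a),
    compl_mem_ae_iff.2 (measure_singleton b)]
    with s ha hb h
  exact ⟨lt_of_le_of_ne h.1 fun h => ha h.symm, lt_of_le_of_ne h.2 fun h => hb h⟩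

theorem LipschitzOnWith.ae_differentiableAt_Icc {V : Type*} [NormedAddCommGroup V]
    [NormedSpace ℝ V] [FiniteDimensional ℝ V] {K : NNReal} {f : ℝ → V} {a b : ℝ}
    (hf : LipschitzOnWith K f (Icc a b)) : ∀ᵐ s : ℝ, s ∈ Icc a b → DifferentiableAt ℝ f s := by
  filter_upwards [hf.ae_differentiableWithinAt_of_mem_real,
    ae_mem_Ioo_of_mem_Icc a b] with s h h' hs
  exact (h hs).differentiableAt (Icc_mem_nhds (h' hs).1 (h' hs).2)

/-- Boundedness of the derivative of a Lipschitz function makes it integrable. -/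
theorem LipschitzOnWith.integrableOn_deriv {K : NNReal} {f : ℝ → E3} {a b : ℝ}
    (hf : LipschitzOnWith K f (Icc a b)) : IntegrableOn (deriv f) (Icc a b) := by
  refine Integrable.mono' (g := fun _ => (K : ℝ)) (integrableOn_const (by simp))
    (measurable_deriv f).aestronglyMeasurable ?_
  rw [ae_restrict_iff' measurableSet_Icc]
  filter_upwards [ae_mem_Ioo_of_mem_Icc a b] with s h hs
  exact norm_deriv_le_of_lipschitzOn (Icc_mem_nhds (h hs).1 (h hs).2) hf

theorem LipschitzOnWith.exists_inner {K K' : NNReal} {f g : ℝ → E3} {a b : ℝ}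
    (hf : LipschitzOnWith K f (Icc a b)) (hg : LipschitzOnWith K' g (Icc a b)) :
    ∃ K'', LipschitzOnWith K'' (fun s => ⟪f s, g s⟫) (Icc a b) := by
  obtain ⟨M, hM⟩ := isCompact_Icc.exists_bound_of_continuousOn hf.continuousOn
  obtain ⟨M', hM'⟩ := isCompact_Icc.exists_bound_of_continuousOn hg.continuousOn
  refine ⟨(K * M' + M * K').toNNReal, LipschitzOnWith.of_dist_le_mul fun s hs t ht => ?_⟩
  have h1 := hf.dist_le_mul s hs t ht
  have h2 := hg.dist_le_mul s hs t ht
  rw [dist_eq_norm] at h1 h2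
  rw [Real.dist_eq, show ⟪f s, g s⟫ - ⟪f t, g t⟫ = ⟪f s - f t, g s⟫ + ⟪f t, g s - g t⟫ by
    rw [inner_sub_left, inner_sub_right]; ring]
  calc |⟪f s - f t, g s⟫ + ⟪f t, g s - g t⟫|
      ≤ ‖f s - f t‖ * ‖g s‖ + ‖f t‖ * ‖g s - g t‖ :=
        (abs_add_le _ _).trans (add_le_add (abs_real_inner_le_norm _ _)
          (abs_real_inner_le_norm _ _))
    _ ≤ (K * dist s t) * M' + M * (K' * dist s t) := by
        gcongr
        · exact hM' s hs
        · exact (norm_nonneg _).trans (hM t ht)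
        · exact hM t ht
    _ = (K * M' + M * K') * dist s t := by ring
    _ ≤ _ := by gcongr; exact Real.le_coe_toNNReal _

theorem LipschitzOnWith.integrableOn_inner_deriv {K : NNReal} {f g : ℝ → E3} {a b : ℝ}
    (hg : LipschitzOnWith K g (Icc a b)) (hf : ContinuousOn f (Icc a b)) :
    IntegrableOn (fun s => ⟪f s, deriv g s⟫) (Icc a b) := by
  obtain ⟨M, hM⟩ := isCompact_Icc.exists_bound_of_continuousOn hf
  refine Integrable.mono' (hg.integrableOn_deriv.norm.const_mul M) ?_ ?_
  · exact (hf.aestronglyMeasurable measurableSet_Icc).inner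
      (measurable_deriv g).aestronglyMeasurable
  · rw [ae_restrict_iff' measurableSet_Icc]
    refine Filter.Eventually.of_forall fun s hs => ?_
    exact (norm_inner_le_norm _ _).trans (mul_le_mul_of_nonneg_right (hM s hs) (norm_nonneg _))

/-- The inner product of two Lipschitz functions is Lipschitz, hence absolutely continuous, and is
recovered from its almost everywhere derivative. -/
theorem integral_inner_deriv {K K' : NNReal} {f g : ℝ → E3} {a b : ℝ} (hab : a ≤ b)
    (hf : LipschitzOnWith K f (Icc a b)) (hg : LipschitzOnWith K' g (Icc a b)) :
    ∫ s in Icc a b, ⟪f s, deriv g s⟫ =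
      ⟪g b, f b⟫ - ⟪g a, f a⟫ - ∫ s in Icc a b, ⟪g s, deriv f s⟫ := by
  obtain ⟨K'', hK⟩ := hf.exists_inner hg
  rw [← uIcc_of_le hab] at hK
  have h := hK.absolutelyContinuousOnInterval.integral_deriv_eq_sub
  rw [intervalIntegral.integral_of_le hab, ← integral_Icc_eq_integral_Ioc] at h
  have h2 : ∫ s in Icc a b, deriv (fun s => ⟪f s, g s⟫) s =
      ∫ s in Icc a b, (⟪f s, deriv g s⟫ + ⟪g s, deriv f s⟫) := by
    refine setIntegral_congr_ae measurableSet_Icc ?_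
    filter_upwards [hf.ae_differentiableAt_Icc, hg.ae_differentiableAt_Icc] with s h1 h2 hs
    rw [((h1 hs).hasDerivAt.inner ℝ (h2 hs).hasDerivAt).deriv, real_inner_comm (deriv f s)]
  rw [h2, integral_add (hg.integrableOn_inner_deriv hf.continuousOn)
    (hf.integrableOn_inner_deriv hg.continuousOn)] at h
  rw [real_inner_comm, real_inner_comm (f a)]
  linarith

/-- The **first variation of length** of a curve with Lipschitz unit tangent `T`. -/
theorem hasDerivAt_length_vary {a b : ℝ} (hab : a ≤ b) {c T ξ : ℝ → E3} {Kc KT Kξ : NNReal}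
    (hc : LipschitzOnWith Kc c (Icc a b)) (hT : LipschitzWith KT T) (hT1 : ∀ s, ‖T s‖ = 1)
    (hcT : ∀ᵐ s : ℝ, s ∈ Icc a b → ∃ v : ℝ, 0 < v ∧ HasDerivAt c (v • T s) s)
    (hξ : LipschitzOnWith Kξ ξ (Icc a b)) :
    HasDerivAt (fun t : ℝ => ∫ s in Icc a b, ‖deriv (fun s => c s + t • ξ s) s‖)
      (⟪ξ b, T b⟫ - ⟪ξ a, T a⟫ - ∫ s in Icc a b, ⟪ξ s, deriv T s⟫) 0 := by
  -- After integration by parts the claimed derivative is the integral of `⟪T s, deriv ξ s⟫`. The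
  -- speed `v` cancels in the pointwise derivative of `‖v • T s + t • deriv ξ s‖`, so no lower bound
  -- on the speed is needed. In `t` this norm is Lipschitz with constant `Kξ`, which justifies
  -- differentiating under the integral.
  rw [← integral_inner_deriv hab hT.lipschitzOnWith hξ]
  have hder : ∀ᵐ s : ℝ, s ∈ Icc a b → ∃ v : ℝ, 0 < v ∧
      ∀ t : ℝ, deriv (fun s => c s + t • ξ s) s = v • T s + t • deriv ξ s := by
    filter_upwards [hcT, hξ.ae_differentiableAt_Icc] with s h1 h2 hs
    obtain ⟨v, hv, hd⟩ := h1 hs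
    exact ⟨v, hv, fun t => (hd.add ((h2 hs).hasDerivAt.const_smul t)).deriv⟩
  refine (hasDerivAt_integral_of_dominated_loc_of_lip (bound := fun _ => (Kξ : ℝ))
    (F := fun t s => ‖deriv (fun s => c s + t • ξ s) s‖) Filter.univ_mem
    ?_ ?_ ?_ ?_ ?_ ?_).2
  · exact Filter.Eventually.of_forall fun t => (measurable_deriv _).norm.aestronglyMeasurable
  · simpa using hc.integrableOn_deriv.norm
  · exact hT.continuous.aestronglyMeasurable.inner (measurable_deriv ξ).aestronglyMeasurable
  · rw [ae_restrict_iff' measurableSet_Icc]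
    filter_upwards [hder, ae_mem_Ioo_of_mem_Icc a b] with s h h' hs
    obtain ⟨v, -, hd⟩ := h hs
    refine LipschitzOnWith.of_dist_le_mul fun t _ t' _ => ?_
    have hb := norm_deriv_le_of_lipschitzOn (Icc_mem_nhds (h' hs).1 (h' hs).2) hξ
    rw [hd, hd]
    calc dist ‖v • T s + t • deriv ξ s‖ ‖v • T s + t' • deriv ξ s‖
        ≤ ‖(v • T s + t • deriv ξ s) - (v • T s + t' • deriv ξ s)‖ := dist_norm_norm_le _ _
      _ = ‖(t - t') • deriv ξ s‖ := by congr 1; module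
      _ = dist t t' * ‖deriv ξ s‖ := by rw [norm_smul, Real.dist_eq, Real.norm_eq_abs]
      _ ≤ dist t t' * Kξ := by gcongr
      _ = _ := by simp [mul_comm]
  · exact integrableOn_const (by simp)
  · rw [ae_restrict_iff' measurableSet_Icc]
    filter_upwards [hder] with s h hs
    obtain ⟨v, hv, hd⟩ := h hs
    have hne : v • T s ≠ 0 := smul_ne_zero hv.ne' (norm_ne_zero_iff.1 (by simp [hT1]))
    have := hasDerivAt_norm_add_smul hne (deriv ξ s)
    simp only [hd]
    refine this.congr_deriv ?_
    rw [real_inner_smul_left, norm_smul, hT1, Real.norm_eq_abs, abs_of_pos hv]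
    field_simp

/-! ### The clasp arcs -/

/-- The square of `claspX τ w / w`, for `0 < w`. -/
def claspRatio (τ w : ℝ) : ℝ := (1 - (τ - w) ^ 2) / (1 - w ^ 2 * (τ - w) ^ 2)

/-- The derivative of `claspRatio τ`. -/
def claspRatioDeriv (τ w : ℝ) : ℝ :=
  2 * (τ - w) * (1 - w ^ 2 + w * (τ - w) * (1 - (τ - w) ^ 2)) / (1 - w ^ 2 * (τ - w) ^ 2) ^ 2

/-- The derivative of `claspX τ` at `w ≥ 0`. -/
def claspXDeriv (τ w : ℝ) : ℝ :=
  √(claspRatio τ w) + w / √(claspRatio τ w) * (claspRatioDeriv τ w / 2)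

theorem claspX_eq (τ u : ℝ) : claspX τ u = u * √(claspRatio τ |u|) := by
  rw [claspX, claspRatio, sq_abs]

theorem claspX_neg (τ u : ℝ) : claspX τ (-u) = -claspX τ u := by
  rw [claspX_eq, claspX_eq, abs_neg, neg_mul]

theorem claspX_zero (τ : ℝ) : claspX τ 0 = 0 := by simp [claspX]

section

variable {τ : ℝ}

theorem one_sub_sq_pos {w : ℝ} (h0 : 0 < τ) (h1 : τ ≤ 1) (hw0 : 0 < w) (hw1 : w ≤ 1) :
    0 < 1 - (τ - w) ^ 2 := by nlinarith

theorem clasp_denom_pos {w : ℝ} (h0 : 0 < τ) (h1 : τ ≤ 1) (hw0 : 0 ≤ w) (hw1 : w ≤ 1) :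
    0 < 1 - w ^ 2 * (τ - w) ^ 2 := by
  rcases hw0.eq_or_lt with rfl | hw
  · norm_num
  · have := one_sub_sq_pos h0 h1 hw hw1
    have : w ^ 2 ≤ 1 := by nlinarith
    nlinarith [sq_nonneg (τ - w)]

theorem claspRatio_pos {w : ℝ} (h0 : 0 < τ) (h1 : τ ≤ 1) (hw0 : 0 < w) (hw1 : w ≤ 1) :
    0 < claspRatio τ w :=
  div_pos (one_sub_sq_pos h0 h1 hw0 hw1) (clasp_denom_pos h0 h1 hw0.le hw1)

theorem hasDerivAt_claspRatio {w : ℝ} (h0 : 0 < τ) (h1 : τ ≤ 1) (hw0 : 0 ≤ w) (hw1 : w ≤ 1) :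
    HasDerivAt (claspRatio τ) (claspRatioDeriv τ w) w := by
  have hD := clasp_denom_pos h0 h1 hw0 hw1
  have hb : HasDerivAt (fun w => τ - w) (-1) w := by simpa using (hasDerivAt_id w).const_sub τ
  have hn := (hb.pow 2).const_sub 1
  have hd := (((hasDerivAt_id w).pow 2).mul (hb.pow 2)).const_sub 1
  refine (hn.div hd hD.ne').congr_deriv ?_
  rw [claspRatioDeriv]
  simp only [id, Pi.mul_apply, Pi.pow_apply]
  congr 1
  ring

theorem hasDerivAt_claspX_of_pos {u : ℝ} (h0 : 0 < τ) (h1 : τ ≤ 1) (hu0 : 0 < u) (hu1 : u ≤ 1) :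
    HasDerivAt (claspX τ) (claspXDeriv τ u) u := by
  have hq := claspRatio_pos h0 h1 hu0 hu1
  have h := (hasDerivAt_id u).mul ((hasDerivAt_claspRatio h0 h1 hu0.le hu1).sqrt hq.ne')
  have he : claspX τ =ᶠ[nhds u] fun w => id w * √(claspRatio τ w) := by
    filter_upwards [eventually_gt_nhds hu0] with w hw
    rw [claspX_eq, abs_of_pos hw, id]
  refine (h.congr_of_eventuallyEq he).congr_deriv ?_
  have : √(claspRatio τ u) ≠ 0 := (Real.sqrt_pos.2 hq).ne'
  rw [claspXDeriv]
  simp only [id]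
  field_simp

theorem continuousOn_claspXDeriv (h0 : 0 < τ) (h1 : τ ≤ 1) :
    ContinuousOn (claspXDeriv τ) (Icc 0 1) := by
  have hq : ContinuousOn (claspRatio τ) (Icc 0 1) := fun w hw =>
    (hasDerivAt_claspRatio h0 h1 hw.1 hw.2).continuousAt.continuousWithinAt
  have hq' : ContinuousOn (claspRatioDeriv τ) (Icc 0 1) := by
    unfold claspRatioDeriv
    refine ContinuousOn.div (by fun_prop) (by fun_prop) fun w hw => ?_
    exact pow_ne_zero _ (clasp_denom_pos h0 h1 hw.1 hw.2).ne'
  refine hq.sqrt.add (ContinuousOn.mul (fun w hw => ?_) (hq'.div_const 2))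
  rcases hw.1.eq_or_lt with rfl | hpos
  -- At `w = 0` the ratio vanishes when `τ = 1`, so `w / √(claspRatio τ w)` is not a quotient of
  -- continuous functions with nonzero denominator. The estimate `w ≤ claspRatio τ w` on `[0, τ]`
  -- bounds it by `√w`.
  · refine ContinuousWithinAt.mono_of_mem_nhdsWithin (t := Icc 0 τ) ?_ ?_
    · have hb : ∀ w ∈ Icc 0 τ, 0 ≤ w / √(claspRatio τ w) ∧ w / √(claspRatio τ w) ≤ √w := by
        intro w hw
        refine ⟨div_nonneg hw.1 (Real.sqrt_nonneg _), ?_⟩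
        rcases hw.1.eq_or_lt with rfl | hpos
        · simp
        have hD := clasp_denom_pos h0 h1 hw.1 (hw.2.trans h1)
        have hle : w ≤ claspRatio τ w := by
          rw [claspRatio, le_div_iff₀ hD]
          have h2 := hw.2
          have : w * (w ^ 2 * (τ - w) ^ 2) ≥ 0 := by positivity
          nlinarith
        rw [div_le_iff₀ (Real.sqrt_pos.2 (hpos.trans_le hle))]
        calc w = √w * √w := (Real.mul_self_sqrt hw.1).symm
          _ ≤ _ := by gcongr
      have hs : ContinuousWithinAt (fun w : ℝ => √w) (Icc 0 τ) 0 := by fun_prop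
      have hs : Filter.Tendsto (fun w : ℝ => √w) (nhdsWithin 0 (Icc 0 τ)) (nhds 0) := by
        simpa [ContinuousWithinAt] using hs
      rw [ContinuousWithinAt, zero_div]
      refine tendsto_of_tendsto_of_tendsto_of_le_of_le' tendsto_const_nhds hs ?_ ?_ <;>
        filter_upwards [self_mem_nhdsWithin] with w hw
      · exact (hb w hw).1
      · exact (hb w hw).2
    · refine Filter.mem_of_superset (Filter.inter_mem self_mem_nhdsWithin
        (mem_nhdsWithin_of_mem_nhds (Iic_mem_nhds h0))) fun x hx => ⟨hx.1.1, hx.2⟩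
  · have := claspRatio_pos h0 h1 hpos hw.2
    exact continuousWithinAt_id.div (hq w hw).sqrt (Real.sqrt_pos.2 this).ne'

theorem claspXDeriv_pos {w : ℝ} (h0 : 0 < τ) (h1 : τ ≤ 1) (hw0 : 0 < w) (hw1 : w ≤ τ) :
    0 < claspXDeriv τ w := by
  have hq := Real.sqrt_pos.2 (claspRatio_pos h0 h1 hw0 (hw1.trans h1))
  have hb : 0 ≤ τ - w := by linarith
  have h2 := (one_sub_sq_pos h0 h1 hw0 (hw1.trans h1)).le
  have h3 : 0 ≤ 1 - w ^ 2 := by nlinarith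
  have : 0 ≤ claspRatioDeriv τ w := by unfold claspRatioDeriv; positivity
  unfold claspXDeriv
  positivity

theorem claspXDeriv_nonneg {w : ℝ} (h0 : 0 < τ) (h1 : τ ≤ 1) (hw0 : 0 ≤ w) (hw1 : w ≤ τ) :
    0 ≤ claspXDeriv τ w := by
  rcases hw0.eq_or_lt with rfl | h
  · simp [claspXDeriv]
  · exact (claspXDeriv_pos h0 h1 h hw1).le

/-- The range `|u| ≤ 1`, larger than that of the clasp arc, lets `claspX τ ∘ sin` be differentiable
on the whole line; no one-sided derivatives are needed at the ends of the arc. -/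
theorem hasDerivAt_claspX {u : ℝ} (h0 : 0 < τ) (h1 : τ ≤ 1) (hu : |u| ≤ 1) :
    HasDerivAt (claspX τ) (claspXDeriv τ |u|) u := by
  rcases lt_trichotomy u 0 with h | rfl | h
  · rw [abs_of_neg h] at hu ⊢
    have := (hasDerivAt_claspX_of_pos h0 h1 (neg_pos.2 h) hu).scomp u (hasDerivAt_neg u)
    have h2 := this.neg
    refine (h2.congr_of_eventuallyEq
      (Filter.Eventually.of_forall fun w => ?_)).congr_deriv (by simp)
    simp [claspX_neg]
  · rw [abs_zero, show claspXDeriv τ 0 = √(claspRatio τ |0|) by simp [claspXDeriv]]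
    have hc : ContinuousAt (fun u : ℝ => √(claspRatio τ |u|)) 0 := by
      have h : ContinuousAt (claspRatio τ) |0| := by
        rw [abs_zero]
        exact (hasDerivAt_claspRatio h0 h1 le_rfl zero_le_one).continuousAt
      exact (ContinuousAt.comp h continuous_abs.continuousAt).sqrt
    rw [hasDerivAt_iff_tendsto_slope]
    refine (hc.tendsto.mono_left nhdsWithin_le_nhds).congr' ?_
    filter_upwards [self_mem_nhdsWithin] with u hu
    have hu : u ≠ 0 := hu
    rw [slope_def_field, claspX_zero, sub_zero, sub_zero, claspX_eq]
    field_simp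
  · rw [abs_of_pos h] at hu ⊢
    exact hasDerivAt_claspX_of_pos h0 h1 h hu

/-- The speed of a clasp arc parametrized by the angle of its tangent. -/
def claspSpeed (τ s : ℝ) : ℝ := claspXDeriv τ |Real.sin s|

theorem deriv_claspX_sin (h0 : 0 < τ) (h1 : τ ≤ 1) (s : ℝ) :
    deriv (claspX τ) (Real.sin s) = claspSpeed τ s :=
  (hasDerivAt_claspX h0 h1 (Real.abs_sin_le_one s)).deriv

theorem continuous_claspSpeed (h0 : 0 < τ) (h1 : τ ≤ 1) : Continuous (claspSpeed τ) :=
  (continuousOn_claspXDeriv h0 h1).comp_continuous (by fun_prop)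
    fun s => ⟨abs_nonneg _, Real.abs_sin_le_one s⟩

theorem claspSpeed_neg (τ s : ℝ) : claspSpeed τ (-s) = claspSpeed τ s := by simp [claspSpeed]

theorem hasDerivAt_claspX_sin (h0 : 0 < τ) (h1 : τ ≤ 1) (s : ℝ) :
    HasDerivAt (fun s => claspX τ (Real.sin s)) (claspSpeed τ s * Real.cos s) s :=
  (hasDerivAt_claspX h0 h1 (Real.abs_sin_le_one s)).comp s (Real.hasDerivAt_sin s)

theorem hasDerivAt_claspZ (h0 : 0 < τ) (h1 : τ ≤ 1) (s : ℝ) :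
    HasDerivAt (claspZ τ) (Real.sin s * claspSpeed τ s) s := by
  have hc : Continuous fun s => Real.sin s * claspSpeed τ s :=
    Real.continuous_sin.mul (continuous_claspSpeed h0 h1)
  have : claspZ τ = fun φ => ∫ s in (0 : ℝ)..φ, Real.sin s * claspSpeed τ s := by
    funext φ
    simp only [claspZ, deriv_claspX_sin h0 h1]
  rw [this]
  exact intervalIntegral.integral_hasDerivAt_right (hc.intervalIntegrable _ _)
    (hc.stronglyMeasurableAtFilter _ _) hc.continuousAt

theorem claspZ_zero (τ : ℝ) : claspZ τ 0 = 0 := by simp [claspZ]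

theorem claspZ_neg (h0 : 0 < τ) (h1 : τ ≤ 1) (s : ℝ) : claspZ τ (-s) = claspZ τ s := by
  simp only [claspZ, deriv_claspX_sin h0 h1]
  have := intervalIntegral.integral_comp_neg (fun s => Real.sin s * claspSpeed τ s)
    (a := 0) (b := s)
  simp only [Real.sin_neg, claspSpeed_neg, neg_mul, neg_zero] at this
  rw [intervalIntegral.integral_symm, ← this, intervalIntegral.integral_neg, neg_neg]

theorem claspZ_abs (h0 : 0 < τ) (h1 : τ ≤ 1) (s : ℝ) : claspZ τ |s| = claspZ τ s := by
  rcases abs_choice s with h | h <;> rw [h]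
  exact claspZ_neg h0 h1 s

theorem sin_mem_Ioc {s : ℝ} (h0 : 0 < τ) (h1 : τ ≤ 1) (hs0 : 0 < s) (hs1 : s ≤ Real.arcsin τ) :
    Real.sin s ∈ Ioc 0 τ := by
  have h2 := Real.arcsin_le_pi_div_two τ
  refine ⟨Real.sin_pos_of_pos_of_lt_pi hs0 (by linarith [Real.pi_pos]), ?_⟩
  rw [← Real.sin_arcsin (by linarith) h1]
  exact Real.sin_le_sin_of_le_of_le_pi_div_two (by linarith [Real.pi_pos]) h2 hs1

theorem sin_mem_Icc {s : ℝ} (h0 : 0 < τ) (h1 : τ ≤ 1) (hs : s ∈ Icc 0 (Real.arcsin τ)) :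
    Real.sin s ∈ Icc 0 τ := by
  rcases hs.1.eq_or_lt with rfl | h
  · simpa using h0.le
  · exact Ioc_subset_Icc_self (sin_mem_Ioc h0 h1 h hs.2)

/-- The tip is excluded because for `τ = 1` the speed vanishes there: a positive angle is turned
with infinite curvature with respect to arclength, although the angle parametrization stays
harmless. -/
theorem claspSpeed_pos {s : ℝ} (h0 : 0 < τ) (h1 : τ ≤ 1) (hs0 : s ≠ 0)
    (hs1 : |s| ≤ Real.arcsin τ) : 0 < claspSpeed τ s := by
  have h : claspSpeed τ s = claspSpeed τ |s| := by
    rcases abs_choice s with h | h <;> rw [h]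
    exact (claspSpeed_neg τ s).symm
  have := sin_mem_Ioc h0 h1 (abs_pos.2 hs0) hs1
  rw [h, claspSpeed, abs_of_pos this.1]
  exact claspXDeriv_pos h0 h1 this.1 this.2

theorem claspZ_strictMonoOn (h0 : 0 < τ) (h1 : τ ≤ 1) :
    StrictMonoOn (claspZ τ) (Icc 0 (Real.arcsin τ)) := by
  refine strictMonoOn_of_deriv_pos (convex_Icc _ _)
    (fun s _ => (hasDerivAt_claspZ h0 h1 s).continuousAt.continuousWithinAt) fun s hs => ?_
  rw [interior_Icc] at hs
  rw [(hasDerivAt_claspZ h0 h1 s).deriv]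
  refine mul_pos (sin_mem_Ioc h0 h1 hs.1 hs.2.le).1 (claspSpeed_pos h0 h1 hs.1.ne' ?_)
  rw [abs_of_pos hs.1]
  exact hs.2.le

theorem claspZ_nonneg {s : ℝ} (h0 : 0 < τ) (h1 : τ ≤ 1) (hs : |s| ≤ Real.arcsin τ) :
    0 ≤ claspZ τ s := by
  rw [← claspZ_abs h0 h1, ← claspZ_zero τ]
  exact (claspZ_strictMonoOn h0 h1).monotoneOn ⟨le_rfl, Real.arcsin_nonneg.2 h0.le⟩
    ⟨abs_nonneg s, hs⟩ (abs_nonneg s)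

theorem claspZ_le {s : ℝ} (h0 : 0 < τ) (h1 : τ ≤ 1) (hs : |s| ≤ Real.arcsin τ) :
    claspZ τ s ≤ claspZ τ (Real.arcsin τ) := by
  rw [← claspZ_abs h0 h1]
  exact (claspZ_strictMonoOn h0 h1).monotoneOn ⟨abs_nonneg s, hs⟩
    ⟨Real.arcsin_nonneg.2 h0.le, le_rfl⟩ hs

theorem claspX_self (h0 : 0 < τ) : claspX τ τ = τ := by
  rw [claspX_eq, abs_of_pos h0, claspRatio]
  simp

end

/-! ### Contact between the two arcs of a clasp -/

/-- The difference in height between points in contact, with parameters `a` and `τ - a`. -/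
def contactHeight (τ a : ℝ) : ℝ := √(1 - claspX τ a ^ 2 - claspX τ (τ - a) ^ 2)

section

variable {τ : ℝ}

theorem claspX_of_nonneg {a : ℝ} (ha : 0 ≤ a) :
    claspX τ a = a * √((1 - (τ - a) ^ 2) / (1 - a ^ 2 * (τ - a) ^ 2)) := by
  rw [claspX_eq, abs_of_nonneg ha, claspRatio]

theorem claspX_sub_of_le {a : ℝ} (ha : a ≤ τ) :
    claspX τ (τ - a) = (τ - a) * √((1 - a ^ 2) / (1 - a ^ 2 * (τ - a) ^ 2)) := by
  rw [claspX_of_nonneg (sub_nonneg.2 ha), sub_sub_cancel, mul_comm (a ^ 2)]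

theorem one_sub_claspX_sq {a : ℝ} (h0 : 0 < τ) (h1 : τ ≤ 1) (ha : a ∈ Icc 0 τ) :
    1 - claspX τ a ^ 2 - claspX τ (τ - a) ^ 2 =
      (1 - a ^ 2) * ((1 - (τ - a) ^ 2) / (1 - a ^ 2 * (τ - a) ^ 2)) := by
  have hD := clasp_denom_pos h0 h1 ha.1 (ha.2.trans h1)
  have h2 : 0 ≤ 1 - a ^ 2 := by nlinarith [ha.1, ha.2]
  have h3 : 0 ≤ 1 - (τ - a) ^ 2 := by nlinarith [ha.1, ha.2]
  rw [claspX_of_nonneg ha.1, claspX_sub_of_le ha.2, mul_pow, mul_pow,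
    Real.sq_sqrt (div_nonneg h3 hD.le), Real.sq_sqrt (div_nonneg h2 hD.le)]
  field_simp
  ring

theorem contactHeight_eq {a : ℝ} (h0 : 0 < τ) (h1 : τ ≤ 1) (ha : a ∈ Icc 0 τ) :
    contactHeight τ a = √(1 - a ^ 2) * √((1 - (τ - a) ^ 2) / (1 - a ^ 2 * (τ - a) ^ 2)) := by
  rw [contactHeight, one_sub_claspX_sq h0 h1 ha, Real.sqrt_mul (by nlinarith [ha.1, ha.2])]

theorem contactHeight_sub (τ a : ℝ) : contactHeight τ (τ - a) = contactHeight τ a := by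
  rw [contactHeight, contactHeight, sub_sub_cancel, sub_right_comm]

/-- Orthogonality of the struts to `γ`, whose tangent at the contact point has horizontal and
vertical components `√(1 - a ^ 2)` and `a`. The next two lemmas on `τ - a` and `contactHeight` give
the same for `α` and exclude degenerate heights. -/
theorem claspX_mul_sqrt {a : ℝ} (h0 : 0 < τ) (h1 : τ ≤ 1) (ha : a ∈ Icc 0 τ) :
    claspX τ a * √(1 - a ^ 2) = a * contactHeight τ a := by
  rw [contactHeight_eq h0 h1 ha, claspX_of_nonneg ha.1]
  ring

theorem claspX_sub_mul_sqrt {a : ℝ} (h0 : 0 < τ) (h1 : τ ≤ 1) (ha : a ∈ Icc 0 τ) :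
    claspX τ (τ - a) * √(1 - (τ - a) ^ 2) = (τ - a) * contactHeight τ a := by
  rw [claspX_mul_sqrt h0 h1 ⟨by linarith [ha.2], by linarith [ha.1]⟩, contactHeight_sub]

theorem contactHeight_pos {a : ℝ} (h0 : 0 < τ) (h1 : τ ≤ 1) (ha : a ∈ Ioo 0 τ) :
    0 < contactHeight τ a := by
  have hD := clasp_denom_pos h0 h1 ha.1.le (ha.2.le.trans h1)
  rw [contactHeight, one_sub_claspX_sq h0 h1 (Ioo_subset_Icc_self ha)]
  have h2 : 0 < 1 - a ^ 2 := by nlinarith [ha.1, ha.2]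
  have h3 : 0 < 1 - (τ - a) ^ 2 := by nlinarith [ha.1, ha.2]
  positivity

theorem contactHeight_sq {a : ℝ} (h0 : 0 < τ) (h1 : τ ≤ 1) (ha : a ∈ Icc 0 τ) :
    claspX τ a ^ 2 + claspX τ (τ - a) ^ 2 + contactHeight τ a ^ 2 = 1 := by
  have hD := clasp_denom_pos h0 h1 ha.1 (ha.2.trans h1)
  have h2 : 0 ≤ 1 - a ^ 2 := by nlinarith [ha.1, ha.2]
  have h3 : 0 ≤ 1 - (τ - a) ^ 2 := by nlinarith [ha.1, ha.2]
  rw [contactHeight, Real.sq_sqrt]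
  · ring
  · rw [one_sub_claspX_sq h0 h1 ha]
    positivity

theorem hasDerivAt_claspZ_arcsin {a : ℝ} (h0 : 0 < τ) (h1 : τ ≤ 1) (ha : a ∈ Ioo 0 1) :
    HasDerivAt (fun a => claspZ τ (Real.arcsin a)) (a / √(1 - a ^ 2) * claspXDeriv τ a) a := by
  have h := (hasDerivAt_claspZ h0 h1 (Real.arcsin a)).comp a
    (Real.hasDerivAt_arcsin (by linarith [ha.1]) ha.2.ne)
  refine h.congr_deriv ?_
  rw [claspSpeed, Real.sin_arcsin (by linarith [ha.1]) ha.2.le, abs_of_pos ha.1]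
  ring

theorem continuous_claspZ (h0 : 0 < τ) (h1 : τ ≤ 1) : Continuous (claspZ τ) :=
  continuous_iff_continuousAt.2 fun s => (hasDerivAt_claspZ h0 h1 s).continuousAt

/-- The heights of points in contact. -/
theorem claspGap_eq {a : ℝ} (h0 : 0 < τ) (h1 : τ ≤ 1) (ha : a ∈ Icc 0 τ) :
    claspGap τ =
      claspZ τ (Real.arcsin a) + claspZ τ (Real.arcsin (τ - a)) + contactHeight τ a := by
  set W : ℝ → ℝ := fun a =>
    claspZ τ (Real.arcsin a) + claspZ τ (Real.arcsin (τ - a)) + contactHeight τ a with hW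
  have hX : ∀ a ∈ Icc 0 τ, HasDerivAt (claspX τ) (claspXDeriv τ a) a := by
    intro a ha
    simpa [abs_of_nonneg ha.1] using
      hasDerivAt_claspX h0 h1 (u := a) (by rw [abs_of_nonneg ha.1]; linarith [ha.2])
  have hsub : ∀ a, HasDerivAt (fun a => τ - a) (-1) a := fun a => by
    simpa using (hasDerivAt_id a).const_sub τ
  have hcont : ContinuousOn W (Icc 0 τ) := by
    have hz := continuous_claspZ h0 h1
    refine ContinuousOn.add (Continuous.continuousOn ?_) (ContinuousOn.sqrt ?_)
    · exact (hz.comp Real.continuous_arcsin).add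
        (hz.comp (Real.continuous_arcsin.comp (by fun_prop)))
    · intro a ha
      have ha' : τ - a ∈ Icc 0 τ := ⟨by linarith [ha.2], by linarith [ha.1]⟩
      have h2 := (hX a ha).continuousAt
      have h3 : ContinuousAt (fun a => claspX τ (τ - a)) a :=
        ContinuousAt.comp (f := fun a => τ - a) (hX _ ha').continuousAt (by fun_prop)
      exact ((continuousAt_const.sub (h2.pow 2)).sub (h3.pow 2)).continuousWithinAt
  -- Orthogonality turns the slopes `a / √(1 - a ^ 2)` of the arcs into quotients `claspX /
  -- contactHeight`. The derivatives of the two heights then cancel that of `contactHeight`, as in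
  -- `x dx + y dy + H dH = 0`. Only interior points are used, since the slopes may be infinite at
  -- the ends.
  have hder : ∀ a ∈ Ioo 0 τ, HasDerivAt W 0 a := by
    intro a ha
    have ha' : τ - a ∈ Ioo 0 τ := ⟨by linarith [ha.2], by linarith [ha.1]⟩
    have hIcc := Ioo_subset_Icc_self ha
    have hH := contactHeight_pos h0 h1 ha
    have hr : 0 < 1 - claspX τ a ^ 2 - claspX τ (τ - a) ^ 2 := Real.sqrt_pos.1 hH
    have hX1 := hX a hIcc
    have hX2 := (hX _ (Ioo_subset_Icc_self ha')).comp a (hsub a)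
    have h1a := hasDerivAt_claspZ_arcsin h0 h1 (a := a) ⟨ha.1, ha.2.trans_le h1⟩
    have h2a := (hasDerivAt_claspZ_arcsin h0 h1 (a := τ - a) ⟨ha'.1, ha'.2.trans_le h1⟩).comp a
      (hsub a)
    have h3a := (((hX1.pow 2).const_sub 1).sub (hX2.pow 2)).sqrt hr.ne'
    refine ((h1a.add h2a).add h3a).congr_deriv ?_
    have e1 : a / √(1 - a ^ 2) = claspX τ a / contactHeight τ a := by
      have : 0 < √(1 - a ^ 2) := Real.sqrt_pos.2 (by nlinarith [ha.1, ha.2])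
      rw [div_eq_div_iff this.ne' hH.ne', claspX_mul_sqrt h0 h1 hIcc]
    have e2 : (τ - a) / √(1 - (τ - a) ^ 2) = claspX τ (τ - a) / contactHeight τ a := by
      have : 0 < √(1 - (τ - a) ^ 2) := Real.sqrt_pos.2 (by nlinarith [ha'.1, ha'.2])
      rw [div_eq_div_iff this.ne' hH.ne', claspX_sub_mul_sqrt h0 h1 hIcc]
    rw [e1, e2]
    change _ + (_ : ℝ) / (2 * contactHeight τ a) = 0
    simp only [Function.comp]
    field_simp
    ring
  have hconst : W a = W 0 := by
    rcases ha.1.eq_or_lt with rfl | hpos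
    · rfl
    obtain ⟨x, hx, h⟩ := exists_hasDerivAt_eq_slope W (fun _ => 0) hpos
      (hcont.mono (Icc_subset_Icc_right ha.2)) fun x hx => hder x ⟨hx.1, hx.2.trans_le ha.2⟩
    have := (div_eq_zero_iff.1 h.symm).resolve_right (by linarith)
    linarith
  rw [show claspZ τ (Real.arcsin a) + claspZ τ (Real.arcsin (τ - a)) + contactHeight τ a = W a
    from rfl, hconst]
  have : contactHeight τ 0 = √(1 - τ ^ 2) := by
    rw [contactHeight, claspX_zero, sub_zero, claspX_self h0]
    norm_num
  simp [hW, this, claspGap, claspZ_zero]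

theorem arcsin_mem_Icc {a : ℝ} (ha : a ∈ Icc 0 τ) : Real.arcsin a ∈ Icc 0 (Real.arcsin τ) :=
  ⟨Real.arcsin_nonneg.2 ha.1, Real.monotone_arcsin ha.2⟩

/-- Points of the two arcs of a clasp are at distance at least one. -/
theorem one_le_clasp_dist_sq_of_nonneg {s t : ℝ} (h0 : 0 < τ) (h1 : τ ≤ 1)
    (hs : s ∈ Icc 0 (Real.arcsin τ)) (ht : t ∈ Icc 0 (Real.arcsin τ)) :
    1 ≤ claspX τ (Real.sin s) ^ 2 + claspX τ (Real.sin t) ^ 2 +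
      (claspGap τ - claspZ τ s - claspZ τ t) ^ 2 := by
  set F : ℝ → ℝ := fun s => claspX τ (Real.sin s) ^ 2 + claspX τ (Real.sin t) ^ 2 +
      (claspGap τ - claspZ τ s - claspZ τ t) ^ 2 with hF
  have hpi := Real.arcsin_le_pi_div_two τ
  have hsin := fun s hs => sin_mem_Icc h0 h1 (s := s) hs
  have harc : ∀ {s}, s ∈ Icc 0 (Real.arcsin τ) → Real.arcsin (Real.sin s) = s := fun {s} hs =>
    Real.arcsin_sin (by linarith [hs.1, Real.pi_pos]) (by linarith [hs.2])
  -- By orthogonality at the contact partner of `s`, the derivative only compares `claspZ τ t` with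
  -- the height of that partner. Its sign therefore changes once, at the parameter `m` in contact
  -- with `t`, where the distance is one.
  have hder : ∀ s ∈ Icc 0 (Real.arcsin τ), HasDerivAt F (2 * claspSpeed τ s * Real.sin s *
      (claspZ τ t - claspZ τ (Real.arcsin (τ - Real.sin s)))) s := by
    intro s hs
    have h := (((hasDerivAt_claspX_sin h0 h1 s).pow 2).add_const (claspX τ (Real.sin t) ^ 2)).add
      ((((hasDerivAt_claspZ h0 h1 s).const_sub (claspGap τ)).sub_const (claspZ τ t)).pow 2)
    refine h.congr_deriv ?_
    have hcos : Real.cos s = √(1 - Real.sin s ^ 2) :=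
      Real.cos_eq_sqrt_one_sub_sin_sq (by linarith [hs.1, Real.pi_pos]) (by linarith [hs.2])
    have e1 := claspX_mul_sqrt h0 h1 (hsin s hs)
    have e2 := claspGap_eq h0 h1 (hsin s hs)
    rw [harc hs] at e2
    rw [← hcos] at e1
    push_cast
    linear_combination 2 * claspSpeed τ s * e1 - 2 * claspSpeed τ s * Real.sin s * e2
  have hcF : ContinuousOn F (Icc 0 (Real.arcsin τ)) := fun s hs =>
    (hder s hs).continuousAt.continuousWithinAt
  have ht' := hsin t ht
  have hm' : τ - Real.sin t ∈ Icc 0 τ := ⟨by linarith [ht'.2], by linarith [ht'.1]⟩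
  set m := Real.arcsin (τ - Real.sin t) with hmdef
  have hm : m ∈ Icc 0 (Real.arcsin τ) := arcsin_mem_Icc hm'
  have hsm : Real.sin m = τ - Real.sin t :=
    Real.sin_arcsin (by linarith [hm'.1]) (by linarith [hm'.2])
  have hFm : F m = 1 := by
    have e1 := contactHeight_sq h0 h1 hm'
    have e2 := claspGap_eq h0 h1 hm'
    rw [sub_sub_cancel] at e1 e2
    rw [harc ht] at e2
    simp only [hF, hsm]
    rw [e2, ← e1]
    ring
  have hmono := (claspZ_strictMonoOn h0 h1).monotoneOn
  have hle : ∀ {s}, s ∈ Icc 0 (Real.arcsin τ) → τ - Real.sin s ∈ Icc 0 τ := fun {s} hs =>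
    ⟨by linarith [(hsin s hs).2], by linarith [(hsin s hs).1]⟩
  have hsinmono : ∀ {s s'}, s ∈ Icc 0 (Real.arcsin τ) → s' ∈ Icc 0 (Real.arcsin τ) → s ≤ s' →
      Real.sin s ≤ Real.sin s' := fun {s s'} hs hs' h =>
    Real.sin_le_sin_of_le_of_le_pi_div_two (by linarith [hs.1, Real.pi_pos])
      (by linarith [hs'.2]) h
  have hk : ∀ s ∈ Icc 0 (Real.arcsin τ), 0 ≤ 2 * claspSpeed τ s * Real.sin s := by
    intro s hs
    have h2 := hsin s hs
    have : 0 ≤ claspSpeed τ s := by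
      rw [claspSpeed, abs_of_nonneg h2.1]
      exact claspXDeriv_nonneg h0 h1 h2.1 h2.2
    exact mul_nonneg (by positivity) h2.1
  rw [← hFm]
  change F m ≤ F s
  rcases le_total s m with hsm' | hsm'
  · refine antitoneOn_of_deriv_nonpos (convex_Icc 0 m) (hcF.mono (Icc_subset_Icc_right hm.2))
      (fun x hx => ?_) (fun x hx => ?_) ⟨hs.1, hsm'⟩ ⟨hm.1, le_rfl⟩ hsm'
    all_goals
      rw [interior_Icc] at hx
      have hx' : x ∈ Icc 0 (Real.arcsin τ) := ⟨hx.1.le, hx.2.le.trans hm.2⟩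
    · exact (hder x hx').differentiableAt.differentiableWithinAt
    · rw [(hder x hx').deriv]
      refine mul_nonpos_of_nonneg_of_nonpos (hk x hx') (sub_nonpos.2 ?_)
      refine hmono ht (arcsin_mem_Icc (hle hx')) ?_
      rw [← harc ht]
      refine Real.monotone_arcsin ?_
      have := hsinmono hx' hm hx.2.le
      linarith
  · refine monotoneOn_of_deriv_nonneg (convex_Icc m (Real.arcsin τ))
      (hcF.mono (Icc_subset_Icc_left hm.1))
      (fun x hx => ?_) (fun x hx => ?_) ⟨le_rfl, hm.2⟩ ⟨hsm', hs.2⟩ hsm'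
    all_goals
      rw [interior_Icc] at hx
      have hx' : x ∈ Icc 0 (Real.arcsin τ) := ⟨hm.1.trans hx.1.le, hx.2.le⟩
    · exact (hder x hx').differentiableAt.differentiableWithinAt
    · rw [(hder x hx').deriv]
      refine mul_nonneg (hk x hx') (sub_nonneg.2 ?_)
      refine hmono (arcsin_mem_Icc (hle hx')) ht ?_
      rw [← harc ht]
      refine Real.monotone_arcsin ?_
      have := hsinmono hm hx' hx.1.le
      linarith

theorem claspX_sin_abs_sq (τ s : ℝ) :
    claspX τ (Real.sin |s|) ^ 2 = claspX τ (Real.sin s) ^ 2 := by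
  rcases abs_choice s with h | h <;> rw [h]
  rw [Real.sin_neg, claspX_neg, neg_sq]

theorem one_le_clasp_dist_sq {s t : ℝ} (h0 : 0 < τ) (h1 : τ ≤ 1)
    (hs : |s| ≤ Real.arcsin τ) (ht : |t| ≤ Real.arcsin τ) :
    1 ≤ claspX τ (Real.sin s) ^ 2 + claspX τ (Real.sin t) ^ 2 +
      (claspGap τ - claspZ τ s - claspZ τ t) ^ 2 := by
  have := one_le_clasp_dist_sq_of_nonneg h0 h1 ⟨abs_nonneg s, hs⟩ ⟨abs_nonneg t, ht⟩
  rwa [claspX_sin_abs_sq, claspX_sin_abs_sq, claspZ_abs h0 h1, claspZ_abs h0 h1] at this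

end

/-! ### Coordinates -/

theorem vec3_eq (a b c : ℝ) : (!₂[a, b, c] : E3) = a • EuclideanSpace.single 0 1 +
    b • EuclideanSpace.single 1 1 + c • EuclideanSpace.single 2 1 := by
  ext i
  fin_cases i <;> simp

theorem HasDerivAt.vec3 {f g h : ℝ → ℝ} {f' g' h' s : ℝ} (hf : HasDerivAt f f' s)
    (hg : HasDerivAt g g' s) (hh : HasDerivAt h h' s) :
    HasDerivAt (fun s => (!₂[f s, g s, h s] : E3)) !₂[f', g', h'] s := by
  simp only [vec3_eq]
  exact ((hf.smul_const _).add (hg.smul_const _)).add (hh.smul_const _)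

theorem inner_vec3 (x y : E3) : ⟪x, y⟫ = x 0 * y 0 + x 1 * y 1 + x 2 * y 2 := by
  simp [PiLp.inner_apply, Fin.sum_univ_three, mul_comm]

theorem norm_sq_vec3 (x : E3) : ‖x‖ ^ 2 = x 0 ^ 2 + x 1 ^ 2 + x 2 ^ 2 := by
  rw [← real_inner_self_eq_norm_sq, inner_vec3]
  ring

theorem dist_sq_vec3 (x y : E3) :
    dist x y ^ 2 = (x 0 - y 0) ^ 2 + (x 1 - y 1) ^ 2 + (x 2 - y 2) ^ 2 := by
  rw [dist_eq_norm, norm_sq_vec3]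
  rfl

theorem one_le_dist_of_sq {x y : E3} (h : 1 ≤ dist x y ^ 2) : 1 ≤ dist x y :=
  (one_le_sq_iff₀ dist_nonneg).1 h

/-- The reflection in the plane `z = 0` as a linear isometry. -/
def reflZEquiv : E3 ≃ₗᵢ[ℝ] E3 where
  toFun := reflZ
  invFun := reflZ
  map_add' x y := by ext i; fin_cases i <;> simp [reflZ, add_comm]
  map_smul' r x := by ext i; fin_cases i <;> simp [reflZ]
  left_inv x := by ext i; fin_cases i <;> simp [reflZ]
  right_inv x := by ext i; fin_cases i <;> simp [reflZ]
  norm_map' x := by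
    refine (sq_eq_sq₀ (norm_nonneg _) (norm_nonneg _)).1 ?_
    change ‖reflZ x‖ ^ 2 = _
    rw [norm_sq_vec3, norm_sq_vec3]
    simp [reflZ]

theorem reflZ_vec3 (a b c : ℝ) : reflZ !₂[a, b, c] = !₂[a, b, -c] := by simp [reflZ]

theorem reflZ_reflZ (x : E3) : reflZ (reflZ x) = x := reflZEquiv.symm_apply_apply x

theorem dist_reflZ (x y : E3) : dist (reflZ x) (reflZ y) = dist x y := reflZEquiv.dist_map x y

theorem dist_reflZ_right (x y : E3) : dist x (reflZ y) = dist (reflZ x) y := by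
  rw [← dist_reflZ, reflZ_reflZ]

theorem inner_reflZ (x y : E3) : ⟪reflZ x, reflZ y⟫ = ⟪x, y⟫ := reflZEquiv.inner_map_map x y

theorem inner_reflZ_right (x y : E3) : ⟪x, reflZ y⟫ = ⟪reflZ x, y⟫ := by
  rw [← inner_reflZ, reflZ_reflZ]

theorem norm_reflZ (x : E3) : ‖reflZ x‖ = ‖x‖ := reflZEquiv.norm_map x

theorem reflZ_smul (r : ℝ) (x : E3) : reflZ (r • x) = r • reflZ x := reflZEquiv.map_smul r x

theorem reflZ_neg (x : E3) : reflZ (-x) = -reflZ x := map_neg reflZEquiv x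

theorem reflZ_sub (x y : E3) : reflZ (x - y) = reflZ x - reflZ y := map_sub reflZEquiv x y

theorem HasDerivAt.reflZ {f : ℝ → E3} {f' : E3} {s : ℝ} (hf : HasDerivAt f f' s) :
    HasDerivAt (fun s => reflZ (f s)) (reflZ f') s :=
  (reflZEquiv : E3 →L[ℝ] E3).hasFDerivAt.comp_hasDerivAt s hf

/-! ### Lipschitz functions -/

/-- Functions on the line that are Lipschitz with some constant. -/
def IsLip {V : Type*} [PseudoEMetricSpace V] (f : ℝ → V) : Prop := ∃ K, LipschitzWith K f

namespace IsLip

variable {V : Type*} [SeminormedAddCommGroup V]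

theorem id : IsLip fun s : ℝ => s := ⟨1, LipschitzWith.id⟩

theorem const {V : Type*} [PseudoEMetricSpace V] (v : V) : IsLip fun _ : ℝ => v :=
  ⟨0, LipschitzWith.const v⟩

theorem add {f g : ℝ → V} (hf : IsLip f) (hg : IsLip g) : IsLip fun s => f s + g s :=
  ⟨_, hf.choose_spec.add hg.choose_spec⟩

theorem sub {f g : ℝ → V} (hf : IsLip f) (hg : IsLip g) : IsLip fun s => f s - g s :=
  ⟨_, hf.choose_spec.sub hg.choose_spec⟩

theorem neg {f : ℝ → V} (hf : IsLip f) : IsLip fun s => -f s := ⟨_, hf.choose_spec.neg⟩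

theorem comp {V : Type*} [PseudoEMetricSpace V] {f : ℝ → V} {g : ℝ → ℝ} (hf : IsLip f)
    (hg : IsLip g) : IsLip fun s => f (g s) :=
  ⟨_, hf.choose_spec.comp hg.choose_spec⟩

theorem mul_const {f : ℝ → ℝ} (hf : IsLip f) (c : ℝ) : IsLip fun s => f s * c :=
  ⟨_, ((ContinuousLinearMap.mul ℝ ℝ).flip c).lipschitz.comp hf.choose_spec⟩

theorem smul_const [NormedSpace ℝ V] {f : ℝ → ℝ} (hf : IsLip f) (v : V) : IsLip fun s => f s • v :=
  ⟨_, (ContinuousLinearMap.toSpanSingleton ℝ v).lipschitz.comp hf.choose_spec⟩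

theorem vec3 {f g h : ℝ → ℝ} (hf : IsLip f) (hg : IsLip g) (hh : IsLip h) :
    IsLip fun s => (!₂[f s, g s, h s] : E3) := by
  simp only [vec3_eq]
  exact ((hf.smul_const _).add (hg.smul_const _)).add (hh.smul_const _)

theorem reflZ {f : ℝ → E3} (hf : IsLip f) : IsLip fun s => reflZ (f s) :=
  ⟨_, reflZEquiv.lipschitz.comp hf.choose_spec⟩

theorem abs : IsLip fun s : ℝ => |s| := ⟨1, LipschitzWith.of_dist_le_mul fun s t => by
  simpa [Real.dist_eq] using abs_abs_sub_abs_le s t⟩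

theorem min {f : ℝ → ℝ} (hf : IsLip f) (c : ℝ) : IsLip fun s => min (f s) c :=
  ⟨_, hf.choose_spec.min_const c⟩

theorem max {f : ℝ → ℝ} (hf : IsLip f) (c : ℝ) : IsLip fun s => max c (f s) :=
  ⟨_, hf.choose_spec.const_max c⟩

theorem of_deriv {f f' : ℝ → ℝ} (h : ∀ s, HasDerivAt f (f' s) s) {M : ℝ} (hM : ∀ s, |f' s| ≤ M) :
    IsLip f := by
  refine ⟨M.toNNReal, lipschitzWith_of_nnnorm_deriv_le (fun s => (h s).differentiableAt)
    fun s => ?_⟩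
  rw [(h s).deriv, ← NNReal.coe_le_coe, coe_nnnorm]
  exact (hM s).trans (Real.le_coe_toNNReal M)

end IsLip

theorem isLip_sin : IsLip Real.sin :=
  IsLip.of_deriv Real.hasDerivAt_sin Real.abs_cos_le_one

theorem isLip_cos : IsLip Real.cos :=
  IsLip.of_deriv Real.hasDerivAt_cos fun s => by rw [abs_neg]; exact Real.abs_sin_le_one s

theorem exists_claspSpeed_le {τ : ℝ} (h0 : 0 < τ) (h1 : τ ≤ 1) :
    ∃ M, ∀ s, |claspSpeed τ s| ≤ M := by
  obtain ⟨M, hM⟩ := isCompact_Icc.exists_bound_of_continuousOn (continuousOn_claspXDeriv h0 h1)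
  exact ⟨M, fun s => hM _ ⟨abs_nonneg _, Real.abs_sin_le_one s⟩⟩

theorem isLip_claspX_sin {τ : ℝ} (h0 : 0 < τ) (h1 : τ ≤ 1) :
    IsLip fun s => claspX τ (Real.sin s) := by
  obtain ⟨M, hM⟩ := exists_claspSpeed_le h0 h1
  refine IsLip.of_deriv (hasDerivAt_claspX_sin h0 h1) (M := M) fun s => ?_
  rw [abs_mul]
  exact (mul_le_of_le_one_right (abs_nonneg _) (Real.abs_cos_le_one s)).trans (hM s)

theorem isLip_claspZ {τ : ℝ} (h0 : 0 < τ) (h1 : τ ≤ 1) : IsLip (claspZ τ) := by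
  obtain ⟨M, hM⟩ := exists_claspSpeed_le h0 h1
  refine IsLip.of_deriv (hasDerivAt_claspZ h0 h1) (M := M) fun s => ?_
  rw [abs_mul]
  exact (mul_le_of_le_one_left (abs_nonneg _) (Real.abs_sin_le_one s)).trans (hM s)

/-! ### Truncation to a symmetric interval -/

/-- The nearest point of `[-r, r]`. -/
def clamp (r s : ℝ) : ℝ := max (-r) (min s r)

theorem isLip_clamp (r : ℝ) : IsLip (clamp r) := (IsLip.id.min r).max (-r)

theorem clamp_of_abs_le {r s : ℝ} (h : |s| ≤ r) : clamp r s = s := by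
  rw [clamp, min_eq_left (abs_le.1 h).2, max_eq_right (abs_le.1 h).1]

theorem clamp_of_le {r s : ℝ} (hr : 0 ≤ r) (h : r ≤ s) : clamp r s = r := by
  rw [clamp, min_eq_right h, max_eq_right (by linarith)]

theorem clamp_of_le_neg {r s : ℝ} (hr : 0 ≤ r) (h : s ≤ -r) : clamp r s = -r := by
  rw [clamp, min_eq_left (by linarith), max_eq_left h]

theorem trichotomy_abs (r s : ℝ) : |s| ≤ r ∨ r < s ∨ s < -r := by
  rcases le_or_gt |s| r with h | h
  · exact Or.inl h
  · exact Or.inr ((lt_abs.1 h).imp_right lt_neg.1)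

theorem clamp_neg {r : ℝ} (hr : 0 ≤ r) (s : ℝ) : clamp r (-s) = -clamp r s := by
  rcases trichotomy_abs r s with h | h | h
  · rw [clamp_of_abs_le h, clamp_of_abs_le (by rwa [abs_neg])]
  · rw [clamp_of_le hr h.le, clamp_of_le_neg hr (by linarith)]
  · rw [clamp_of_le_neg hr h.le, clamp_of_le hr (by linarith), neg_neg]

theorem hasDerivAt_clamp_of_abs_lt {r s : ℝ} (h : |s| < r) : HasDerivAt (clamp r) 1 s := by
  refine (hasDerivAt_id s).congr_of_eventuallyEq ?_
  filter_upwards [continuous_abs.continuousAt.eventually_lt_const h] with x hx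
  exact clamp_of_abs_le hx.le

theorem hasDerivAt_clamp_of_lt_abs {r s : ℝ} (hr : 0 ≤ r) (h : r < |s|) :
    HasDerivAt (clamp r) 0 s := by
  rcases lt_abs.1 h with h | h
  · refine (hasDerivAt_const s r).congr_of_eventuallyEq ?_
    filter_upwards [eventually_gt_nhds h] with x hx
    exact clamp_of_le hr hx.le
  · refine (hasDerivAt_const s (-r)).congr_of_eventuallyEq ?_
    filter_upwards [eventually_lt_nhds (lt_neg.1 h)] with x hx
    exact clamp_of_le_neg hr hx.le

/-! ### The curves of the chained clasp -/

/-- The horizontal coordinate of `γ`. -/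
def gammaX (τ s : ℝ) : ℝ :=
  claspX τ (Real.sin (clamp (Real.arcsin τ) s)) + (s - clamp (Real.arcsin τ) s) * √(1 - τ ^ 2)

/-- The height of `γ` above its tip. -/
def gammaHeight (τ s : ℝ) : ℝ :=
  claspZ τ (clamp (Real.arcsin τ) s) + |s - clamp (Real.arcsin τ) s| * τ

/-- The horizontal coordinate of the upper half of `α`. -/
def alphaX (τ s : ℝ) : ℝ :=
  claspX τ (Real.sin (clamp (Real.arcsin τ) s)) + Real.sin (clamp (Real.pi / 2) s) -
    Real.sin (clamp (Real.arcsin τ) s)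

/-- The height of the upper half of `α` above the tip of `γ`. -/
def alphaHeight (τ s : ℝ) : ℝ :=
  claspGap τ - claspZ τ (clamp (Real.arcsin τ) s) + Real.cos (clamp (Real.pi / 2) s) -
    Real.cos (clamp (Real.arcsin τ) s) - |s - clamp (Real.pi / 2) s|

/-- The unit tangent vector of `γ`. -/
def gammaTangent (τ s : ℝ) : E3 :=
  !₂[0, Real.cos (clamp (Real.arcsin τ) s), Real.sin (clamp (Real.arcsin τ) s)]

/-- Half the length of the parameter interval of the upper half of `α`. -/
def alphaHalf (d : ℝ) : ℝ := Real.pi / 2 + d / 2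

/-- The angle between the horizontal and the tangent of `α`. -/
def alphaAngle (d s : ℝ) : ℝ :=
  clamp (Real.pi / 2) s + clamp (Real.pi / 2) (s - 2 * alphaHalf d) + Real.pi / 2

/-- The unit tangent vector of `α`. -/
def alphaTangent (d s : ℝ) : E3 := !₂[Real.cos (alphaAngle d s), 0, -Real.sin (alphaAngle d s)]

/-- The speed of `γ` and of the upper half of `α`. -/
def upperSpeed (τ s : ℝ) : ℝ := if |s| < Real.arcsin τ then claspSpeed τ s else 1

/-- The speed of `α`. -/
def alphaSpeed (τ d s : ℝ) : ℝ :=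
  if s < alphaHalf d then upperSpeed τ s else upperSpeed τ (2 * alphaHalf d - s)

theorem arcsin_pos {τ : ℝ} (h0 : 0 < τ) : 0 < Real.arcsin τ := Real.arcsin_pos.2 h0

theorem claspZ_arcsin_eq (τ : ℝ) : claspZ τ (Real.arcsin τ) = claspGap τ - √(1 - τ ^ 2) := by
  rw [claspGap, add_sub_cancel_right]

section

variable {τ d s : ℝ}

theorem sin_arcsin_self (h0 : 0 < τ) (h1 : τ ≤ 1) : Real.sin (Real.arcsin τ) = τ :=
  Real.sin_arcsin (by linarith) h1

theorem gammaPath_of_abs_le (h : |s| ≤ Real.arcsin τ) :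
    gammaPath τ d s = !₂[0, claspX τ (Real.sin s), d / 2 + claspZ τ s] := if_pos h

theorem gammaPath_of_lt (h0 : 0 < τ) (h : Real.arcsin τ < s) :
    gammaPath τ d s = !₂[0, τ + (s - Real.arcsin τ) * √(1 - τ ^ 2),
      d / 2 + claspZ τ (Real.arcsin τ) + (s - Real.arcsin τ) * τ] := by
  have hs : 0 < s := (arcsin_pos h0).trans h
  rw [gammaPath, abs_of_pos hs, if_neg (not_le.2 h), sign_pos hs]
  simp

theorem gammaPath_of_lt_neg (h0 : 0 < τ) (h : s < -Real.arcsin τ) :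
    gammaPath τ d s = !₂[0, -(τ + (-s - Real.arcsin τ) * √(1 - τ ^ 2)),
      d / 2 + claspZ τ (Real.arcsin τ) + (-s - Real.arcsin τ) * τ] := by
  have hs : s < 0 := h.trans (neg_lt_zero.2 (arcsin_pos h0))
  rw [gammaPath, abs_of_neg hs, if_neg (not_le.2 (lt_neg.1 h)), sign_neg hs]
  simp

/-- The clamped form merges the three pieces into one composition of Lipschitz functions, so
Lipschitz continuity needs no discussion of the junctions. -/
theorem gammaPath_eq (h0 : 0 < τ) (h1 : τ ≤ 1) (d s : ℝ) :
    gammaPath τ d s = !₂[0, gammaX τ s, d / 2 + gammaHeight τ s] := by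
  have hθ := (arcsin_pos h0).le
  rcases trichotomy_abs (Real.arcsin τ) s with h | h | h
  · rw [gammaPath_of_abs_le h, gammaX, gammaHeight, clamp_of_abs_le h]
    simp
  · rw [gammaPath_of_lt h0 h, gammaX, gammaHeight, clamp_of_le hθ h.le, sin_arcsin_self h0 h1,
      claspX_self h0, abs_of_pos (sub_pos.2 h), add_assoc]
  · rw [gammaPath_of_lt_neg h0 h, gammaX, gammaHeight, clamp_of_le_neg hθ h.le, Real.sin_neg,
      sin_arcsin_self h0 h1, claspX_neg, claspX_self h0, claspZ_neg h0 h1,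
      abs_of_neg (by linarith), add_assoc]
    rw [show -(τ + (-s - Real.arcsin τ) * √(1 - τ ^ 2)) =
        -τ + (s - -Real.arcsin τ) * √(1 - τ ^ 2) by ring,
      show -s - Real.arcsin τ = -(s - -Real.arcsin τ) by ring]

theorem alphaUpper_of_abs_le (h : |s| ≤ Real.arcsin τ) :
    alphaUpper τ d s = !₂[claspX τ (Real.sin s), 0, d / 2 + claspGap τ - claspZ τ s] := if_pos h

theorem alphaUpper_of_abs_le_pi (h : Real.arcsin τ < |s|) (h' : |s| ≤ Real.pi / 2) :
    alphaUpper τ d s = !₂[Real.sin s, 0, d / 2 + Real.cos s] := by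
  rw [alphaUpper, if_neg (not_le.2 h), if_pos h']

theorem alphaUpper_of_lt (h : Real.pi / 2 < s) :
    alphaUpper τ d s = !₂[1, 0, d / 2 - (s - Real.pi / 2)] := by
  have hs : 0 < s := by linarith [Real.pi_pos]
  have := Real.arcsin_le_pi_div_two τ
  rw [alphaUpper, abs_of_pos hs, if_neg (by linarith), if_neg (not_le.2 h), sign_pos hs]
  simp

theorem alphaUpper_of_lt_neg (h : s < -(Real.pi / 2)) :
    alphaUpper τ d s = !₂[-1, 0, d / 2 - (-s - Real.pi / 2)] := by
  have hs : s < 0 := by linarith [Real.pi_pos]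
  have := Real.arcsin_le_pi_div_two τ
  rw [alphaUpper, abs_of_neg hs, if_neg (by linarith), if_neg (by linarith), sign_neg hs]
  simp

theorem alphaUpper_eq (h0 : 0 < τ) (h1 : τ ≤ 1) (d s : ℝ) :
    alphaUpper τ d s = !₂[alphaX τ s, 0, d / 2 + alphaHeight τ s] := by
  have hθ := (arcsin_pos h0).le
  have hπ := Real.arcsin_le_pi_div_two τ
  have hpi := Real.pi_pos
  rcases trichotomy_abs (Real.pi / 2) s with h' | h | h
  · rcases trichotomy_abs (Real.arcsin τ) s with h | h | h
    · rw [alphaUpper_of_abs_le h, alphaX, alphaHeight, clamp_of_abs_le h, clamp_of_abs_le h']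
      simp
      ring
    · rw [alphaUpper_of_abs_le_pi (lt_abs.2 (Or.inl h)) h', alphaX, alphaHeight,
        clamp_of_abs_le h', clamp_of_le hθ h.le, sin_arcsin_self h0 h1, claspX_self h0,
        Real.cos_arcsin, claspZ_arcsin_eq]
      simp
    · rw [alphaUpper_of_abs_le_pi (lt_abs.2 (Or.inr (lt_neg.1 h))) h', alphaX, alphaHeight,
        clamp_of_abs_le h', clamp_of_le_neg hθ h.le, Real.sin_neg, claspX_neg, Real.cos_neg,
        claspZ_neg h0 h1, sin_arcsin_self h0 h1, claspX_self h0,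
        Real.cos_arcsin, claspZ_arcsin_eq]
      simp
  · rw [alphaUpper_of_lt h, alphaX, alphaHeight, clamp_of_le (by linarith) h.le,
      clamp_of_le hθ (by linarith), sin_arcsin_self h0 h1, claspX_self h0,
        Real.cos_arcsin, claspZ_arcsin_eq, abs_of_pos (by linarith)]
    simp
    ring
  · rw [alphaUpper_of_lt_neg h, alphaX, alphaHeight, clamp_of_le_neg (by linarith) h.le,
      clamp_of_le_neg hθ (by linarith), Real.sin_neg, Real.sin_neg, claspX_neg, Real.cos_neg,
      Real.cos_neg, claspZ_neg h0 h1, sin_arcsin_self h0 h1,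
      claspX_self h0, Real.cos_arcsin, claspZ_arcsin_eq, abs_of_neg (by linarith)]
    simp
    ring

theorem alphaPath_of_le (h : s ≤ alphaHalf d) : alphaPath τ d s = alphaUpper τ d s := if_pos h

theorem alphaUpper_alphaHalf (hd : 1 ≤ d) : alphaUpper τ d (alphaHalf d) = !₂[1, 0, 0] := by
  rw [alphaUpper_of_lt (by rw [alphaHalf]; linarith), alphaHalf]
  simp

theorem alphaPath_of_ge (hd : 1 ≤ d) (h : alphaHalf d ≤ s) :
    alphaPath τ d s = reflZ (alphaUpper τ d (2 * alphaHalf d - s)) := by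
  rcases h.eq_or_lt with rfl | h
  · rw [alphaPath_of_le le_rfl, show 2 * alphaHalf d - alphaHalf d = alphaHalf d by ring,
      alphaUpper_alphaHalf hd, reflZ_vec3, neg_zero]
  · exact if_neg (not_le.2 h)

theorem alphaPath_reflect (hd : 1 ≤ d) (s : ℝ) :
    alphaPath τ d (2 * alphaHalf d - s) = reflZ (alphaPath τ d s) := by
  rcases le_total s (alphaHalf d) with h | h
  · rw [alphaPath_of_ge hd (by linarith), alphaPath_of_le h, sub_sub_cancel]
  · rw [alphaPath_of_ge hd h, alphaPath_of_le (by linarith), reflZ_reflZ]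

/-- One of the two summands is always frozen at the junction `(1, 0, 0)`, which is subtracted again.
This makes the closed curve a sum of Lipschitz curves. -/
theorem alphaPath_eq (hd : 1 ≤ d) (s : ℝ) :
    alphaPath τ d s = alphaUpper τ d (min s (alphaHalf d)) +
      reflZ (alphaUpper τ d (min (2 * alphaHalf d - s) (alphaHalf d))) - !₂[1, 0, 0] := by
  rcases le_total s (alphaHalf d) with h | h
  · rw [alphaPath_of_le h, min_eq_left h, min_eq_right (by linarith), alphaUpper_alphaHalf hd,
      reflZ_vec3, neg_zero, add_sub_cancel_right]
  · rw [alphaPath_of_ge hd h, min_eq_right h, min_eq_left (by linarith), alphaUpper_alphaHalf hd,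
      add_sub_cancel_left]

theorem isLip_gammaPath (h0 : 0 < τ) (h1 : τ ≤ 1) (d : ℝ) : IsLip (gammaPath τ d) := by
  have hp := isLip_clamp (Real.arcsin τ)
  have hq := IsLip.id.sub hp
  rw [funext (gammaPath_eq h0 h1 d)]
  unfold gammaX gammaHeight
  exact IsLip.vec3 (IsLip.const 0) (((isLip_claspX_sin h0 h1).comp hp).add (hq.mul_const _))
    ((IsLip.const _).add (((isLip_claspZ h0 h1).comp hp).add ((IsLip.abs.comp hq).mul_const _)))

theorem isLip_alphaUpper (h0 : 0 < τ) (h1 : τ ≤ 1) (d : ℝ) : IsLip (alphaUpper τ d) := by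
  have hp := isLip_clamp (Real.arcsin τ)
  have hp' := isLip_clamp (Real.pi / 2)
  rw [funext (alphaUpper_eq h0 h1 d)]
  unfold alphaX alphaHeight
  exact IsLip.vec3
    ((((isLip_claspX_sin h0 h1).comp hp).add (isLip_sin.comp hp')).sub (isLip_sin.comp hp))
    (IsLip.const 0)
    ((IsLip.const _).add (((((IsLip.const _).sub ((isLip_claspZ h0 h1).comp hp)).add
      (isLip_cos.comp hp')).sub (isLip_cos.comp hp)).sub (IsLip.abs.comp (IsLip.id.sub hp'))))

theorem isLip_alphaPath (h0 : 0 < τ) (h1 : τ ≤ 1) (hd : 1 ≤ d) : IsLip (alphaPath τ d) := by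
  have h := isLip_alphaUpper h0 h1 d
  rw [funext (alphaPath_eq (τ := τ) hd)]
  exact ((h.comp (IsLip.id.min _)).add
    (h.comp (((IsLip.const _).sub IsLip.id).min _)).reflZ).sub (IsLip.const _)

/-- In the angle parameter the tangent is Lipschitz for every `τ`, including `τ = 1`. Hence the
curvature force has a bounded density and no atoms. -/
theorem isLip_gammaTangent (τ : ℝ) : IsLip (gammaTangent τ) :=
  IsLip.vec3 (IsLip.const 0) (isLip_cos.comp (isLip_clamp _)) (isLip_sin.comp (isLip_clamp _))

theorem isLip_alphaTangent (d : ℝ) : IsLip (alphaTangent d) := by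
  have h : IsLip (alphaAngle d) := ((isLip_clamp _).add
    ((isLip_clamp _).comp (IsLip.id.sub (IsLip.const _)))).add (IsLip.const _)
  exact IsLip.vec3 (isLip_cos.comp h) (IsLip.const 0) (isLip_sin.comp h).neg

theorem norm_gammaTangent (τ s : ℝ) : ‖gammaTangent τ s‖ = 1 := by
  rw [← sq_eq_sq₀ (norm_nonneg _) zero_le_one, norm_sq_vec3]
  simp [gammaTangent]

theorem norm_alphaTangent (d s : ℝ) : ‖alphaTangent d s‖ = 1 := by
  rw [← sq_eq_sq₀ (norm_nonneg _) zero_le_one, norm_sq_vec3]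
  simp [alphaTangent]

theorem upperSpeed_pos (h0 : 0 < τ) (h1 : τ ≤ 1) (hs : s ≠ 0) : 0 < upperSpeed τ s := by
  unfold upperSpeed
  split_ifs with h
  · exact claspSpeed_pos h0 h1 hs h.le
  · exact one_pos

theorem hasDerivAt_gammaPath (h0 : 0 < τ) (h1 : τ ≤ 1) (d : ℝ) (hs : |s| ≠ Real.arcsin τ) :
    HasDerivAt (gammaPath τ d) (upperSpeed τ s • gammaTangent τ s) s := by
  have hθ := (arcsin_pos h0).le
  rcases hs.lt_or_gt with h | h
  · have he : gammaPath τ d =ᶠ[nhds s]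
        fun s => !₂[0, claspX τ (Real.sin s), d / 2 + claspZ τ s] := by
      filter_upwards [continuous_abs.continuousAt.eventually_lt_const h] with x hx
      exact gammaPath_of_abs_le hx.le
    refine (((hasDerivAt_const s (0 : ℝ)).vec3 (hasDerivAt_claspX_sin h0 h1 s)
      ((hasDerivAt_claspZ h0 h1 s).const_add _)).congr_of_eventuallyEq he).congr_deriv ?_
    rw [upperSpeed, if_pos h, gammaTangent, clamp_of_abs_le h.le]
    ext i
    fin_cases i <;> simp [mul_comm]
  · rw [upperSpeed, if_neg h.not_gt, one_smul, gammaTangent]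
    rcases lt_abs.1 h with h | h
    · have he : gammaPath τ d =ᶠ[nhds s] fun s => !₂[0, τ + (s - Real.arcsin τ) * √(1 - τ ^ 2),
          d / 2 + claspZ τ (Real.arcsin τ) + (s - Real.arcsin τ) * τ] := by
        filter_upwards [eventually_gt_nhds h] with x hx using gammaPath_of_lt h0 hx
      have hl := (hasDerivAt_id s).sub_const (Real.arcsin τ)
      refine (((hasDerivAt_const s (0 : ℝ)).vec3 ((hl.mul_const _).const_add _)
        ((hl.mul_const _).const_add _)).congr_of_eventuallyEq he).congr_deriv ?_
      rw [clamp_of_le hθ h.le, sin_arcsin_self h0 h1, Real.cos_arcsin, one_mul, one_mul]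
    · have h := lt_neg.1 h
      have he : gammaPath τ d =ᶠ[nhds s]
          fun s => !₂[0, -(τ + (-s - Real.arcsin τ) * √(1 - τ ^ 2)),
            d / 2 + claspZ τ (Real.arcsin τ) + (-s - Real.arcsin τ) * τ] := by
        filter_upwards [eventually_lt_nhds h] with x hx using gammaPath_of_lt_neg h0 hx
      have hl := (hasDerivAt_neg s).sub_const (Real.arcsin τ)
      refine (((hasDerivAt_const s (0 : ℝ)).vec3 ((hl.mul_const _).const_add _).neg
        ((hl.mul_const _).const_add _)).congr_of_eventuallyEq he).congr_deriv ?_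
      rw [clamp_of_le_neg hθ h.le, Real.sin_neg, Real.cos_neg, sin_arcsin_self h0 h1,
        Real.cos_arcsin]
      simp

theorem hasDerivAt_alphaUpper (h0 : 0 < τ) (h1 : τ ≤ 1) (d : ℝ) (hs : |s| ≠ Real.arcsin τ)
    (hs' : |s| ≠ Real.pi / 2) :
    HasDerivAt (alphaUpper τ d) (upperSpeed τ s •
      !₂[Real.cos (clamp (Real.pi / 2) s), 0, -Real.sin (clamp (Real.pi / 2) s)]) s := by
  have hπ := Real.arcsin_le_pi_div_two τ
  have hpi := Real.pi_pos
  rcases hs.lt_or_gt with h | h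
  · have he : alphaUpper τ d =ᶠ[nhds s]
        fun s => !₂[claspX τ (Real.sin s), 0, d / 2 + claspGap τ - claspZ τ s] := by
      filter_upwards [continuous_abs.continuousAt.eventually_lt_const h] with x hx
      exact alphaUpper_of_abs_le hx.le
    refine (((hasDerivAt_claspX_sin h0 h1 s).vec3 (hasDerivAt_const s (0 : ℝ))
      ((hasDerivAt_claspZ h0 h1 s).const_sub _)).congr_of_eventuallyEq he).congr_deriv ?_
    rw [upperSpeed, if_pos h, clamp_of_abs_le (h.le.trans hπ)]
    ext i
    fin_cases i <;> simp [mul_comm]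
  · rw [upperSpeed, if_neg h.not_gt, one_smul]
    rcases hs'.lt_or_gt with h' | h'
    · have he : alphaUpper τ d =ᶠ[nhds s] fun s => !₂[Real.sin s, 0, d / 2 + Real.cos s] := by
        filter_upwards [continuous_abs.continuousAt.eventually_lt_const h',
          continuous_abs.continuousAt.eventually_const_lt h] with x hx hx'
        exact alphaUpper_of_abs_le_pi hx' hx.le
      refine (((Real.hasDerivAt_sin s).vec3 (hasDerivAt_const s (0 : ℝ))
        ((Real.hasDerivAt_cos s).const_add _)).congr_of_eventuallyEq he).congr_deriv ?_
      rw [clamp_of_abs_le h'.le]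
    · rcases lt_abs.1 h' with h' | h'
      · have he : alphaUpper τ d =ᶠ[nhds s] fun s => !₂[1, 0, d / 2 - (s - Real.pi / 2)] := by
          filter_upwards [eventually_gt_nhds h'] with x hx using alphaUpper_of_lt hx
        refine (((hasDerivAt_const s (1 : ℝ)).vec3 (hasDerivAt_const s (0 : ℝ))
          (((hasDerivAt_id s).sub_const _).const_sub _)).congr_of_eventuallyEq he).congr_deriv ?_
        rw [clamp_of_le (by linarith) h'.le]
        simp
      · have h' := lt_neg.1 h'
        have he : alphaUpper τ d =ᶠ[nhds s] fun s => !₂[-1, 0, d / 2 - (-s - Real.pi / 2)] := by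
          filter_upwards [eventually_lt_nhds h'] with x hx using alphaUpper_of_lt_neg hx
        refine (((hasDerivAt_const s (-1 : ℝ)).vec3 (hasDerivAt_const s (0 : ℝ))
          (((hasDerivAt_neg s).sub_const _).const_sub _)).congr_of_eventuallyEq he).congr_deriv ?_
        rw [clamp_of_le_neg (by linarith) h'.le]
        simp

/-- On the upper half the second clamp is stuck at `-π / 2` and cancels the constant in
`alphaAngle`. Beyond it the first clamp is stuck at `π / 2`, and the angle continues to `3 π / 2`,
giving total turning `2 π`. -/
theorem alphaAngle_of_le (hd : 1 ≤ d) (h : s ≤ alphaHalf d) :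
    alphaAngle d s = clamp (Real.pi / 2) s := by
  have hpi := Real.pi_pos
  unfold alphaHalf at h
  rw [alphaAngle, clamp_of_le_neg (by linarith) (s := s - 2 * alphaHalf d)
    (by rw [alphaHalf]; linarith)]
  ring

theorem alphaAngle_of_ge (hd : 1 ≤ d) (h : alphaHalf d ≤ s) :
    alphaAngle d s = Real.pi - clamp (Real.pi / 2) (2 * alphaHalf d - s) := by
  have hpi := Real.pi_pos
  unfold alphaHalf at h
  rw [alphaAngle, clamp_of_le (by linarith) (s := s) (by linarith),
    show s - 2 * alphaHalf d = -(2 * alphaHalf d - s) by ring, clamp_neg (by linarith)]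
  ring

theorem hasDerivAt_alphaPath (h0 : 0 < τ) (h1 : τ ≤ 1) (hd : 1 ≤ d)
    (hs : s ≠ alphaHalf d) (hs1 : |s| ≠ Real.arcsin τ) (hs2 : |s| ≠ Real.pi / 2)
    (hs3 : |2 * alphaHalf d - s| ≠ Real.arcsin τ) (hs4 : |2 * alphaHalf d - s| ≠ Real.pi / 2) :
    HasDerivAt (alphaPath τ d) (alphaSpeed τ d s • alphaTangent d s) s := by
  rcases hs.lt_or_gt with h | h
  · rw [alphaSpeed, if_pos h, alphaTangent, alphaAngle_of_le hd h.le]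
    refine (hasDerivAt_alphaUpper h0 h1 d hs1 hs2).congr_of_eventuallyEq ?_
    filter_upwards [eventually_lt_nhds h] with x hx using alphaPath_of_le hx.le
  · rw [alphaSpeed, if_neg h.not_gt, alphaTangent, alphaAngle_of_ge hd h.le]
    have h2 : HasDerivAt (fun s => 2 * alphaHalf d - s) (-1) s := by
      simpa using (hasDerivAt_id s).const_sub (2 * alphaHalf d)
    have h3 := ((hasDerivAt_alphaUpper h0 h1 d hs3 hs4).scomp s h2).reflZ
    have he : alphaPath τ d =ᶠ[nhds s] fun s => reflZ (alphaUpper τ d (2 * alphaHalf d - s)) := by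
      filter_upwards [eventually_gt_nhds h] with x hx using alphaPath_of_ge hd hx.le
    refine (h3.congr_of_eventuallyEq he).congr_deriv ?_
    rw [reflZ_smul, reflZ_smul, reflZ_vec3, Real.cos_pi_sub, Real.sin_pi_sub]
    ext i
    fin_cases i <;> simp

end

theorem ae_ne (a : ℝ) : ∀ᵐ s : ℝ, s ≠ a := compl_mem_ae_iff.2 (measure_singleton a)

theorem ae_abs_ne (r : ℝ) : ∀ᵐ s : ℝ, |s| ≠ r := by
  filter_upwards [ae_ne r, ae_ne (-r)] with s h1 h2 h
  rcases abs_choice s with h' | h' <;> rw [h'] at h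
  · exact h1 h
  · exact h2 (by linarith)

theorem ae_abs_sub_ne (a r : ℝ) : ∀ᵐ s : ℝ, |a - s| ≠ r := by
  filter_upwards [ae_ne (a - r), ae_ne (a + r)] with s h1 h2 h
  rcases abs_choice (a - s) with h' | h' <;> rw [h'] at h
  · exact h1 (by linarith)
  · exact h2 (by linarith)

section

variable {τ d : ℝ}

theorem ae_hasDerivAt_gammaPath (h0 : 0 < τ) (h1 : τ ≤ 1) (d : ℝ) :
    ∀ᵐ s : ℝ, 0 < upperSpeed τ s ∧
      HasDerivAt (gammaPath τ d) (upperSpeed τ s • gammaTangent τ s) s := by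
  filter_upwards [ae_ne 0, ae_abs_ne (Real.arcsin τ)] with s h h'
  exact ⟨upperSpeed_pos h0 h1 h, hasDerivAt_gammaPath h0 h1 d h'⟩

theorem ae_hasDerivAt_alphaPath (h0 : 0 < τ) (h1 : τ ≤ 1) (hd : 1 ≤ d) :
    ∀ᵐ s : ℝ, 0 < alphaSpeed τ d s ∧
      HasDerivAt (alphaPath τ d) (alphaSpeed τ d s • alphaTangent d s) s := by
  filter_upwards [ae_ne 0, ae_ne (2 * alphaHalf d), ae_ne (alphaHalf d), ae_abs_ne (Real.arcsin τ),
    ae_abs_ne (Real.pi / 2), ae_abs_sub_ne (2 * alphaHalf d) (Real.arcsin τ),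
    ae_abs_sub_ne (2 * alphaHalf d) (Real.pi / 2)] with s hs0 hs1 hs2 hs3 hs4 hs5 hs6
  refine ⟨?_, hasDerivAt_alphaPath h0 h1 hd hs2 hs3 hs4 hs5 hs6⟩
  unfold alphaSpeed
  split_ifs
  · exact upperSpeed_pos h0 h1 hs0
  · exact upperSpeed_pos h0 h1 (sub_ne_zero.2 hs1.symm)

end

/-! ### Distances between the components -/

section

variable {τ c d : ℝ}

theorem claspX_arcsin (h0 : 0 < τ) (h1 : τ ≤ 1) : claspX τ (Real.sin (Real.arcsin τ)) = τ := by
  rw [sin_arcsin_self h0 h1, claspX_self h0]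

theorem gammaHeight_nonneg (h0 : 0 < τ) (h1 : τ ≤ 1) (s : ℝ) : 0 ≤ gammaHeight τ s := by
  refine add_nonneg (claspZ_nonneg h0 h1 ?_) (by positivity)
  have := arcsin_pos h0
  rw [clamp, abs_le]
  exact ⟨le_max_left _ _, max_le (by linarith) (min_le_right _ _)⟩

theorem gammaHeight_pos (h0 : 0 < τ) (h1 : τ ≤ 1) {s : ℝ} (hs : s ≠ 0) : 0 < gammaHeight τ s := by
  have hθ := arcsin_pos h0
  have hz : ∀ s, s ≠ 0 → |s| ≤ Real.arcsin τ → 0 < claspZ τ s := by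
    intro s hs hs'
    rw [← claspZ_abs h0 h1, ← claspZ_zero τ]
    exact claspZ_strictMonoOn h0 h1 ⟨le_rfl, hθ.le⟩ ⟨abs_nonneg s, hs'⟩ (abs_pos.2 hs)
  rw [gammaHeight]
  rcases trichotomy_abs (Real.arcsin τ) s with h | h | h
  · rw [clamp_of_abs_le h]
    exact add_pos_of_pos_of_nonneg (hz s hs h) (by positivity)
  · rw [clamp_of_le hθ.le h.le]
    exact add_pos_of_pos_of_nonneg (hz _ hθ.ne' (abs_of_pos hθ).le) (by positivity)
  · rw [clamp_of_le_neg hθ.le h.le]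
    refine add_pos_of_pos_of_nonneg (hz _ (neg_ne_zero.2 hθ.ne') ?_) (by positivity)
    rw [abs_neg, abs_of_pos hθ]

/-- Along a straight end of `γ` the squared distance exceeds its value at the end of the clasp arc
by `2 l τ * claspZ τ s + l ^ 2`, where `l` is the length traversed. This uses `claspGap τ - claspZ τ
(arcsin τ) = √(1 - τ ^ 2)`. -/
theorem one_le_clasp_gamma (h0 : 0 < τ) (h1 : τ ≤ 1) {s : ℝ} (hs : |s| ≤ Real.arcsin τ) (t : ℝ) :
    1 ≤ claspX τ (Real.sin s) ^ 2 + gammaX τ t ^ 2 +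
      (claspGap τ - claspZ τ s - gammaHeight τ t) ^ 2 := by
  have hθ := (arcsin_pos h0).le
  have hz := claspZ_nonneg h0 h1 hs
  have key : ∀ l, 0 ≤ l → 1 ≤ claspX τ (Real.sin s) ^ 2 + (τ + l * √(1 - τ ^ 2)) ^ 2 +
      (claspGap τ - claspZ τ s - (claspZ τ (Real.arcsin τ) + l * τ)) ^ 2 := by
    intro l hl
    have h := one_le_clasp_dist_sq h0 h1 hs (abs_of_nonneg hθ).le
    rw [claspX_arcsin h0 h1] at h
    have e : √(1 - τ ^ 2) ^ 2 = 1 - τ ^ 2 := Real.sq_sqrt (by nlinarith)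
    rw [claspZ_arcsin_eq] at h ⊢
    nlinarith [mul_nonneg (mul_nonneg hl h0.le) hz, sq_nonneg l]
  rcases trichotomy_abs (Real.arcsin τ) t with h | h | h
  · have := one_le_clasp_dist_sq h0 h1 hs h
    simpa [gammaX, gammaHeight, clamp_of_abs_le h] using this
  · have := key (t - Real.arcsin τ) (by linarith)
    rwa [gammaX, gammaHeight, clamp_of_le hθ h.le, claspX_arcsin h0 h1, abs_of_pos (by linarith)]
  · have := key (-(t - -Real.arcsin τ)) (by linarith)
    rw [gammaX, gammaHeight, clamp_of_le_neg hθ h.le, Real.sin_neg, claspX_neg, claspZ_neg h0 h1,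
      claspX_arcsin h0 h1, abs_of_neg (by linarith)]
    convert this using 3
    ring

theorem one_le_alpha_gamma (h0 : 0 < τ) (h1 : τ ≤ 1) (s t : ℝ) :
    1 ≤ alphaX τ s ^ 2 + gammaX τ t ^ 2 + (alphaHeight τ s - gammaHeight τ t) ^ 2 := by
  have hθ := (arcsin_pos h0).le
  have hπ := Real.arcsin_le_pi_div_two τ
  have hpi := Real.pi_pos
  have hend := one_le_clasp_gamma h0 h1 (abs_of_nonneg hθ).le t
  rw [claspX_arcsin h0 h1, claspZ_arcsin_eq, sub_sub_cancel] at hend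
  have e : √(1 - τ ^ 2) ^ 2 = 1 - τ ^ 2 := Real.sq_sqrt (by nlinarith)
  have hg := gammaHeight_nonneg h0 h1 t
  -- The estimate for the end of the clasp arc of `α` says that a point of `γ` has squared distance
  -- from the tip at least `2 √(1 - τ ^ 2)` times its height. Further along the circle `cos p` is
  -- smaller, so the same inequality suffices. Vertical segments are at distance one from the plane
  -- of `γ`.
  have circ : ∀ p, Real.arcsin τ ≤ p → p ≤ Real.pi / 2 →
      1 ≤ Real.sin p ^ 2 + gammaX τ t ^ 2 + (Real.cos p - gammaHeight τ t) ^ 2 := by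
    intro p hp hp'
    have hc : Real.cos p ≤ √(1 - τ ^ 2) := by
      rw [← Real.cos_arcsin]
      exact Real.cos_le_cos_of_nonneg_of_le_pi hθ (by linarith) hp
    nlinarith [Real.sin_sq_add_cos_sq p, mul_le_mul_of_nonneg_left hc hg]
  rcases trichotomy_abs (Real.pi / 2) s with h' | h' | h'
  · rcases trichotomy_abs (Real.arcsin τ) s with h | h | h
    · have := one_le_clasp_gamma h0 h1 h t
      simpa [alphaX, alphaHeight, clamp_of_abs_le h, clamp_of_abs_le h'] using this
    · have := circ s h.le (abs_le.1 h').2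
      simpa [alphaX, alphaHeight, clamp_of_le hθ h.le, clamp_of_abs_le h', claspX_arcsin h0 h1,
        sin_arcsin_self h0 h1, claspX_self h0, claspZ_arcsin_eq, Real.cos_arcsin] using this
    · have := circ (-s) (by linarith) (by linarith [(abs_le.1 h').1])
      simpa [alphaX, alphaHeight, clamp_of_le_neg hθ h.le, clamp_of_abs_le h', claspX_neg,
        claspZ_neg h0 h1, sin_arcsin_self h0 h1, claspX_self h0, claspZ_arcsin_eq,
        Real.cos_arcsin] using this
  · have : alphaX τ s = 1 := by
      rw [alphaX, clamp_of_le hθ (by linarith), clamp_of_le (by linarith) h'.le,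
        claspX_arcsin h0 h1, sin_arcsin_self h0 h1, Real.sin_pi_div_two]
      ring
    rw [this]
    nlinarith [sq_nonneg (gammaX τ t), sq_nonneg (alphaHeight τ s - gammaHeight τ t)]
  · have : alphaX τ s = -1 := by
      rw [alphaX, clamp_of_le_neg hθ (by linarith), clamp_of_le_neg (by linarith) h'.le,
        Real.sin_neg, Real.sin_neg, claspX_neg, claspX_arcsin h0 h1, sin_arcsin_self h0 h1,
        Real.sin_pi_div_two]
      ring
    rw [this]
    nlinarith [sq_nonneg (gammaX τ t), sq_nonneg (alphaHeight τ s - gammaHeight τ t)]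

theorem sqrt_le_claspGap (h0 : 0 < τ) (h1 : τ ≤ 1) : √(1 - τ ^ 2) ≤ claspGap τ := by
  rw [claspGap]
  linarith [claspZ_nonneg h0 h1 (s := Real.arcsin τ) (abs_of_pos (arcsin_pos h0)).le]

/-- The lower bound keeps the upper half of `α` in `z ≥ 0`, so its mirror image is no closer to `γ`;
the upper bound keeps `α` away from the walls. -/
theorem alphaHeight_mem (h0 : 0 < τ) (h1 : τ ≤ 1) {s : ℝ} (hd : 1 ≤ d) (hs : |s| ≤ alphaHalf d) :
    -(d / 2) ≤ alphaHeight τ s ∧ alphaHeight τ s ≤ claspGap τ := by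
  have hθ := (arcsin_pos h0).le
  have hπ := Real.arcsin_le_pi_div_two τ
  have hpi := Real.pi_pos
  have hgap := sqrt_le_claspGap h0 h1
  have hsq := Real.sqrt_nonneg (1 - τ ^ 2)
  rw [alphaHalf] at hs
  have hs1 := (abs_le.1 hs).1
  have hs2 := (abs_le.1 hs).2
  have circ : ∀ p, Real.arcsin τ ≤ p → p ≤ Real.pi / 2 →
      0 ≤ Real.cos p ∧ Real.cos p ≤ √(1 - τ ^ 2) := by
    intro p hp hp'
    rw [← Real.cos_arcsin]
    exact ⟨Real.cos_nonneg_of_neg_pi_div_two_le_of_le (by linarith) hp',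
      Real.cos_le_cos_of_nonneg_of_le_pi hθ (by linarith) hp⟩
  rcases trichotomy_abs (Real.pi / 2) s with h' | h' | h'
  · rcases trichotomy_abs (Real.arcsin τ) s with h | h | h
    · have h2 := claspZ_nonneg h0 h1 h
      have h3 := claspZ_le h0 h1 h
      rw [claspZ_arcsin_eq] at h3
      rw [alphaHeight, clamp_of_abs_le h, clamp_of_abs_le h', sub_self, abs_zero]
      constructor <;> linarith
    · have := circ s h.le (abs_le.1 h').2
      rw [alphaHeight, clamp_of_le hθ h.le, clamp_of_abs_le h', sub_self, abs_zero,
        claspZ_arcsin_eq, Real.cos_arcsin]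
      constructor <;> linarith
    · have := circ (-s) (by linarith) (by linarith [(abs_le.1 h').1])
      rw [Real.cos_neg] at this
      rw [alphaHeight, clamp_of_le_neg hθ h.le, clamp_of_abs_le h', sub_self, abs_zero,
        claspZ_neg h0 h1, Real.cos_neg, claspZ_arcsin_eq, Real.cos_arcsin]
      constructor <;> linarith
  · rw [alphaHeight, clamp_of_le hθ (by linarith), clamp_of_le (by linarith) h'.le,
      abs_of_pos (by linarith), claspZ_arcsin_eq, Real.cos_arcsin, Real.cos_pi_div_two]
    constructor <;> linarith
  · rw [alphaHeight, clamp_of_le_neg hθ (by linarith), clamp_of_le_neg (by linarith) h'.le,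
      abs_of_neg (by linarith), claspZ_neg h0 h1, Real.cos_neg, Real.cos_neg, claspZ_arcsin_eq,
      Real.cos_arcsin, Real.cos_pi_div_two]
    constructor <;> linarith

/-- Points of `α` are mirror images of one another, or in the upper half. -/
theorem alphaPath_cases (hd : 1 ≤ d) {s : ℝ} (hs : s ∈ Icc (-alphaHalf d) (3 * alphaHalf d)) :
    ∃ s', |s'| ≤ alphaHalf d ∧
      (alphaPath τ d s = alphaUpper τ d s' ∨ alphaPath τ d s = reflZ (alphaUpper τ d s')) := by
  rcases le_total s (alphaHalf d) with h | h
  · exact ⟨s, abs_le.2 ⟨hs.1, h⟩, Or.inl (alphaPath_of_le h)⟩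
  · exact ⟨2 * alphaHalf d - s, abs_le.2 ⟨by linarith [hs.2], by linarith⟩,
      Or.inr (alphaPath_of_ge hd h)⟩

theorem one_le_dist_alpha_gamma (h0 : 0 < τ) (h1 : τ ≤ 1) (hd : 1 ≤ d) {s : ℝ}
    (hs : s ∈ Icc (-alphaHalf d) (3 * alphaHalf d)) (t : ℝ) :
    1 ≤ dist (alphaPath τ d s) (gammaPath τ d t) := by
  obtain ⟨s', hs', h⟩ := alphaPath_cases (τ := τ) hd hs
  have h2 := one_le_alpha_gamma h0 h1 s' t
  refine one_le_dist_of_sq ?_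
  rw [dist_sq_vec3]
  rcases h with h | h <;> rw [h, gammaPath_eq h0 h1, alphaUpper_eq h0 h1]
  · simp
    linarith
  -- Both heights are nonnegative, so changing the sign of one of them can only increase the
  -- distance.
  · have h3 := (alphaHeight_mem h0 h1 hd hs').1
    have h4 := gammaHeight_nonneg h0 h1 t
    simp [reflZ]
    nlinarith [mul_nonneg (show 0 ≤ d / 2 + alphaHeight τ s' by linarith)
      (show 0 ≤ d / 2 + gammaHeight τ t by linarith)]

theorem one_le_dist_alpha_beta (h0 : 0 < τ) (h1 : τ ≤ 1) (hd : 1 ≤ d) {s : ℝ}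
    (hs : s ∈ Icc (-alphaHalf d) (3 * alphaHalf d)) (t : ℝ) :
    1 ≤ dist (alphaPath τ d s) (reflZ (gammaPath τ d t)) := by
  rw [dist_reflZ_right, ← alphaPath_reflect hd]
  exact one_le_dist_alpha_gamma h0 h1 hd ⟨by linarith [hs.2], by linarith [hs.1]⟩ t

theorem dist_sq_beta_gamma (h0 : 0 < τ) (h1 : τ ≤ 1) (s t : ℝ) :
    (d + gammaHeight τ s + gammaHeight τ t) ^ 2 ≤
      dist (reflZ (gammaPath τ d s)) (gammaPath τ d t) ^ 2 := by
  rw [dist_sq_vec3, gammaPath_eq h0 h1, gammaPath_eq h0 h1]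
  simp [reflZ]
  nlinarith [sq_nonneg (gammaX τ s - gammaX τ t)]

theorem one_le_dist_beta_gamma (h0 : 0 < τ) (h1 : τ ≤ 1) (hd : 1 ≤ d) (s t : ℝ) :
    1 ≤ dist (reflZ (gammaPath τ d s)) (gammaPath τ d t) := by
  refine one_le_dist_of_sq (le_trans ?_ (dist_sq_beta_gamma h0 h1 s t))
  have := gammaHeight_nonneg h0 h1 s
  have := gammaHeight_nonneg h0 h1 t
  nlinarith

/-- Different components are at distance at least one. -/
theorem chainedClasp_one_le_dist (h0 : 0 < τ) (h1 : τ ≤ 1) (hd : 1 ≤ d) {i j : Fin 3}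
    (hij : i ≠ j) {s t : ℝ} (hs : s ∈ ((chainedClasp τ d c).strand i).dom)
    (ht : t ∈ ((chainedClasp τ d c).strand j).dom) :
    1 ≤ dist (((chainedClasp τ d c).strand i).path s) (((chainedClasp τ d c).strand j).path t) := by
  fin_cases i <;> fin_cases j
  · exact absurd rfl hij
  · exact one_le_dist_alpha_beta h0 h1 hd hs t
  · exact one_le_dist_alpha_gamma h0 h1 hd hs t
  · rw [dist_comm]
    exact one_le_dist_alpha_beta h0 h1 hd ht s
  · exact absurd rfl hij
  · exact one_le_dist_beta_gamma h0 h1 hd s t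
  · rw [dist_comm]
    exact one_le_dist_alpha_gamma h0 h1 hd ht s
  · rw [dist_comm]
    exact one_le_dist_beta_gamma h0 h1 hd t s
  · exact absurd rfl hij

/-! ### The configuration is a generalized link -/

theorem norm_wallNormal (h0 : 0 < τ) (h1 : τ ≤ 1) {σ ρ : ℝ} (hσ : σ ^ 2 = 1) (hρ : ρ ^ 2 = 1) :
    ⟪wallNormal τ σ ρ, wallNormal τ σ ρ⟫ = 1 := by
  have e : √(1 - τ ^ 2) ^ 2 = 1 - τ ^ 2 := Real.sq_sqrt (by nlinarith)
  rw [inner_vec3]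
  simp [wallNormal]
  linear_combination √(1 - τ ^ 2) ^ 2 * hσ + τ ^ 2 * hρ + e

theorem mem_wallPlane {n p : E3} (hn : ⟪n, n⟫ = 1) (hp : ⟪n, p⟫ = c) : p ∈ wallPlane n c := by
  rw [wallPlane, AffineSubspace.mem_mk', vsub_eq_sub,
    Submodule.mem_orthogonal_singleton_iff_inner_right,
    inner_sub_right, real_inner_smul_right, hn, hp]
  ring

theorem inner_wallNormal (τ σ ρ : ℝ) (p : E3) :
    ⟪wallNormal τ σ ρ, p⟫ = σ * √(1 - τ ^ 2) * p 1 + ρ * τ * p 2 := by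
  rw [inner_vec3]
  simp [wallNormal]

theorem mem_direction_wallPlane {n v : E3} (h : v ∈ (wallPlane n c).direction) : ⟪n, v⟫ = 0 := by
  rwa [wallPlane, AffineSubspace.direction_mk',
    Submodule.mem_orthogonal_singleton_iff_inner_right] at h

theorem abs_claspX_le (h0 : 0 < τ) (h1 : τ ≤ 1) {u : ℝ} (hu : |u| ≤ τ) : |claspX τ u| ≤ τ := by
  have hD := clasp_denom_pos h0 h1 (abs_nonneg u) (hu.trans h1)
  have hq : √(claspRatio τ |u|) ≤ 1 := by
    refine Real.sqrt_le_one.2 ?_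
    rw [claspRatio, div_le_one hD]
    have : |u| ^ 2 ≤ 1 := by nlinarith [abs_nonneg u]
    nlinarith [sq_nonneg (τ - |u|)]
  rw [claspX_eq, abs_mul, abs_of_nonneg (Real.sqrt_nonneg _)]
  exact (mul_le_of_le_one_right (abs_nonneg u) hq).trans hu

/-- The extent of `γ` in the direction of the walls. -/
theorem abs_gammaX_le (h0 : 0 < τ) (h1 : τ ≤ 1) (he : 0 ≤ endLength τ d c) {s : ℝ}
    (hs : |s| ≤ Real.arcsin τ + endLength τ d c) :
    |gammaX τ s| * √(1 - τ ^ 2) + τ * (d / 2 + gammaHeight τ s) ≤ c := by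
  have hθ := (arcsin_pos h0).le
  have hsq := Real.sqrt_nonneg (1 - τ ^ 2)
  have e : √(1 - τ ^ 2) ^ 2 = 1 - τ ^ 2 := Real.sq_sqrt (by nlinarith)
  rw [endLength] at hs he
  have hZ := claspZ_arcsin_eq τ
  -- At the end of the clasp arc the left side is `τ * (d / 2 + claspGap τ)`. Each unit of length of
  -- a straight end, which runs along the wall normal, adds `(1 - τ ^ 2) + τ ^ 2 = 1`; this is why
  -- `endLength` is the admissible length.
  have key : ∀ l x, 0 ≤ l → l + Real.arcsin τ ≤
      Real.arcsin τ + (c - τ * (d / 2 + claspGap τ)) → |x| ≤ τ + l * √(1 - τ ^ 2) →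
      |x| * √(1 - τ ^ 2) + τ * (d / 2 + (claspZ τ (Real.arcsin τ) + l * τ)) ≤ c := by
    intro l x hl hlc hx
    rw [hZ]
    nlinarith [mul_le_mul_of_nonneg_right hx hsq]
  rcases trichotomy_abs (Real.arcsin τ) s with h | h | h
  · have hc := claspZ_le h0 h1 h
    have hx : |claspX τ (Real.sin s)| ≤ τ := by
      refine abs_claspX_le h0 h1 (abs_le.2 ?_)
      have := abs_le.1 h
      have hπ := Real.arcsin_le_pi_div_two τ
      rw [← sin_arcsin_self h0 h1, ← Real.sin_neg]
      exact ⟨Real.sin_le_sin_of_le_of_le_pi_div_two (by linarith) (by linarith) this.1,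
        Real.sin_le_sin_of_le_of_le_pi_div_two (by linarith) (by linarith) this.2⟩
    rw [gammaX, gammaHeight, clamp_of_abs_le h, sub_self, zero_mul, abs_zero, zero_mul, add_zero,
      add_zero]
    nlinarith [mul_le_mul_of_nonneg_right hx hsq]
  · have := key (s - Real.arcsin τ) (τ + (s - Real.arcsin τ) * √(1 - τ ^ 2)) (by linarith)
      (by linarith [le_abs_self s]) (abs_of_nonneg (by nlinarith)).le
    rwa [gammaX, gammaHeight, clamp_of_le hθ h.le, claspX_arcsin h0 h1,
      abs_of_pos (a := s - _) (by linarith)]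
  · have := key (-(s - -Real.arcsin τ)) (-τ + (s - -Real.arcsin τ) * √(1 - τ ^ 2)) (by linarith)
      (by linarith [neg_abs_le s]) (by rw [abs_of_nonpos (by nlinarith)]; linarith)
    rwa [gammaX, gammaHeight, clamp_of_le_neg hθ h.le, Real.sin_neg, claspX_neg, claspZ_neg h0 h1,
      claspX_arcsin h0 h1, abs_of_neg (a := s - _) (by linarith)]

end

section

variable {τ c d : ℝ}

theorem gammaX_neg (h0 : 0 < τ) (s : ℝ) : gammaX τ (-s) = -gammaX τ s := by
  rw [gammaX, gammaX, clamp_neg (arcsin_pos h0).le, Real.sin_neg, claspX_neg]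
  ring

theorem gammaHeight_neg (h0 : 0 < τ) (h1 : τ ≤ 1) (s : ℝ) :
    gammaHeight τ (-s) = gammaHeight τ s := by
  rw [gammaHeight, gammaHeight, clamp_neg (arcsin_pos h0).le, claspZ_neg h0 h1, ← abs_neg,
    neg_sub, sub_neg_eq_add, neg_add_eq_sub]

theorem gamma_right_end (h0 : 0 < τ) (h1 : τ ≤ 1) (he : 0 ≤ endLength τ d c) :
    √(1 - τ ^ 2) * gammaX τ (Real.arcsin τ + endLength τ d c) +
      τ * (d / 2 + gammaHeight τ (Real.arcsin τ + endLength τ d c)) = c := by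
  have e : √(1 - τ ^ 2) ^ 2 = 1 - τ ^ 2 := Real.sq_sqrt (by nlinarith)
  rw [gammaX, gammaHeight, clamp_of_le (arcsin_pos h0).le (by linarith), claspX_arcsin h0 h1,
    add_sub_cancel_left, abs_of_nonneg he, claspZ_arcsin_eq]
  have : endLength τ d c = c - τ * (d / 2 + claspGap τ) := rfl
  linear_combination this + endLength τ d c * e

theorem exists_obstacle_eq (τ c d : ℝ) (j : Fin 4) : ∃ σ ρ : ℝ, σ ^ 2 = 1 ∧ ρ ^ 2 = 1 ∧
    (chainedClasp τ d c).obstacle j = wallFun (wallNormal τ σ ρ) c := by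
  fin_cases j
  · exact ⟨-1, -1, by norm_num, by norm_num, rfl⟩
  · exact ⟨1, -1, by norm_num, by norm_num, rfl⟩
  · exact ⟨-1, 1, by norm_num, by norm_num, rfl⟩
  · exact ⟨1, 1, by norm_num, by norm_num, rfl⟩

/-- Absolute values treat the four walls at once, since they differ only by signs of the
coordinates. -/
theorem wallFun_nonneg (h0 : 0 < τ) {σ ρ : ℝ} (hσ : σ ^ 2 = 1) (hρ : ρ ^ 2 = 1) {p : E3}
    (hp : |p 1| * √(1 - τ ^ 2) + τ * |p 2| ≤ c) : 0 ≤ wallFun (wallNormal τ σ ρ) c p := by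
  have key : ∀ {σ : ℝ}, σ ^ 2 = 1 → ∀ x, σ * x ≤ |x| := by
    intro σ hσ x
    have : |σ| = 1 := by rw [← sq_eq_sq₀ (abs_nonneg _) zero_le_one, sq_abs, hσ, one_pow]
    calc σ * x ≤ |σ * x| := le_abs_self _
      _ = |x| := by rw [abs_mul, this, one_mul]
  rw [wallFun, inner_wallNormal]
  nlinarith [mul_le_mul_of_nonneg_right (key hσ (p 1)) (Real.sqrt_nonneg (1 - τ ^ 2)),
    mul_le_mul_of_nonneg_right (key hρ (p 2)) h0.le]

theorem chainedClasp_isLip (h0 : 0 < τ) (h1 : τ ≤ 1) (hd : 1 ≤ d) (i : Fin 3) :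
    IsLip ((chainedClasp τ d c).strand i).path := by
  fin_cases i
  · exact isLip_alphaPath h0 h1 hd
  · exact (isLip_gammaPath h0 h1 d).reflZ
  · exact isLip_gammaPath h0 h1 d

theorem alphaHalf_pos (hd : 1 ≤ d) : 0 < alphaHalf d := by
  have := Real.pi_pos
  rw [alphaHalf]
  linarith

/-- The unit tangent vectors of the components. -/
def linkTangent (τ d : ℝ) : Fin 3 → ℝ → E3 :=
  ![alphaTangent d, fun s => reflZ (gammaTangent τ s), gammaTangent τ]

theorem chainedClasp_ae_hasDerivAt (h0 : 0 < τ) (h1 : τ ≤ 1) (hd : 1 ≤ d) (i : Fin 3) :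
    ∀ᵐ s : ℝ, ∃ v : ℝ, 0 < v ∧
      HasDerivAt ((chainedClasp τ d c).strand i).path (v • linkTangent τ d i s) s := by
  fin_cases i
  · filter_upwards [ae_hasDerivAt_alphaPath h0 h1 hd] with s hs using ⟨_, hs⟩
  · filter_upwards [ae_hasDerivAt_gammaPath h0 h1 d] with s hs
    refine ⟨_, hs.1, ?_⟩
    have := hs.2.reflZ
    rwa [reflZ_smul] at this
  · filter_upwards [ae_hasDerivAt_gammaPath h0 h1 d] with s hs using ⟨_, hs⟩

theorem norm_linkTangent (τ d : ℝ) (i : Fin 3) (s : ℝ) : ‖linkTangent τ d i s‖ = 1 := by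
  fin_cases i
  · exact norm_alphaTangent d s
  · exact (norm_reflZ _).trans (norm_gammaTangent τ s)
  · exact norm_gammaTangent τ s

theorem isLip_linkTangent (τ d : ℝ) (i : Fin 3) : IsLip (linkTangent τ d i) := by
  fin_cases i
  · exact isLip_alphaTangent d
  · exact (isLip_gammaTangent τ).reflZ
  · exact isLip_gammaTangent τ

theorem chainedClasp_left_lt_right (h0 : 0 < τ) (hd : 1 ≤ d) (he : 0 ≤ endLength τ d c)
    (i : Fin 3) : ((chainedClasp τ d c).strand i).left < ((chainedClasp τ d c).strand i).right := by
  have h2 := arcsin_pos h0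
  have h3 := alphaHalf_pos hd
  fin_cases i
  · change -alphaHalf d < 3 * alphaHalf d
    linarith
  all_goals
    change -(Real.arcsin τ + endLength τ d c) < Real.arcsin τ + endLength τ d c
    linarith

theorem alphaPath_closes (hd : 1 ≤ d) :
    alphaPath τ d (-alphaHalf d) = alphaPath τ d (3 * alphaHalf d) := by
  have h3 := alphaHalf_pos hd
  have h : alphaPath τ d (-alphaHalf d) = !₂[-1, 0, 0] := by
    rw [alphaPath_of_le (by linarith),
      alphaUpper_of_lt_neg (by rw [alphaHalf]; linarith), alphaHalf]
    simp
  have h2 := alphaPath_reflect (τ := τ) hd (-alphaHalf d)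
  rw [show 2 * alphaHalf d - -alphaHalf d = 3 * alphaHalf d by ring, h, reflZ_vec3, neg_zero] at h2
  rw [h, h2]

theorem contDiff_wallFun (n : E3) (c : ℝ) : ContDiff ℝ 1 (wallFun n c) :=
  contDiff_const.sub (contDiff_const.inner ℝ contDiff_id)

theorem fderiv_wallFun_ne_zero {n : E3} (hn : ⟪n, n⟫ = 1) (c : ℝ) (p : E3) :
    fderiv ℝ (wallFun n c) p ≠ 0 := by
  have h : HasFDerivAt (wallFun n c) (-(innerSL ℝ n)) p :=
    (innerSL ℝ n).hasFDerivAt.const_sub c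
  intro h2
  rw [h.fderiv] at h2
  have := congrArg (fun L : E3 →L[ℝ] ℝ => L n) h2
  simp only [neg_apply, innerSL_apply_apply, hn] at this
  norm_num at this

theorem chainedClasp_avoids (h0 : 0 < τ) (h1 : τ ≤ 1) (hd : 1 ≤ d) (he : 0 ≤ endLength τ d c)
    {i : Fin 3} {s : ℝ} (hs : s ∈ ((chainedClasp τ d c).strand i).dom) :
    |((chainedClasp τ d c).strand i).path s 1| * √(1 - τ ^ 2) +
      τ * |((chainedClasp τ d c).strand i).path s 2| ≤ c := by
  have hγ : ∀ s, s ∈ Icc (-(Real.arcsin τ + endLength τ d c)) (Real.arcsin τ + endLength τ d c) →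
      |gammaX τ s| * √(1 - τ ^ 2) + τ * |d / 2 + gammaHeight τ s| ≤ c := by
    intro s hs
    rw [abs_of_nonneg (a := _ + _) (by linarith [gammaHeight_nonneg h0 h1 s])]
    exact abs_gammaX_le h0 h1 he (abs_le.2 ⟨hs.1, hs.2⟩)
  fin_cases i
  · have hα : ∀ s, |s| ≤ alphaHalf d → τ * |d / 2 + alphaHeight τ s| ≤ c := by
      intro s hs
      have := alphaHeight_mem h0 h1 hd hs
      rw [abs_of_nonneg (by linarith)]
      rw [endLength] at he
      nlinarith
    change |alphaPath τ d s 1| * _ + τ * |alphaPath τ d s 2| ≤ c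
    obtain ⟨s', hs', h | h⟩ := alphaPath_cases (τ := τ) hd hs
    · rw [h, alphaUpper_eq h0 h1]
      simpa using hα s' hs'
    · rw [h, alphaUpper_eq h0 h1, reflZ_vec3]
      have := hα s' hs'
      rw [← abs_neg] at this
      simpa [add_comm] using this
  · change |reflZ (gammaPath τ d s) 1| * _ + τ * |reflZ (gammaPath τ d s) 2| ≤ c
    rw [gammaPath_eq h0 h1, reflZ_vec3]
    have := hγ s hs
    rw [← abs_neg (_ + _)] at this
    simpa [add_comm] using this
  · change |gammaPath τ d s 1| * _ + τ * |gammaPath τ d s 2| ≤ c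
    rw [gammaPath_eq h0 h1]
    simpa using hγ s hs

theorem chainedClasp_isValid (h0 : 0 < τ) (h1 : τ ≤ 1) (hd : 1 ≤ d) (he : 0 ≤ endLength τ d c) :
    (chainedClasp τ d c).IsValid where
  left_lt_right := chainedClasp_left_lt_right h0 hd he
  lipschitz i := by
    obtain ⟨K, hK⟩ := chainedClasp_isLip (c := c) h0 h1 hd i
    exact ⟨K, hK.lipschitzOnWith⟩
  regular i := by
    filter_upwards [chainedClasp_ae_hasDerivAt (c := c) h0 h1 hd i] with s ⟨v, hv, h⟩ _
    rw [h.deriv]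
    exact smul_ne_zero hv.ne' (norm_ne_zero_iff.1 (by simp [norm_linkTangent]))
  closes_up i hi := by
    fin_cases i
    · exact alphaPath_closes hd
    · exact hi.elim
    · exact hi.elim
  left_mem i hi := by
    have hend := gamma_right_end h0 h1 he
    fin_cases i
    · exact absurd trivial hi
    all_goals
      refine mem_wallPlane (norm_wallNormal h0 h1 (by norm_num) (by norm_num)) ?_
      rw [inner_wallNormal]
    · change _ * reflZ (gammaPath τ d (-(Real.arcsin τ + endLength τ d c))) 1 +
        _ * reflZ (gammaPath τ d (-(Real.arcsin τ + endLength τ d c))) 2 = c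
      rw [gammaPath_eq h0 h1, gammaX_neg h0, gammaHeight_neg h0 h1, reflZ_vec3]
      simp
      linarith
    · change _ * gammaPath τ d (-(Real.arcsin τ + endLength τ d c)) 1 +
        _ * gammaPath τ d (-(Real.arcsin τ + endLength τ d c)) 2 = c
      rw [gammaPath_eq h0 h1, gammaX_neg h0, gammaHeight_neg h0 h1]
      simp
      linarith
  right_mem i hi := by
    have hend := gamma_right_end h0 h1 he
    fin_cases i
    · exact absurd trivial hi
    all_goals
      refine mem_wallPlane (norm_wallNormal h0 h1 (by norm_num) (by norm_num)) ?_
      rw [inner_wallNormal]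
    · change _ * reflZ (gammaPath τ d (Real.arcsin τ + endLength τ d c)) 1 +
        _ * reflZ (gammaPath τ d (Real.arcsin τ + endLength τ d c)) 2 = c
      rw [gammaPath_eq h0 h1, reflZ_vec3]
      simp
      linarith
    · change _ * gammaPath τ d (Real.arcsin τ + endLength τ d c) 1 +
        _ * gammaPath τ d (Real.arcsin τ + endLength τ d c) 2 = c
      rw [gammaPath_eq h0 h1]
      simp
      linarith
  disjoint i j hij := by
    rw [Set.disjoint_left]
    rintro _ ⟨s, hs, rfl⟩ ⟨t, ht, h⟩
    have := chainedClasp_one_le_dist h0 h1 hd hij hs ht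
    rw [h, dist_self] at this
    linarith
  contDiff_obstacle j := by
    obtain ⟨σ, ρ, -, -, h⟩ := exists_obstacle_eq τ c d j
    rw [h]
    exact contDiff_wallFun _ _
  regular_obstacle j p _ := by
    obtain ⟨σ, ρ, hσ, hρ, h⟩ := exists_obstacle_eq τ c d j
    rw [h]
    exact fderiv_wallFun_ne_zero (norm_wallNormal h0 h1 hσ hρ) c p
  avoids j i s hs := by
    obtain ⟨σ, ρ, hσ, hρ, h⟩ := exists_obstacle_eq τ c d j
    rw [h]
    exact wallFun_nonneg h0 hσ hρ (chainedClasp_avoids h0 h1 hd he hs)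

/-! ### Struts -/

theorem alphaPath_arcsin (h0 : 0 < τ) (h1 : τ ≤ 1) (hd : 1 ≤ d) {b ε : ℝ} (hb : b ∈ Icc 0 τ)
    (hε : ε = 1 ∨ ε = -1) : alphaPath τ d (ε * Real.arcsin b) =
      !₂[ε * claspX τ b, 0, d / 2 + claspGap τ - claspZ τ (Real.arcsin b)] := by
  have hm := arcsin_mem_Icc hb
  have hπ := Real.arcsin_le_pi_div_two τ
  have hs : Real.sin (Real.arcsin b) = b := Real.sin_arcsin (by linarith [hb.1]) (hb.2.trans h1)
  have habs : |ε * Real.arcsin b| = Real.arcsin b := by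
    rcases hε with rfl | rfl <;> simp [abs_of_nonneg hm.1]
  rw [alphaPath_of_le, alphaUpper_of_abs_le (habs.le.trans hm.2)]
  · rcases hε with rfl | rfl
    · simp [hs]
    · simp [hs, claspX_neg, claspZ_neg h0 h1]
  · refine (le_abs_self _).trans (habs.le.trans (hm.2.trans (hπ.trans ?_)))
    rw [alphaHalf]
    linarith

theorem gammaPath_arcsin (h0 : 0 < τ) (h1 : τ ≤ 1) {a ε : ℝ} (ha : a ∈ Icc 0 τ)
    (hε : ε = 1 ∨ ε = -1) : gammaPath τ d (ε * Real.arcsin a) =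
      !₂[0, ε * claspX τ a, d / 2 + claspZ τ (Real.arcsin a)] := by
  have hm := arcsin_mem_Icc ha
  have hs : Real.sin (Real.arcsin a) = a := Real.sin_arcsin (by linarith [ha.1]) (ha.2.trans h1)
  have habs : |ε * Real.arcsin a| = Real.arcsin a := by
    rcases hε with rfl | rfl <;> simp [abs_of_nonneg hm.1]
  rw [gammaPath_of_abs_le (habs.le.trans hm.2)]
  rcases hε with rfl | rfl
  · simp [hs]
  · simp [hs, claspX_neg, claspZ_neg h0 h1]

/-- The vector joining points in contact in the upper clasp. -/
theorem alphaPath_sub_gammaPath (h0 : 0 < τ) (h1 : τ ≤ 1) (hd : 1 ≤ d) {a ε ε' : ℝ}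
    (ha : a ∈ Icc 0 τ) (hε : ε = 1 ∨ ε = -1) (hε' : ε' = 1 ∨ ε' = -1) :
    alphaPath τ d (ε * Real.arcsin (τ - a)) - gammaPath τ d (ε' * Real.arcsin a) =
      !₂[ε * claspX τ (τ - a), -(ε' * claspX τ a), contactHeight τ a] := by
  rw [alphaPath_arcsin h0 h1 hd ⟨by linarith [ha.2], by linarith [ha.1]⟩ hε,
    gammaPath_arcsin h0 h1 ha hε', claspGap_eq h0 h1 ha]
  ext i
  fin_cases i
  · simp
  · simp
  · simp
    ring

theorem norm_contact (h0 : 0 < τ) (h1 : τ ≤ 1) {a ε ε' : ℝ}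
    (ha : a ∈ Icc 0 τ) (hε : ε = 1 ∨ ε = -1) (hε' : ε' = 1 ∨ ε' = -1) :
    ‖(!₂[ε * claspX τ (τ - a), -(ε' * claspX τ a), contactHeight τ a] : E3)‖ = 1 := by
  rw [← sq_eq_sq₀ (norm_nonneg _) zero_le_one, norm_sq_vec3]
  have := contactHeight_sq h0 h1 ha
  rcases hε with rfl | rfl <;> rcases hε' with rfl | rfl <;> simp <;> linarith

theorem gammaPath_zero (h0 : 0 < τ) : gammaPath τ d 0 = !₂[0, 0, d / 2] := by
  rw [gammaPath_of_abs_le (by simpa using (arcsin_pos h0).le)]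
  simp [claspX_zero, claspZ_zero]

/-- The circular arcs of `α` are at distance one from the tip of `γ`. -/
theorem alphaPath_sub_tip (h0 : 0 < τ) (hd : 1 ≤ d) {s : ℝ}
    (hs : Real.arcsin τ < |s|) (hs' : |s| ≤ Real.pi / 2) :
    alphaPath τ d s - gammaPath τ d 0 = !₂[Real.sin s, 0, Real.cos s] := by
  rw [gammaPath_zero h0, alphaPath_of_le, alphaUpper_of_abs_le_pi hs hs']
  · ext i
    fin_cases i <;> simp
  · rw [alphaHalf]
    linarith [le_abs_self s]

theorem norm_sin_cos (s : ℝ) : ‖(!₂[Real.sin s, 0, Real.cos s] : E3)‖ = 1 := by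
  rw [← sq_eq_sq₀ (norm_nonneg _) zero_le_one, norm_sq_vec3]
  simp

theorem mem_dom_alpha (hd : 1 ≤ d) {s : ℝ} (hs : |s| ≤ Real.pi / 2) :
    s ∈ ((chainedClasp τ d c).strand 0).dom ∧
      2 * alphaHalf d - s ∈ ((chainedClasp τ d c).strand 0).dom := by
  have := abs_le.1 hs
  have hpi := Real.pi_pos
  change s ∈ Icc (-alphaHalf d) (3 * alphaHalf d) ∧
    2 * alphaHalf d - s ∈ Icc (-alphaHalf d) (3 * alphaHalf d)
  rw [alphaHalf]
  constructor <;> constructor <;> linarith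

theorem mem_dom_gamma (he : 0 ≤ endLength τ d c) {s : ℝ} (hs : |s| ≤ Real.arcsin τ) :
    s ∈ ((chainedClasp τ d c).strand 2).dom ∧ s ∈ ((chainedClasp τ d c).strand 1).dom := by
  have := abs_le.1 hs
  change s ∈ Icc (-(Real.arcsin τ + endLength τ d c)) (Real.arcsin τ + endLength τ d c) ∧
    s ∈ Icc (-(Real.arcsin τ + endLength τ d c)) (Real.arcsin τ + endLength τ d c)
  constructor <;> constructor <;> linarith

theorem chainedClasp_gThi (h0 : 0 < τ) (h1 : τ ≤ 1) (hd : 1 ≤ d) (he : 0 ≤ endLength τ d c) :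
    (chainedClasp τ d c).gThi = 1 := by
  refine IsLeast.csInf_eq
    ⟨⟨0, 2, by decide, 1 * Real.arcsin (τ - 0), ?_, 1 * Real.arcsin 0, ?_, ?_⟩, ?_⟩
  · refine (mem_dom_alpha hd ?_).1
    rw [sub_zero, one_mul, abs_of_pos (arcsin_pos h0)]
    exact Real.arcsin_le_pi_div_two τ
  · refine (mem_dom_gamma he ?_).1
    simpa using (arcsin_pos h0).le
  · change 1 = dist (alphaPath τ d _) (gammaPath τ d _)
    have ha : (0 : ℝ) ∈ Icc 0 τ := ⟨le_rfl, h0.le⟩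
    rw [dist_eq_norm, alphaPath_sub_gammaPath h0 h1 hd ha (Or.inl rfl) (Or.inl rfl),
      norm_contact h0 h1 ha (Or.inl rfl) (Or.inl rfl)]
  · rintro r ⟨i, j, hij, s, hs, t, ht, rfl⟩
    exact chainedClasp_one_le_dist h0 h1 hd hij hs ht

end

/-! ### Integrals over symmetric intervals -/

theorem integral_symm_interval {f : ℝ → ℝ} {r : ℝ} (hr : 0 ≤ r) (hf : ContinuousOn f (Icc (-r) r)) :
    ∫ s in -r..r, f s = ∫ s in (0 : ℝ)..r, (f s + f (-s)) := by
  have h1 : IntervalIntegrable f volume (-r) 0 :=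
    (hf.mono (Icc_subset_Icc_right hr)).intervalIntegrable_of_Icc (by linarith)
  have h2 : IntervalIntegrable f volume 0 r :=
    (hf.mono (Icc_subset_Icc_left (by linarith))).intervalIntegrable_of_Icc hr
  have h3 : IntervalIntegrable (fun s => f (-s)) volume 0 r :=
    (hf.comp continuous_neg.continuousOn fun s (hs : s ∈ Icc 0 r) =>
      ⟨by linarith [hs.2], by linarith [hs.1]⟩).intervalIntegrable_of_Icc hr
  rw [← intervalIntegral.integral_add_adjacent_intervals h1 h2,
    intervalIntegral.integral_add h2 h3, intervalIntegral.integral_comp_neg, neg_zero, add_comm]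

/-- Pairing with a density that is supported in a symmetric interval. -/
theorem integral_inner_eq_of_support {r R : ℝ} (hr : 0 ≤ r) (hrR : r ≤ R) {ξ T' N : ℝ → E3}
    (hξ : ContinuousOn ξ (Icc (-R) R)) (hN : Continuous N) (h1 : ∀ s, |s| < r → T' s = N s)
    (h2 : ∀ s, r < |s| → |s| < R → T' s = 0) :
    ∫ s in Icc (-R) R, ⟪ξ s, T' s⟫ = ∫ s in (0 : ℝ)..r, (⟪ξ s, N s⟫ + ⟪ξ (-s), N (-s)⟫) := by
  have hsub : Icc (-r) r ⊆ Icc (-R) R := Icc_subset_Icc (by linarith) hrR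
  rw [setIntegral_eq_of_subset_of_ae_sdiff_eq_zero (s := Icc (-r) r) nullMeasurableSet_Icc hsub,
    ← integral_symm_interval (f := fun s => ⟪ξ s, N s⟫) hr
      ((hξ.mono hsub).inner hN.continuousOn),
    intervalIntegral.integral_of_le (by linarith), ← integral_Icc_eq_integral_Ioc]
  · refine setIntegral_congr_ae measurableSet_Icc ?_
    filter_upwards [ae_mem_Ioo_of_mem_Icc (-r) r] with s hs hs'
    rw [h1 s (abs_lt.2 (hs hs'))]
  · filter_upwards [ae_mem_Ioo_of_mem_Icc (-R) R] with s hs hs'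
    rw [h2 s (lt_of_not_ge fun h => hs'.2 (abs_le.1 h)) (abs_lt.2 (hs hs'.1)), inner_zero_right]

/-- The integrand is unbounded at `1` when `τ = 1`. It is integrable as the nonnegative derivative
of the continuous function `arcsin`. -/
theorem intervalIntegrable_inv_sqrt {τ : ℝ} (h0 : 0 < τ) (h1 : τ ≤ 1) :
    IntervalIntegrable (fun u : ℝ => 1 / √(1 - u ^ 2)) volume 0 τ := by
  refine intervalIntegral.intervalIntegrable_deriv_of_nonneg (g := Real.arcsin)
    Real.continuous_arcsin.continuousOn (fun x hx => ?_) fun x _ => by positivity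
  rw [min_eq_left h0.le, max_eq_right h0.le] at hx
  exact Real.hasDerivAt_arcsin (by linarith [hx.1]) (by linarith [hx.2])

theorem integrable_comp_arcsin {τ : ℝ} (h0 : 0 < τ) (h1 : τ ≤ 1) {g : ℝ → ℝ}
    (hg : ContinuousOn g (Icc 0 (Real.arcsin τ))) :
    IntervalIntegrable (fun u => g (Real.arcsin u) * (1 / √(1 - u ^ 2))) volume 0 τ := by
  refine (intervalIntegrable_inv_sqrt h0 h1).continuousOn_mul ?_
  rw [uIcc_of_le h0.le]
  exact hg.comp Real.continuous_arcsin.continuousOn fun u hu => arcsin_mem_Icc hu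

/-- Passing from the angle to its sine is what makes contact the simple relation `a ↔ τ - a`. The
substitution needs differentiability only in the open interval, which allows `τ = 1`. -/
theorem integral_comp_arcsin {τ : ℝ} (h0 : 0 < τ) (h1 : τ ≤ 1) {g : ℝ → ℝ}
    (hg : ContinuousOn g (Icc 0 (Real.arcsin τ))) :
    ∫ u in (0 : ℝ)..τ, g (Real.arcsin u) * (1 / √(1 - u ^ 2)) =
      ∫ s in (0 : ℝ)..Real.arcsin τ, g s := by
  have him : Real.arcsin '' uIcc 0 τ ⊆ Icc 0 (Real.arcsin τ) := by
    rw [uIcc_of_le h0.le]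
    rintro _ ⟨u, hu, rfl⟩
    exact arcsin_mem_Icc hu
  have := intervalIntegral.integral_comp_mul_deriv''' (f := Real.arcsin) (g := g) (a := 0) (b := τ)
    (f' := fun u => 1 / √(1 - u ^ 2)) Real.continuous_arcsin.continuousOn (fun x hx => ?_)
    (hg.mono ((image_mono Ioo_subset_Icc_self).trans him))
    ((hg.integrableOn_Icc).mono_set him) ?_
  · simpa using this
  · rw [min_eq_left h0.le, max_eq_right h0.le] at hx
    exact (Real.hasDerivAt_arcsin (by linarith [hx.1]) (by linarith [hx.2])).hasDerivWithinAt
  · rw [uIcc_of_le h0.le, integrableOn_Icc_iff_integrableOn_Ioc]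
    exact (intervalIntegrable_iff_integrableOn_Ioc_of_le h0.le).1 (integrable_comp_arcsin h0 h1 hg)

/-! ### The balance of forces in one clasp -/

/-- The curvature of `α` with respect to the angle. -/
def alphaNormal (s : ℝ) : E3 := !₂[-Real.sin s, 0, -Real.cos s]

/-- The curvature of `γ` with respect to the angle. -/
def gammaNormal (s : ℝ) : E3 := !₂[0, -Real.sin s, Real.cos s]

theorem continuous_alphaNormal : Continuous alphaNormal := by
  unfold alphaNormal
  fun_prop

theorem continuous_gammaNormal : Continuous gammaNormal := by
  unfold gammaNormal
  fun_prop

section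

variable {τ : ℝ}

/-- The balance of the curvature forces of points in contact and the forces transmitted by the
struts that join them. -/
theorem contact_balance (h0 : 0 < τ) (h1 : τ ≤ 1) {a p : ℝ} (ha : a ∈ Ioo 0 τ) (hp : p ≤ 0)
    {η₁ η₂ ζ₁ ζ₂ : E3}
    (h11 : p ≤ ⟪!₂[1 * claspX τ (τ - a), -(1 * claspX τ a), contactHeight τ a], η₁ - ζ₁⟫)
    (h12 : p ≤ ⟪!₂[1 * claspX τ (τ - a), -(-1 * claspX τ a), contactHeight τ a], η₁ - ζ₂⟫)
    (h21 : p ≤ ⟪!₂[-1 * claspX τ (τ - a), -(1 * claspX τ a), contactHeight τ a], η₂ - ζ₁⟫)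
    (h22 : p ≤ ⟪!₂[-1 * claspX τ (τ - a), -(-1 * claspX τ a), contactHeight τ a], η₂ - ζ₂⟫) :
    (⟪η₁, alphaNormal (Real.arcsin (τ - a))⟫ + ⟪η₂, alphaNormal (-Real.arcsin (τ - a))⟫) *
        (1 / √(1 - (τ - a) ^ 2)) +
      (⟪ζ₁, gammaNormal (Real.arcsin a)⟫ + ⟪ζ₂, gammaNormal (-Real.arcsin a)⟫) *
        (1 / √(1 - a ^ 2)) ≤
      -(p * 4) * (1 / √(1 - (τ - a) ^ 2)) + -(p * 4) * (1 / √(1 - a ^ 2)) := by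
  obtain ⟨ha0, haτ⟩ := ha
  have ha := Ioo_subset_Icc_self (a := (0 : ℝ)) (b := τ) ⟨ha0, haτ⟩
  have hH := contactHeight_pos h0 h1 ⟨ha0, haτ⟩
  have hra : 0 < √(1 - a ^ 2) := Real.sqrt_pos.2 (by nlinarith)
  have hrb : 0 < √(1 - (τ - a) ^ 2) := Real.sqrt_pos.2 (by nlinarith)
  have ea := claspX_mul_sqrt h0 h1 ha
  have eb := claspX_sub_mul_sqrt h0 h1 ha
  have hHle : √(1 - a ^ 2) * √(1 - (τ - a) ^ 2) ≤ contactHeight τ a := by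
    have hD := clasp_denom_pos h0 h1 ha.1 (ha.2.trans h1)
    rw [contactHeight_eq h0 h1 ha]
    refine mul_le_mul_of_nonneg_left (Real.sqrt_le_sqrt ?_) hra.le
    rw [le_div_iff₀ hD]
    have : 0 ≤ 1 - (τ - a) ^ 2 := by nlinarith
    nlinarith [mul_nonneg this (by positivity : 0 ≤ a ^ 2 * (τ - a) ^ 2)]
  simp only [inner_vec3, alphaNormal, gammaNormal, Real.sin_neg, Real.cos_neg, Real.cos_arcsin,
    Real.sin_arcsin (show -1 ≤ a by linarith) (by linarith),
    Real.sin_arcsin (show -1 ≤ τ - a by linarith) (by linarith)] at *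
  simp at h11 h12 h21 h22 ⊢
  set H := contactHeight τ a
  set X := claspX τ a
  set Y := claspX τ (τ - a)
  set A := √(1 - a ^ 2)
  set B := √(1 - (τ - a) ^ 2)
  have ea' : a * A⁻¹ = X * H⁻¹ := by field_simp; linarith
  have eb' : (τ - a) * B⁻¹ = Y * H⁻¹ := by field_simp; linarith
  have hA1 : A * A⁻¹ = 1 := mul_inv_cancel₀ hra.ne'
  have hB1 : B * B⁻¹ = 1 := mul_inv_cancel₀ hrb.ne'
  have hH1 : H * H⁻¹ = 1 := mul_inv_cancel₀ hH.ne'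
  have hinv : H⁻¹ ≤ A⁻¹ * B⁻¹ := by
    rw [← mul_inv]
    exact inv_anti₀ (mul_pos hra hrb) hHle
  -- The four struts have total weight `2 / H`, to be bounded by an integrable function. Since `1 /
  -- H ≤ 1 / (A * B)`, and the smaller of `a` and `τ - a` is at most `1 / 2`, one of the two roots
  -- is at least `1 / 2`.
  have hsum : H⁻¹ ≤ 2 * (A⁻¹ + B⁻¹) := by
    have hA0 := inv_pos.2 hra
    have hB0 := inv_pos.2 hrb
    rcases le_total a (τ - a) with h | h
    · have : (2 : ℝ)⁻¹ ≤ A := Real.le_sqrt_of_sq_le (by nlinarith)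
      have : A⁻¹ ≤ 2 := by simpa using inv_anti₀ (by norm_num) this
      nlinarith
    · have : (2 : ℝ)⁻¹ ≤ B := Real.le_sqrt_of_sq_le (by nlinarith)
      have : B⁻¹ ≤ 2 := by simpa using inv_anti₀ (by norm_num) this
      nlinarith
  have hHi := inv_pos.2 hH
  -- The weight `H⁻¹ / 2` is forced by vertical balance: two struts at each point transmit `2 * H *
  -- (H⁻¹ / 2) = 1`. Horizontal balance is then `ea'` and `eb'`, that is, orthogonality of the
  -- struts to the arcs.
  have key := mul_le_mul_of_nonneg_right
    (add_le_add (add_le_add h11 h12) (add_le_add h21 h22)) (by positivity : 0 ≤ H⁻¹ / 2)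
  have hneg := mul_le_mul_of_nonneg_left hsum (neg_nonneg.2 hp)
  have e1 : (η₁ 0 * (a - τ) + -(η₁ 2 * B) + (η₂ 0 * (τ - a) + -(η₂ 2 * B))) * B⁻¹ =
      -(η₁ 0 - η₂ 0) * (Y * H⁻¹) - (η₁ 2 + η₂ 2) := by
    linear_combination -(η₁ 0 - η₂ 0) * eb' - (η₁ 2 + η₂ 2) * hB1
  have e2 : (-(ζ₁ 1 * a) + ζ₁ 2 * A + (ζ₂ 1 * a + ζ₂ 2 * A)) * A⁻¹ =
      -(ζ₁ 1 - ζ₂ 1) * (X * H⁻¹) + (ζ₁ 2 + ζ₂ 2) := by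
    linear_combination -(ζ₁ 1 - ζ₂ 1) * ea' + (ζ₁ 2 + ζ₂ 2) * hA1
  rw [e1, e2]
  linear_combination key + 2 * hneg + (η₁ 2 + η₂ 2 - ζ₁ 2 - ζ₂ 2) * hH1

/-- The balance of forces in a clasp: struts that lengthen at a rate at least `p` bound the
variation of length. -/
theorem clasp_balance (h0 : 0 < τ) (h1 : τ ≤ 1) {p : ℝ} (hp : p ≤ 0) {η ζ : ℝ → E3}
    (hη : ContinuousOn η (Icc (-(Real.pi / 2)) (Real.pi / 2)))
    (hζ : ContinuousOn ζ (Icc (-Real.arcsin τ) (Real.arcsin τ)))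
    (hclasp : ∀ a ∈ Icc 0 τ, ∀ ε ε' : ℝ, (ε = 1 ∨ ε = -1) → (ε' = 1 ∨ ε' = -1) →
      p ≤ ⟪!₂[ε * claspX τ (τ - a), -(ε' * claspX τ a), contactHeight τ a],
        η (ε * Real.arcsin (τ - a)) - ζ (ε' * Real.arcsin a)⟫)
    (hcirc : ∀ s, Real.arcsin τ < |s| → |s| ≤ Real.pi / 2 →
      p ≤ ⟪!₂[Real.sin s, 0, Real.cos s], η s - ζ 0⟫) :
    (∫ s in (0 : ℝ)..Real.pi / 2, (⟪η s, alphaNormal s⟫ + ⟪η (-s), alphaNormal (-s)⟫)) +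
      ∫ s in (0 : ℝ)..Real.arcsin τ, (⟪ζ s, gammaNormal s⟫ + ⟪ζ (-s), gammaNormal (-s)⟫) ≤
      -(p * (6 * Real.arcsin τ + Real.pi)) - 2 * (1 - τ) * ζ 0 2 := by
  have hθ := (arcsin_pos h0).le
  have hπ := Real.arcsin_le_pi_div_two τ
  have hsymm : ∀ {f : ℝ → ℝ} {r : ℝ}, ContinuousOn f (Icc (-r) r) →
      ContinuousOn (fun s => f s + f (-s)) (Icc 0 r) := by
    intro f r hf
    refine ContinuousOn.add (hf.mono fun s hs => ⟨by linarith [hs.1, hs.2], hs.2⟩)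
      (hf.comp continuous_neg.continuousOn fun s hs => ?_)
    exact ⟨by linarith [hs.2], by linarith [hs.1, hs.2]⟩
  have hgη := hsymm (hη.inner (𝕜 := ℝ) continuous_alphaNormal.continuousOn)
  have hgζ := hsymm (hζ.inner (𝕜 := ℝ) continuous_gammaNormal.continuousOn)
  set gη : ℝ → ℝ := fun s => ⟪η s, alphaNormal s⟫ + ⟪η (-s), alphaNormal (-s)⟫ with hgηdef
  set gζ : ℝ → ℝ := fun s => ⟪ζ s, gammaNormal s⟫ + ⟪ζ (-s), gammaNormal (-s)⟫ with hgζdef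
  have hgη1 := hgη.mono (Icc_subset_Icc_right hπ)
  have hgη2 := hgη.mono (Icc_subset_Icc_left hθ)
  have hi2 : IntervalIntegrable gη volume (Real.arcsin τ) (Real.pi / 2) :=
    hgη2.intervalIntegrable_of_Icc hπ
  rw [← intervalIntegral.integral_add_adjacent_intervals (hgη1.intervalIntegrable_of_Icc hθ) hi2]
  -- Unit weight on each strut from the circle to the tip balances the curvature of the circle. The
  -- cosine integrates to `1 - τ`, and the two sides give the residual `2 * (1 - τ)` at the tip.
  have hcircle : ∫ s in Real.arcsin τ..Real.pi / 2, gη s ≤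
      -(p * (Real.pi - 2 * Real.arcsin τ)) - 2 * (1 - τ) * ζ 0 2 := by
    have hle : ∫ s in Real.arcsin τ..Real.pi / 2, gη s ≤
        ∫ s in Real.arcsin τ..Real.pi / 2, (-(2 * p) - 2 * ζ 0 2 * Real.cos s) := by
      refine intervalIntegral.integral_mono_on_of_le_Ioo hπ hi2
        (Continuous.intervalIntegrable (by fun_prop) _ _) fun s hs => ?_
      have hs0 : 0 < s := hθ.trans_lt hs.1
      have e1 := hcirc s (by rw [abs_of_pos hs0]; exact hs.1)
        (by rw [abs_of_pos hs0]; exact hs.2.le)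
      have e2 := hcirc (-s) (by rw [abs_neg, abs_of_pos hs0]; exact hs.1)
        (by rw [abs_neg, abs_of_pos hs0]; exact hs.2.le)
      rw [inner_vec3] at e1 e2
      simp only [hgηdef]
      rw [inner_vec3, inner_vec3]
      simp [alphaNormal] at e1 e2 ⊢
      linarith
    refine hle.trans (le_of_eq ?_)
    rw [intervalIntegral.integral_sub (by simp) (Continuous.intervalIntegrable (by fun_prop) _ _),
      intervalIntegral.integral_const, intervalIntegral.integral_const_mul, integral_cos,
      Real.sin_pi_div_two, sin_arcsin_self h0 h1, smul_eq_mul]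
    ring
  have hflip : ∀ {f : ℝ → ℝ}, IntervalIntegrable f volume 0 τ →
      IntervalIntegrable (fun a => f (τ - a)) volume 0 τ := by
    intro f hf
    simpa using (hf.comp_sub_left τ).symm
  have hi3 := integrable_comp_arcsin h0 h1 hgζ
  have hi4 := hflip (integrable_comp_arcsin h0 h1 hgη1)
  have hj := intervalIntegrable_inv_sqrt h0 h1
  have hj1 := hj.const_mul (-(p * 4))
  have hj2 := hflip hj1
  have hone : ∫ u in (0 : ℝ)..τ, -(p * 4) * (1 / √(1 - u ^ 2)) = -(p * 4) * Real.arcsin τ := by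
    rw [integral_comp_arcsin h0 h1 (g := fun _ => -(p * 4)) continuousOn_const]
    simp
    ring
  have hcontact : (∫ s in (0 : ℝ)..Real.arcsin τ, gη s) + ∫ s in (0 : ℝ)..Real.arcsin τ, gζ s ≤
      -(p * (8 * Real.arcsin τ)) := by
    rw [← integral_comp_arcsin h0 h1 hgη1, ← integral_comp_arcsin h0 h1 hgζ]
    -- The force on `α` is reparametrized by `a ↦ τ - a`, so that both integrands refer to points in
    -- contact for the same `a`.
    have e := intervalIntegral.integral_comp_sub_left (a := 0) (b := τ)
      (fun u => gη (Real.arcsin u) * (1 / √(1 - u ^ 2))) τ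
    rw [sub_self, sub_zero] at e
    have e' := intervalIntegral.integral_comp_sub_left (a := 0) (b := τ)
      (fun u => -(p * 4) * (1 / √(1 - u ^ 2))) τ
    rw [sub_self, sub_zero] at e'
    rw [← e, ← intervalIntegral.integral_add hi4 hi3]
    calc _ ≤ ∫ a in (0 : ℝ)..τ, (-(p * 4) * (1 / √(1 - (τ - a) ^ 2)) +
          -(p * 4) * (1 / √(1 - a ^ 2))) := by
          refine intervalIntegral.integral_mono_on_of_le_Ioo h0.le (hi4.add hi3) (hj2.add hj1)
            fun a ha => ?_
          have hc := hclasp a (Ioo_subset_Icc_self ha)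
          have h11 := hc 1 1 (Or.inl rfl) (Or.inl rfl)
          have h12 := hc 1 (-1) (Or.inl rfl) (Or.inr rfl)
          have h21 := hc (-1) 1 (Or.inr rfl) (Or.inl rfl)
          have h22 := hc (-1) (-1) (Or.inr rfl) (Or.inr rfl)
          refine contact_balance h0 h1 ha hp (η₁ := η (Real.arcsin (τ - a)))
            (η₂ := η (-Real.arcsin (τ - a))) (ζ₁ := ζ (Real.arcsin a)) (ζ₂ := ζ (-Real.arcsin a))
            ?_ ?_ ?_ ?_
          · simpa only [one_mul] using h11
          · simpa only [one_mul, neg_mul] using h12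
          · simpa only [one_mul, neg_mul] using h21
          · simpa only [one_mul, neg_mul] using h22
      _ = _ := by
          rw [intervalIntegral.integral_add hj2 hj1, e', hone]
          ring
  linarith

end

/-! ### The curvature force of the chained clasp -/

section

variable {τ c d : ℝ}

theorem hasDerivAt_gammaTangent_of_lt {s : ℝ} (hs : |s| < Real.arcsin τ) :
    HasDerivAt (gammaTangent τ) (gammaNormal s) s := by
  have h := hasDerivAt_clamp_of_abs_lt hs
  refine ((hasDerivAt_const s (0 : ℝ)).vec3 h.cos h.sin).congr_deriv ?_
  rw [clamp_of_abs_le hs.le, gammaNormal, mul_one, mul_one]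

theorem hasDerivAt_gammaTangent_of_gt (h0 : 0 < τ) {s : ℝ} (hs : Real.arcsin τ < |s|) :
    HasDerivAt (gammaTangent τ) 0 s := by
  have h := hasDerivAt_clamp_of_lt_abs (arcsin_pos h0).le hs
  refine ((hasDerivAt_const s (0 : ℝ)).vec3 h.cos h.sin).congr_deriv ?_
  ext i
  fin_cases i <;> simp

theorem hasDerivAt_alphaAngle (hd : 1 ≤ d) {s k : ℝ} (hs : s < alphaHalf d)
    (h : HasDerivAt (clamp (Real.pi / 2)) k s) : HasDerivAt (alphaAngle d) k s := by
  have hpi := Real.pi_pos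
  have h2 : HasDerivAt (fun s => clamp (Real.pi / 2) (s - 2 * alphaHalf d)) 0 s := by
    have h3 : HasDerivAt (clamp (Real.pi / 2)) 0 (s - 2 * alphaHalf d) := by
      refine hasDerivAt_clamp_of_lt_abs (by linarith) (lt_abs.2 (Or.inr ?_))
      rw [alphaHalf] at hs ⊢
      linarith
    exact (h3.comp s ((hasDerivAt_id s).sub_const (2 * alphaHalf d))).congr_deriv (zero_mul _)
  exact ((h.add h2).add_const (Real.pi / 2)).congr_deriv (add_zero k)

theorem hasDerivAt_alphaTangent_of_lt (hd : 1 ≤ d) {s : ℝ} (hs : |s| < Real.pi / 2) :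
    HasDerivAt (alphaTangent d) (alphaNormal s) s := by
  have hs' : s < alphaHalf d := by
    rw [alphaHalf]
    linarith [le_abs_self s]
  have h := hasDerivAt_alphaAngle hd hs' (hasDerivAt_clamp_of_abs_lt hs)
  refine (h.cos.vec3 (hasDerivAt_const s (0 : ℝ)) h.sin.neg).congr_deriv ?_
  rw [alphaAngle_of_le hd hs'.le, clamp_of_abs_le hs.le, alphaNormal, mul_one, mul_one]

theorem hasDerivAt_alphaTangent_of_gt (hd : 1 ≤ d) {s : ℝ} (hs : Real.pi / 2 < |s|)
    (hs' : |s| < alphaHalf d) : HasDerivAt (alphaTangent d) 0 s := by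
  have h := hasDerivAt_alphaAngle hd ((le_abs_self s).trans_lt hs')
    (hasDerivAt_clamp_of_lt_abs (by positivity) hs)
  refine (h.cos.vec3 (hasDerivAt_const s (0 : ℝ)) h.sin.neg).congr_deriv ?_
  ext i
  fin_cases i <;> simp

theorem alphaTangent_reflect (d s : ℝ) :
    alphaTangent d (2 * alphaHalf d - s) = -reflZ (alphaTangent d s) := by
  have hpi : 0 ≤ Real.pi / 2 := by positivity
  have h : alphaAngle d (2 * alphaHalf d - s) = Real.pi - alphaAngle d s := by
    rw [alphaAngle, alphaAngle, show 2 * alphaHalf d - s - 2 * alphaHalf d = -s by ring,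
      show 2 * alphaHalf d - s = -(s - 2 * alphaHalf d) by ring, clamp_neg hpi, clamp_neg hpi]
    ring
  rw [alphaTangent, alphaTangent, h, Real.cos_pi_sub, Real.sin_pi_sub, reflZ_vec3]
  ext i
  fin_cases i <;> simp

/-- Reflection reverses the orientation of `α`, hence the sign of the tangent. Differentiating at
the reversed parameter changes the sign again, so curvature vectors are simply reflected. -/
theorem hasDerivAt_alphaTangent_reflect {s : ℝ} {T' : E3} (h : HasDerivAt (alphaTangent d) T' s) :
    HasDerivAt (alphaTangent d) (reflZ T') (2 * alphaHalf d - s) := by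
  have h2 : HasDerivAt (fun x => 2 * alphaHalf d - x) (-1) (2 * alphaHalf d - s) := by
    simpa using (hasDerivAt_id (2 * alphaHalf d - s)).const_sub (2 * alphaHalf d)
  have h' : HasDerivAt (alphaTangent d) T' (2 * alphaHalf d - (2 * alphaHalf d - s)) := by
    rwa [sub_sub_cancel]
  have h3 := (h'.scomp _ h2).reflZ.neg
  have he : alphaTangent d = fun x =>
      -reflZ ((alphaTangent d ∘ fun x => 2 * alphaHalf d - x) x) := by
    funext x
    rw [Function.comp, ← alphaTangent_reflect, sub_sub_cancel]
  rw [he]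
  refine h3.congr_deriv ?_
  rw [neg_one_smul, reflZ_neg, neg_neg]

/-- The parameter measures of the components, with respect to which the curvature force has the
derivative of the unit tangent as density. -/
def linkMeasure (τ d c : ℝ) (i : Fin 3) : Measure ℝ :=
  volume.restrict ((chainedClasp τ d c).strand i).dom

/-- The density of the curvature force of the chained clasp. -/
def linkNormal (τ d : ℝ) (i : Fin 3) : ℝ → E3 := deriv (linkTangent τ d i)

/-- The measures are already restricted to the parameter intervals, to be finite; the second
restriction in the pairing has no effect. -/
theorem forcePairing_term (τ c d : ℝ) (ξ : Fin 3 → ℝ → E3) (i : Fin 3) :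
    ∫ s in ((chainedClasp τ d c).strand i).dom, ⟪ξ i s, linkNormal τ d i s⟫ ∂(linkMeasure τ d c i) =
      ∫ s in ((chainedClasp τ d c).strand i).dom, ⟪ξ i s, deriv (linkTangent τ d i) s⟫ := by
  rw [linkMeasure, Measure.restrict_restrict (by exact measurableSet_Icc), inter_self]
  rfl

/-- The ends are orthogonal to the walls, so compatible fields are orthogonal to the tangent there
and the boundary terms of the length variation disappear. -/
theorem gammaTangent_right (h0 : 0 < τ) (h1 : τ ≤ 1) {l : ℝ} (hl : 0 ≤ l) :
    gammaTangent τ (Real.arcsin τ + l) = wallNormal τ 1 1 := by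
  rw [gammaTangent, clamp_of_le (arcsin_pos h0).le (by linarith), sin_arcsin_self h0 h1,
    Real.cos_arcsin, wallNormal, one_mul, one_mul]

theorem gammaTangent_left (h0 : 0 < τ) (h1 : τ ≤ 1) {l : ℝ} (hl : 0 ≤ l) :
    gammaTangent τ (-(Real.arcsin τ + l)) = -wallNormal τ (-1) 1 := by
  rw [gammaTangent, clamp_of_le_neg (arcsin_pos h0).le (by linarith), Real.sin_neg, Real.cos_neg,
    sin_arcsin_self h0 h1, Real.cos_arcsin, wallNormal]
  ext i
  fin_cases i <;> simp

theorem reflZ_wallNormal (τ σ ρ : ℝ) : reflZ (wallNormal τ σ ρ) = wallNormal τ σ (-ρ) := by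
  rw [wallNormal, wallNormal, reflZ_vec3, neg_mul]

theorem alphaTangent_closes (hd : 1 ≤ d) :
    alphaTangent d (-alphaHalf d) = alphaTangent d (3 * alphaHalf d) := by
  have hh := alphaHalf_pos hd
  have h : alphaTangent d (-alphaHalf d) = !₂[0, 0, 1] := by
    rw [alphaTangent, alphaAngle_of_le hd (by linarith),
      clamp_of_le_neg (by positivity) (by rw [alphaHalf]; linarith)]
    simp
  have h2 := alphaTangent_reflect d (-alphaHalf d)
  rw [show 2 * alphaHalf d - -alphaHalf d = 3 * alphaHalf d by ring, h, reflZ_vec3] at h2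
  rw [h, h2]
  ext i
  fin_cases i <;> simp

/-- The boundary terms of the first variation of length vanish for compatible fields. -/
theorem boundary_term_eq_zero (h0 : 0 < τ) (h1 : τ ≤ 1) (hd : 1 ≤ d) (he : 0 ≤ endLength τ d c)
    {ξ : Fin 3 → ℝ → E3} (hξ : (chainedClasp τ d c).Compatible ξ) (i : Fin 3) :
    ⟪ξ i ((chainedClasp τ d c).strand i).right,
        linkTangent τ d i ((chainedClasp τ d c).strand i).right⟫ -
      ⟪ξ i ((chainedClasp τ d c).strand i).left,
        linkTangent τ d i ((chainedClasp τ d c).strand i).left⟫ = 0 := by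
  obtain ⟨-, hcl, hop⟩ := hξ i
  fin_cases i
  · have h2 : ξ 0 (-alphaHalf d) = ξ 0 (3 * alphaHalf d) := hcl trivial
    change ⟪ξ 0 (3 * alphaHalf d), alphaTangent d (3 * alphaHalf d)⟫ -
      ⟪ξ 0 (-alphaHalf d), alphaTangent d (-alphaHalf d)⟫ = 0
    rw [h2, alphaTangent_closes hd, sub_self]
  · obtain ⟨hl, hr⟩ := hop id
    have hl := mem_direction_wallPlane hl
    have hr := mem_direction_wallPlane hr
    change ⟪ξ 1 (Real.arcsin τ + endLength τ d c),
        reflZ (gammaTangent τ (Real.arcsin τ + endLength τ d c))⟫ -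
      ⟪ξ 1 (-(Real.arcsin τ + endLength τ d c)),
        reflZ (gammaTangent τ (-(Real.arcsin τ + endLength τ d c)))⟫ = 0
    rw [gammaTangent_left h0 h1 he, gammaTangent_right h0 h1 he, reflZ_neg, inner_neg_right,
      reflZ_wallNormal, reflZ_wallNormal, real_inner_comm]
    rw [real_inner_comm] at hl
    exact (congrArg₂ (fun x y => x - -y) hr hl).trans (by norm_num)
  · obtain ⟨hl, hr⟩ := hop id
    have hl := mem_direction_wallPlane hl
    have hr := mem_direction_wallPlane hr
    change ⟪ξ 2 (Real.arcsin τ + endLength τ d c),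
        gammaTangent τ (Real.arcsin τ + endLength τ d c)⟫ -
      ⟪ξ 2 (-(Real.arcsin τ + endLength τ d c)),
        gammaTangent τ (-(Real.arcsin τ + endLength τ d c))⟫ = 0
    rw [gammaTangent_left h0 h1 he, gammaTangent_right h0 h1 he, inner_neg_right, real_inner_comm]
    rw [real_inner_comm] at hl
    exact (congrArg₂ (fun x y => x - -y) hr hl).trans (by norm_num)

theorem chainedClasp_isCurvatureForce (h0 : 0 < τ) (h1 : τ ≤ 1) (hd : 1 ≤ d)
    (he : 0 ≤ endLength τ d c) :
    (chainedClasp τ d c).IsCurvatureForce (linkMeasure τ d c) (linkNormal τ d) := by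
  refine ⟨fun i => ⟨?_, ?_⟩, fun ξ hξ hlip => ?_⟩
  · exact isFiniteMeasure_restrict.2 (measure_Icc_lt_top.ne)
  · obtain ⟨K, hK⟩ := isLip_linkTangent τ d i
    exact LipschitzOnWith.integrableOn_deriv (hK.lipschitzOnWith (s := Icc _ _))
  · have hsum : ∀ i, HasDerivAt (fun t => (((chainedClasp τ d c).vary ξ t).strand i).length)
        (-∫ s in ((chainedClasp τ d c).strand i).dom, ⟪ξ i s, deriv (linkTangent τ d i) s⟫) 0 := by
      intro i
      obtain ⟨Kc, hc⟩ := chainedClasp_isLip (c := c) h0 h1 hd i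
      obtain ⟨KT, hT⟩ := isLip_linkTangent τ d i
      obtain ⟨Kξ, hKξ⟩ := hlip i
      have h := hasDerivAt_length_vary (chainedClasp_left_lt_right h0 hd he i).le
        hc.lipschitzOnWith hT (norm_linkTangent τ d i)
        ((chainedClasp_ae_hasDerivAt (c := c) h0 h1 hd i).mono fun s h _ => h) hKξ
      rw [boundary_term_eq_zero h0 h1 hd he hξ, zero_sub] at h
      exact h
    have h := HasDerivAt.fun_sum fun i (_ : i ∈ Finset.univ) => hsum i
    refine h.congr_deriv ?_
    rw [GeneralizedLink.forcePairing, Finset.sum_neg_distrib]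
    simp only [forcePairing_term]

theorem integral_gamma (h0 : 0 < τ) (he : 0 ≤ endLength τ d c) {ζ : ℝ → E3}
    (hζ : ContinuousOn ζ ((chainedClasp τ d c).strand 2).dom) :
    ∫ s in ((chainedClasp τ d c).strand 2).dom, ⟪ζ s, deriv (gammaTangent τ) s⟫ =
      ∫ s in (0 : ℝ)..Real.arcsin τ, (⟪ζ s, gammaNormal s⟫ + ⟪ζ (-s), gammaNormal (-s)⟫) :=
  integral_inner_eq_of_support (arcsin_pos h0).le (by linarith) hζ continuous_gammaNormal
    (fun _ hs => (hasDerivAt_gammaTangent_of_lt hs).deriv)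
    (fun _ hs _ => (hasDerivAt_gammaTangent_of_gt h0 hs).deriv)

theorem continuous_reflZ : Continuous reflZ := reflZEquiv.continuous

theorem integral_beta (h0 : 0 < τ) (he : 0 ≤ endLength τ d c) {ζ : ℝ → E3}
    (hζ : ContinuousOn ζ ((chainedClasp τ d c).strand 1).dom) :
    ∫ s in ((chainedClasp τ d c).strand 1).dom,
        ⟪ζ s, deriv (fun s => reflZ (gammaTangent τ s)) s⟫ =
      ∫ s in (0 : ℝ)..Real.arcsin τ,
        (⟪reflZ (ζ s), gammaNormal s⟫ + ⟪reflZ (ζ (-s)), gammaNormal (-s)⟫) := by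
  simp only [← inner_reflZ_right]
  refine integral_inner_eq_of_support (N := fun s => reflZ (gammaNormal s)) (arcsin_pos h0).le
    (by linarith) hζ (continuous_reflZ.comp continuous_gammaNormal)
    (fun _ hs => (hasDerivAt_gammaTangent_of_lt hs).reflZ.deriv)
    (fun _ hs _ => (hasDerivAt_gammaTangent_of_gt h0 hs).reflZ.deriv.trans ?_)
  exact map_zero reflZEquiv

/-- Splitting at the junction and reversing the second half turns the lower clasp into a reflected
copy of the upper one, so that `clasp_balance` serves for both. -/
theorem integral_alpha (hd : 1 ≤ d) {η : ℝ → E3}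
    (hη : ContinuousOn η ((chainedClasp τ d c).strand 0).dom) :
    ∫ s in ((chainedClasp τ d c).strand 0).dom, ⟪η s, deriv (alphaTangent d) s⟫ =
      (∫ s in (0 : ℝ)..Real.pi / 2, (⟪η s, alphaNormal s⟫ + ⟪η (-s), alphaNormal (-s)⟫)) +
      ∫ s in (0 : ℝ)..Real.pi / 2, (⟪reflZ (η (2 * alphaHalf d - s)), alphaNormal s⟫ +
        ⟪reflZ (η (2 * alphaHalf d - -s)), alphaNormal (-s)⟫) := by
  have hh := alphaHalf_pos hd
  have hle : Real.pi / 2 ≤ alphaHalf d := by rw [alphaHalf]; linarith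
  have hpi : 0 ≤ Real.pi / 2 := by positivity
  have hη : ContinuousOn η (Icc (-alphaHalf d) (3 * alphaHalf d)) := hη
  obtain ⟨K, hK⟩ := isLip_alphaTangent d
  have hint :=
    (hK.lipschitzOnWith (s := Icc (-alphaHalf d) (3 * alphaHalf d))).integrableOn_inner_deriv hη
  have hii : ∀ a b, -alphaHalf d ≤ a → a ≤ b → b ≤ 3 * alphaHalf d →
      IntervalIntegrable (fun s => ⟪η s, deriv (alphaTangent d) s⟫) volume a b := by
    intro a b ha hab hb
    rw [intervalIntegrable_iff_integrableOn_Icc_of_le hab]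
    exact hint.mono_set (Icc_subset_Icc ha hb)
  have hη1 : ContinuousOn η (Icc (-alphaHalf d) (alphaHalf d)) :=
    hη.mono (Icc_subset_Icc_right (by linarith))
  have hη2 : ContinuousOn (fun s => η (2 * alphaHalf d - s)) (Icc (-alphaHalf d) (alphaHalf d)) :=
    hη.comp (by fun_prop) fun s hs => ⟨by linarith [hs.2], by linarith [hs.1]⟩
  have e1 := integral_inner_eq_of_support hpi hle hη1 continuous_alphaNormal
    (fun _ hs => (hasDerivAt_alphaTangent_of_lt hd hs).deriv)
    (fun _ hs hs' => (hasDerivAt_alphaTangent_of_gt hd hs hs').deriv)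
  have e2 := integral_inner_eq_of_support
    (T' := fun s => deriv (alphaTangent d) (2 * alphaHalf d - s))
    (N := fun s => reflZ (alphaNormal s)) hpi hle hη2
    (continuous_reflZ.comp continuous_alphaNormal)
    (fun _ hs => (hasDerivAt_alphaTangent_reflect (hasDerivAt_alphaTangent_of_lt hd hs)).deriv)
    (fun _ hs hs' => (hasDerivAt_alphaTangent_reflect
      (hasDerivAt_alphaTangent_of_gt hd hs hs')).deriv.trans (map_zero reflZEquiv))
  simp only [← inner_reflZ_right]
  rw [← e1, ← e2]
  change ∫ s in Icc (-alphaHalf d) (3 * alphaHalf d), _ = _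
  rw [integral_Icc_eq_integral_Ioc, integral_Icc_eq_integral_Ioc, integral_Icc_eq_integral_Ioc,
    ← intervalIntegral.integral_of_le (by linarith),
    ← intervalIntegral.integral_of_le (by linarith),
    ← intervalIntegral.integral_of_le (by linarith),
    ← intervalIntegral.integral_add_adjacent_intervals (hii (-alphaHalf d) (alphaHalf d) le_rfl
      (by linarith) (by linarith)) (hii _ _ (by linarith) (by linarith) le_rfl)]
  have := intervalIntegral.integral_comp_sub_left (a := -alphaHalf d) (b := alphaHalf d)
    (fun s => ⟪η s, deriv (alphaTangent d) s⟫) (2 * alphaHalf d)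
  rw [this]
  congr 2 <;> ring

/-! ### Strong criticality -/

/-- Adding `clasp_balance` for the upper and the lower clasp leaves the residual forces at the tips.
The hypothesis `hd1` provides the strut between them exactly when the coefficient `1 - τ` is
nonzero. -/
theorem chainedClasp_isStronglyCritical (h0 : 0 < τ) (h1 : τ ≤ 1) (hd : 1 ≤ d)
    (hd1 : τ < 1 → d = 1) (he : 0 ≤ endLength τ d c) :
    (chainedClasp τ d c).IsStronglyCritical := by
  have hpi := Real.pi_pos
  have hθ := arcsin_pos h0
  have hπ := Real.arcsin_le_pi_div_two τ
  -- `M` bounds the mass of the strut measure: `6 * arcsin τ + π` for each of the two clasps, and `2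
  -- * (1 - τ)` for the strut between the tips.
  set M : ℝ := 2 * (6 * Real.arcsin τ + Real.pi) + 2 * (1 - τ) with hM
  have hMpos : 0 < M := by rw [hM]; linarith
  refine ⟨linkMeasure τ d c, linkNormal τ d, chainedClasp_isCurvatureForce h0 h1 hd he, 1 / M,
    by positivity, fun ξ hξ hlen => ?_⟩
  have hc : ∀ i, ContinuousOn ((chainedClasp τ d c).strand i).path
      ((chainedClasp τ d c).strand i).dom := fun i =>
    (chainedClasp_isLip h0 h1 hd i).choose_spec.continuous.continuousOn
  have hne : (chainedClasp τ d c).pairs.Nonempty :=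
    ⟨(0, 2, 0, 0), by decide, (mem_dom_alpha hd (by simpa using by positivity)).1,
      (mem_dom_gamma he (by simpa using hθ.le)).1⟩
  obtain ⟨p, hp, hstrut⟩ := GeneralizedLink.exists_hasDerivWithinAt_gThi hc
    (chainedClasp_gThi h0 h1 hd he) hne fun i => (hξ i).1
  choose σ ρ _ _ hobs using exists_obstacle_eq τ c d
  obtain ⟨q, hq⟩ := GeneralizedLink.exists_hasDerivWithinAt_obstacleMin
    (fun i => (chainedClasp_left_lt_right h0 hd he i).le) hc hobs fun i => (hξ i).1
  refine ⟨p, q, hp, hq, (min_le_left _ _).trans ?_⟩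
  by_contra! hlt
  -- Replacing the mass of the contact struts by a larger bound is legitimate only for a nonpositive
  -- rate, hence the truncation at zero.
  set p' := min p 0 with hp'
  have hp'0 : p' ≤ 0 := min_le_right _ _
  have hp'p : p' ≤ p := min_le_left _ _
  have hp'M : -1 < p' * M := by
    have : -(1 / M) < p' := lt_min hlt (by simpa using hMpos)
    have := mul_lt_mul_of_pos_right this hMpos
    rwa [neg_mul, one_div_mul_cancel hMpos.ne'] at this
  have hξ0 := (hξ 0).1
  have hξ1 := (hξ 1).1
  have hξ2 := (hξ 2).1
  have hpair : (chainedClasp τ d c).forcePairing (linkMeasure τ d c) (linkNormal τ d) ξ = 1 := by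
    linarith
  rw [GeneralizedLink.forcePairing, Fin.sum_univ_three, forcePairing_term, forcePairing_term,
    forcePairing_term] at hpair
  have hsplit : ((∫ s in (0 : ℝ)..Real.pi / 2,
        (⟪ξ 0 s, alphaNormal s⟫ + ⟪ξ 0 (-s), alphaNormal (-s)⟫)) +
      ∫ s in (0 : ℝ)..Real.pi / 2, (⟪reflZ (ξ 0 (2 * alphaHalf d - s)), alphaNormal s⟫ +
        ⟪reflZ (ξ 0 (2 * alphaHalf d - -s)), alphaNormal (-s)⟫)) +
      (∫ s in (0 : ℝ)..Real.arcsin τ,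
        (⟪reflZ (ξ 1 s), gammaNormal s⟫ + ⟪reflZ (ξ 1 (-s)), gammaNormal (-s)⟫)) +
      ∫ s in (0 : ℝ)..Real.arcsin τ,
        (⟪ξ 2 s, gammaNormal s⟫ + ⟪ξ 2 (-s), gammaNormal (-s)⟫) = 1 := by
    rw [← integral_alpha hd hξ0, ← integral_beta h0 he hξ1, ← integral_gamma h0 he hξ2]
    exact hpair
  have hdomα : ∀ {s}, |s| ≤ Real.pi / 2 → _ := fun {s} hs => mem_dom_alpha (τ := τ) (c := c) hd hs
  have hdomγ : ∀ {s}, |s| ≤ Real.arcsin τ → _ := fun {s} hs => mem_dom_gamma (d := d) (c := c) he hs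
  have hsgn : ∀ {a ε}, a ∈ Icc 0 τ → (ε = 1 ∨ ε = -1) → |ε * Real.arcsin a| ≤ Real.arcsin τ := by
    intro a ε ha hε
    have := arcsin_mem_Icc ha
    rcases hε with rfl | rfl <;> simpa [abs_of_nonneg this.1] using this.2
  have hflip : ∀ {a}, a ∈ Icc 0 τ → τ - a ∈ Icc 0 τ := fun {a} ha =>
    ⟨by linarith [ha.2], by linarith [ha.1]⟩
  have htip : |(0 : ℝ)| ≤ Real.arcsin τ := by simpa using hθ.le
  have upper := clasp_balance h0 h1 hp'0 (η := ξ 0) (ζ := ξ 2)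
    (hξ0.mono fun s hs => (hdomα (abs_le.2 hs)).1) (hξ2.mono fun s hs => (hdomγ (abs_le.2 hs)).1)
    (fun a ha ε ε' hε hε' => by
      refine hp'p.trans ?_
      rw [← alphaPath_sub_gammaPath (d := d) h0 h1 hd ha hε hε']
      refine hstrut 0 2 _ _ (by decide) (hdomα ((hsgn (hflip ha) hε).trans hπ)).1
        (hdomγ (hsgn ha hε')).1 ?_
      change ‖alphaPath τ d _ - gammaPath τ d _‖ = 1
      rw [alphaPath_sub_gammaPath h0 h1 hd ha hε hε', norm_contact h0 h1 ha hε hε'])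
    (fun s hs hs' => by
      refine hp'p.trans ?_
      rw [← alphaPath_sub_tip h0 hd hs hs']
      refine hstrut 0 2 _ _ (by decide) (hdomα hs').1 (hdomγ htip).1 ?_
      change ‖alphaPath τ d _ - gammaPath τ d _‖ = 1
      rw [alphaPath_sub_tip h0 hd hs hs', norm_sin_cos])
  have lower := clasp_balance h0 h1 hp'0 (η := fun s => reflZ (ξ 0 (2 * alphaHalf d - s)))
    (ζ := fun s => reflZ (ξ 1 s))
    (continuous_reflZ.comp_continuousOn
      (hξ0.comp (by fun_prop) fun s hs => (hdomα (abs_le.2 hs)).2))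
    (continuous_reflZ.comp_continuousOn (hξ1.mono fun s hs => (hdomγ (abs_le.2 hs)).2))
    (fun a ha ε ε' hε hε' => by
      refine hp'p.trans ?_
      have e : alphaPath τ d (2 * alphaHalf d - ε * Real.arcsin (τ - a)) -
          reflZ (gammaPath τ d (ε' * Real.arcsin a)) =
          reflZ !₂[ε * claspX τ (τ - a), -(ε' * claspX τ a), contactHeight τ a] := by
        rw [alphaPath_reflect hd, ← reflZ_sub, alphaPath_sub_gammaPath h0 h1 hd ha hε hε']
      rw [← reflZ_sub, inner_reflZ_right, ← e]
      refine hstrut 0 1 _ _ (by decide) (hdomα ((hsgn (hflip ha) hε).trans hπ)).2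
        (hdomγ (hsgn ha hε')).2 ?_
      change ‖alphaPath τ d _ - reflZ (gammaPath τ d _)‖ = 1
      rw [e, norm_reflZ, norm_contact h0 h1 ha hε hε'])
    (fun s hs hs' => by
      refine hp'p.trans ?_
      have e : alphaPath τ d (2 * alphaHalf d - s) - reflZ (gammaPath τ d 0) =
          reflZ !₂[Real.sin s, 0, Real.cos s] := by
        rw [alphaPath_reflect hd, ← reflZ_sub, alphaPath_sub_tip h0 hd hs hs']
      rw [← reflZ_sub, inner_reflZ_right, ← e]
      refine hstrut 0 1 _ _ (by decide) (hdomα hs').2 (hdomγ htip).2 ?_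
      change ‖alphaPath τ d _ - reflZ (gammaPath τ d _)‖ = 1
      rw [e, norm_reflZ, norm_sin_cos])
  -- For `τ = 1` both sides vanish and no strut between the tips is required.
  have tips : (1 - τ) * p' ≤ (1 - τ) * (ξ 2 0 2 + reflZ (ξ 1 0) 2) := by
    rcases h1.lt_or_eq with hlt1 | rfl
    · refine mul_le_mul_of_nonneg_left (hp'p.trans ?_) (by linarith)
      have e : gammaPath τ d 0 - reflZ (gammaPath τ d 0) = !₂[0, 0, 1] := by
        rw [gammaPath_zero h0, reflZ_vec3, hd1 hlt1]
        ext i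
        fin_cases i
        · simp
        · simp
        · simp
          norm_num
      have h := hstrut 2 1 0 0 (by decide) (hdomγ htip).1 (hdomγ htip).2 (by
        change ‖gammaPath τ d 0 - reflZ (gammaPath τ d 0)‖ = 1
        rw [e, ← sq_eq_sq₀ (norm_nonneg _) zero_le_one, norm_sq_vec3]
        simp)
      have h' : p ≤ ⟪gammaPath τ d 0 - reflZ (gammaPath τ d 0), ξ 2 0 - ξ 1 0⟫ := h
      rw [e, inner_vec3] at h'
      simp [reflZ] at h' ⊢
      linarith
    · simp
  linarith

end

section

variable {τ c d : ℝ}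

/-! ### The strut between the tips -/

theorem tips_isolated (h0 : 0 < τ) (h1 : τ ≤ 1) (he : 0 ≤ endLength τ 1 c) :
    let tips : E3 × E3 :=
      (((chainedClasp τ 1 c).strand 1).path 0, ((chainedClasp τ 1 c).strand 2).path 0)
    tips ∈ (chainedClasp τ 1 c).gStrut ∧
      ∃ r : ℝ, 0 < r ∧ ∀ p ∈ (chainedClasp τ 1 c).gStrut, dist p tips < r → p = tips := by
  intro tips
  have htip : |(0 : ℝ)| ≤ Real.arcsin τ := by simpa using (arcsin_pos h0).le
  have hdom := mem_dom_gamma (d := 1) (c := c) he htip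
  have hgThi := chainedClasp_gThi h0 h1 le_rfl he
  constructor
  · refine ⟨1, 2, by decide, 0, hdom.2, 0, hdom.1, rfl, ?_⟩
    rw [hgThi]
    change dist (reflZ (gammaPath τ 1 0)) (gammaPath τ 1 0) = 1
    rw [← sq_eq_sq₀ dist_nonneg zero_le_one, dist_sq_vec3, gammaPath_zero h0, reflZ_vec3]
    simp
    norm_num
  -- Radius one suffices: a point within distance less than one of a tip lies on the same component
  -- as that tip. A strut from `β` to `γ` then has no room for positive heights above the tips.
  · refine ⟨1, one_pos, ?_⟩
    rintro _ ⟨i, j, hij, s, hs, t, ht, rfl, hst⟩ hlt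
    rw [Prod.dist_eq, max_lt_iff] at hlt
    have hi : i = 1 := by
      by_contra h
      exact absurd (chainedClasp_one_le_dist h0 h1 le_rfl h hs hdom.2) (not_le.2 hlt.1)
    have hj : j = 2 := by
      by_contra h
      exact absurd (chainedClasp_one_le_dist h0 h1 le_rfl h ht hdom.1) (not_le.2 hlt.2)
    subst hi hj
    rw [hgThi] at hst
    have h := dist_sq_beta_gamma (d := 1) h0 h1 s t
    have hst : dist (reflZ (gammaPath τ 1 s)) (gammaPath τ 1 t) = 1 := hst
    rw [hst] at h
    have hs0 := gammaHeight_nonneg h0 h1 s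
    have ht0 := gammaHeight_nonneg h0 h1 t
    have e1 : s = 0 := by
      by_contra hne
      nlinarith [gammaHeight_pos h0 h1 hne]
    have e2 : t = 0 := by
      by_contra hne
      nlinarith [gammaHeight_pos h0 h1 hne]
    rw [e1, e2]

/-! ### Lengths -/

/-- A clasp arc ends with unit speed in the angle parameter, hence with curvature one, like the
adjoining circle. This makes the speed of the whole curve continuous. -/
theorem claspXDeriv_self (τ : ℝ) : claspXDeriv τ τ = 1 := by
  simp [claspXDeriv, claspRatio, claspRatioDeriv]

theorem upperSpeed_eq (h0 : 0 < τ) (h1 : τ ≤ 1) (s : ℝ) :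
    upperSpeed τ s = claspSpeed τ (clamp (Real.arcsin τ) s) := by
  have hθ := (arcsin_pos h0).le
  have hend : claspSpeed τ (Real.arcsin τ) = 1 := by
    rw [claspSpeed, sin_arcsin_self h0 h1, abs_of_pos h0, claspXDeriv_self]
  unfold upperSpeed
  split_ifs with h
  · rw [clamp_of_abs_le h.le]
  · rcases le_abs.1 (not_lt.1 h) with h | h
    · rw [clamp_of_le hθ h, hend]
    · rw [clamp_of_le_neg hθ (by linarith), claspSpeed_neg, hend]

theorem continuous_upperSpeed (h0 : 0 < τ) (h1 : τ ≤ 1) : Continuous (upperSpeed τ) := by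
  rw [funext (upperSpeed_eq h0 h1)]
  exact (continuous_claspSpeed h0 h1).comp (isLip_clamp _).choose_spec.continuous

/-- The length of a clasp arc. -/
def claspLength (τ : ℝ) : ℝ := ∫ s in -Real.arcsin τ..Real.arcsin τ, claspSpeed τ s

theorem integral_upperSpeed (h0 : 0 < τ) (h1 : τ ≤ 1) {R : ℝ} (hR : Real.arcsin τ ≤ R) :
    ∫ s in -R..R, upperSpeed τ s = claspLength τ + 2 * (R - Real.arcsin τ) := by
  have hθ := (arcsin_pos h0).le
  have hi : ∀ a b, IntervalIntegrable (upperSpeed τ) volume a b := fun a b =>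
    (continuous_upperSpeed h0 h1).intervalIntegrable a b
  have e2 : ∫ s in -Real.arcsin τ..Real.arcsin τ, upperSpeed τ s = claspLength τ := by
    refine intervalIntegral.integral_congr fun s hs => ?_
    rw [uIcc_of_le (by linarith)] at hs
    rw [upperSpeed_eq h0 h1, clamp_of_abs_le (abs_le.2 hs)]
  have e1 : ∫ s in -R..-Real.arcsin τ, upperSpeed τ s = ∫ s in -R..-Real.arcsin τ, 1 := by
    refine intervalIntegral.integral_congr fun s hs => ?_
    rw [uIcc_of_le (by linarith)] at hs
    exact if_neg (not_lt.2 (le_abs.2 (Or.inr (by linarith [hs.2]))))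
  have e3 : ∫ s in Real.arcsin τ..R, upperSpeed τ s = ∫ s in Real.arcsin τ..R, 1 := by
    refine intervalIntegral.integral_congr fun s hs => ?_
    rw [uIcc_of_le hR] at hs
    exact if_neg (not_lt.2 (le_abs.2 (Or.inl hs.1)))
  rw [← intervalIntegral.integral_add_adjacent_intervals (hi _ (Real.arcsin τ)) (hi _ R),
    ← intervalIntegral.integral_add_adjacent_intervals (hi _ (-Real.arcsin τ)) (hi _ _), e1, e2, e3,
    intervalIntegral.integral_const, intervalIntegral.integral_const, smul_eq_mul, smul_eq_mul]
  ring

theorem length_eq_integral {C : Strand} (hC : C.left ≤ C.right) {v : ℝ → ℝ} {T : ℝ → E3}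
    (hT : ∀ s, ‖T s‖ = 1) (h : ∀ᵐ s : ℝ, 0 < v s ∧ HasDerivAt C.path (v s • T s) s) :
    C.length = ∫ s in C.left..C.right, v s := by
  rw [Strand.length, Strand.dom, integral_Icc_eq_integral_Ioc,
    ← intervalIntegral.integral_of_le hC]
  refine intervalIntegral.integral_congr_ae ?_
  filter_upwards [h] with s hs _
  rw [hs.2.deriv, norm_smul, hT, mul_one, Real.norm_eq_abs, abs_of_pos hs.1]

theorem length_gamma (h0 : 0 < τ) (h1 : τ ≤ 1) (hd : 1 ≤ d) (he : 0 ≤ endLength τ d c) :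
    ((chainedClasp τ d c).strand 2).length = claspLength τ + 2 * endLength τ d c := by
  rw [length_eq_integral (chainedClasp_left_lt_right h0 hd he 2).le (norm_gammaTangent τ)
    (ae_hasDerivAt_gammaPath h0 h1 d)]
  refine (integral_upperSpeed h0 h1 (by linarith)).trans ?_
  ring

theorem length_beta (h0 : 0 < τ) (h1 : τ ≤ 1) (hd : 1 ≤ d) (he : 0 ≤ endLength τ d c) :
    ((chainedClasp τ d c).strand 1).length = claspLength τ + 2 * endLength τ d c := by
  rw [length_eq_integral (chainedClasp_left_lt_right h0 hd he 1).le (v := upperSpeed τ)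
    (T := fun s => reflZ (gammaTangent τ s))
    (fun s => (norm_reflZ _).trans (norm_gammaTangent τ s))
    ((ae_hasDerivAt_gammaPath h0 h1 d).mono fun s hs => ⟨hs.1, by
      have := hs.2.reflZ
      rwa [reflZ_smul] at this⟩)]
  refine (integral_upperSpeed h0 h1 (by linarith)).trans ?_
  ring

theorem length_alpha (h0 : 0 < τ) (h1 : τ ≤ 1) (hd : 1 ≤ d) (he : 0 ≤ endLength τ d c) :
    ((chainedClasp τ d c).strand 0).length =
      2 * (claspLength τ + 2 * (alphaHalf d - Real.arcsin τ)) := by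
  have hh := alphaHalf_pos hd
  have hle : Real.arcsin τ ≤ alphaHalf d := by
    refine (Real.arcsin_le_pi_div_two τ).trans ?_
    rw [alphaHalf]
    linarith
  have hmin : ∀ s, alphaSpeed τ d s = upperSpeed τ (min s (2 * alphaHalf d - s)) := by
    intro s
    unfold alphaSpeed
    split_ifs with h
    · rw [min_eq_left (by linarith)]
    · rw [min_eq_right (by linarith)]
  have hc := continuous_upperSpeed h0 h1
  have hi : ∀ a b, IntervalIntegrable (alphaSpeed τ d) volume a b := fun a b => by
    rw [funext hmin]
    exact (hc.comp (by fun_prop)).intervalIntegrable a b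
  rw [length_eq_integral (chainedClasp_left_lt_right h0 hd he 0).le (norm_alphaTangent d)
    (ae_hasDerivAt_alphaPath h0 h1 hd)]
  change ∫ s in -alphaHalf d..3 * alphaHalf d, alphaSpeed τ d s = _
  have e1 : ∫ s in -alphaHalf d..alphaHalf d, alphaSpeed τ d s =
      ∫ s in -alphaHalf d..alphaHalf d, upperSpeed τ s := by
    refine intervalIntegral.integral_congr fun s hs => ?_
    rw [uIcc_of_le (by linarith)] at hs
    rw [hmin, min_eq_left (by linarith [hs.2])]
  have e2 : ∫ s in alphaHalf d..3 * alphaHalf d, alphaSpeed τ d s =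
      ∫ s in alphaHalf d..3 * alphaHalf d, upperSpeed τ (2 * alphaHalf d - s) := by
    refine intervalIntegral.integral_congr fun s hs => ?_
    rw [uIcc_of_le (by linarith)] at hs
    rw [hmin, min_eq_right (by linarith [hs.1])]
  rw [← intervalIntegral.integral_add_adjacent_intervals (hi _ (alphaHalf d)) (hi _ _), e1, e2,
    intervalIntegral.integral_comp_sub_left (upperSpeed τ),
    show 2 * alphaHalf d - 3 * alphaHalf d = -alphaHalf d by ring,
    show 2 * alphaHalf d - alphaHalf d = alphaHalf d by ring, integral_upperSpeed h0 h1 hle]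
  ring

end

end

/-! ### The theorem on the chained clasp -/

theorem theorem6p1 :
    -- slanted ends: the tips of `β` and `γ` are at distance one
    (∀ τ c : ℝ, 0 < τ → τ < 1 → 0 ≤ endLength τ 1 c →
      (chainedClasp τ 1 c).IsValid ∧
      (chainedClasp τ 1 c).gThi = 1 ∧
      (chainedClasp τ 1 c).IsStronglyCritical ∧
      -- the strut between the tips is isolated
      (let tips : E3 × E3 :=
        (((chainedClasp τ 1 c).strand 1).path 0, ((chainedClasp τ 1 c).strand 2).path 0)
       tips ∈ (chainedClasp τ 1 c).gStrut ∧
       ∃ r : ℝ, 0 < r ∧ ∀ p ∈ (chainedClasp τ 1 c).gStrut, dist p tips < r → p = tips)) ∧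
    -- vertical ends: a one-parameter family, for a fixed floor and a fixed ceiling
    (∀ c d : ℝ, 1 ≤ d → 0 ≤ endLength 1 d c →
      (chainedClasp 1 d c).IsValid ∧
      (chainedClasp 1 d c).gThi = 1 ∧
      (chainedClasp 1 d c).IsStronglyCritical) ∧
    -- in this family the total length is constant, whereas the length of `α` varies
    (∀ c d d' : ℝ, 1 ≤ d → 0 ≤ endLength 1 d c → 1 ≤ d' → 0 ≤ endLength 1 d' c →
      (chainedClasp 1 d c).length = (chainedClasp 1 d' c).length ∧
      ((chainedClasp 1 d' c).strand 0).length - ((chainedClasp 1 d c).strand 0).length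
        = 2 * (d' - d)) := by
  have h1 : (0 : ℝ) < 1 := one_pos
  refine ⟨fun τ c h0 hτ he => ⟨chainedClasp_isValid h0 hτ.le le_rfl he,
      chainedClasp_gThi h0 hτ.le le_rfl he,
      chainedClasp_isStronglyCritical h0 hτ.le le_rfl (fun _ => rfl) he,
      tips_isolated h0 hτ.le he⟩,
    fun c d hd he => ⟨chainedClasp_isValid h1 le_rfl hd he, chainedClasp_gThi h1 le_rfl hd he,
      chainedClasp_isStronglyCritical h1 le_rfl hd (fun h => absurd h (lt_irrefl _)) he⟩,
    fun c d d' hd he hd' he' => ⟨?_, ?_⟩⟩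
  -- For `τ = 1` the vertical segments of `α` gain `2 * (d' - d)` in all, and each of the four
  -- straight ends of `β` and `γ` loses `(d' - d) / 2`.
  · rw [GeneralizedLink.length, GeneralizedLink.length, Fin.sum_univ_three, Fin.sum_univ_three,
      length_alpha h1 le_rfl hd he, length_alpha h1 le_rfl hd' he', length_beta h1 le_rfl hd he,
      length_beta h1 le_rfl hd' he', length_gamma h1 le_rfl hd he, length_gamma h1 le_rfl hd' he',
      alphaHalf, alphaHalf, endLength, endLength]
    ring
  · rw [length_alpha h1 le_rfl hd he, length_alpha h1 le_rfl hd' he', alphaHalf, alphaHalf]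
    ring
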